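/- **Lemma 4.1.** Let $U=[0,2\pi)$; all functions of $x$ are $2\pi$-periodic, and $H^m(U)$ is the periodic Sobolev space. Let $D=t\partial_t$, let $k:U\to(0,\infty)$ be $C^\infty$, and put $\lambda^{(1)}=0$, $\lambda^{(2)}=-2k$. *Spaces.* Let $\delta>0$, $l\ge 0$ an integer and $a=(a_1,a_2)$ with $a_i:U\to(0,\infty)$ continuous. For $w=(w^{(1)},w^{(2)})$ with $w^{(i)}\in\bigcap_{p=0}^{l}C^p((0,\delta],H^{l-p}(U))$ and $0\le p\le l$, $0<t\le\delta$, set $$S_{p}[w](t)=\sum_{i=1}^{2}\sum_{p'=0}^{p}\sum_{q=0}^{l-p}\int_U t^{2(\lambda^{(i)}(x)-a_i(x))}\,\bigl|\partial_x^qD^{p'}w^{(i)}(t,x)\bigr|^2\,dx,$$ $$E_{\delta,a,l}[w](t)=\Bigl(\sum_{p=0}^{l}S_p[w](t)\Bigr)^{1/2},\qquad \|w\|_{\delta,a,l}=\Bigl(\sum_{p=0}^{l}\,\sup_{0<t\le\delta}S_p[w](t)\Bigr)^{1/2},$$ and let $X_{\delta,a,l}$ be the space of all such $w$ with $\|w\|_{\delta,a,l}<\infty$.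 Define $\tilde E_{\delta,a,l}[w]$, $\|w\|^{\sim}_{\delta,a,l}$ and $\tilde X_{\delta,a,l}$ in the same way, except that each highest spatial derivative $\partial_x^l w^{(i)}$ is multiplied by the additional factor $t$ (that is, $|\partial_x^l w^{(i)}|^2$ is replaced by $t^2|\partial_x^l w^{(i)}|^2$). *Hypotheses.* Let $m\ge 2$ and let $P_*,P_{**},Q_*,Q_{**}\in H^m(U)$, where $P_*$ is identified with its continuous periodic representative. Suppose that $0<\epsilon<1$ and that $\alpha=(\alpha_1,\alpha_2):U\to(0,\infty)^2$ is continuous and periodic, and that at each $x\in U$ $$\alpha_1+\epsilon<\min\bigl(2(P_*+2k),\,2(P_*+1)\bigr),\qquad \alpha_2+\epsilon<2(1-k),\qquad \alpha_1-\alpha_2>\epsilon+\max(0,\,2k-1).$$ *Source operator.* For $w=(w^{(1)},w^{(2)})$ let $F[w]=(F_1[w],F_2[w])$ with $$R=2k\,t^{2k}Q_{**}+Dw^{(2)},\qquad S=t\,\partial_xQ_*+2\,\partial_xk\,t^{2k}\,t\log t\,Q_{**}+t^{2k}\,t\,\partial_xQ_{**}+t\,\partial_xw^{(2)},$$ $$F_1[w]=\bigl(t^{P_*}e^{P_{**}}e^{w^{(1)}}R\bigr)^2-\bigl(t^{P_*}e^{P_{**}}e^{w^{(1)}}S\bigr)^2,$$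 $$F_2[w]=-2\,Dw^{(1)}\,R+2\bigl(t\,\partial_xP_*\log t+t\,\partial_xP_{**}+t\,\partial_xw^{(1)}\bigr)S .$$ *Conclusion.* For every $\delta>0$, $F$ maps $\tilde X_{\delta,\alpha,m}$ into $X_{\delta,\alpha+\epsilon,m-1}$, where $\alpha+\epsilon=(\alpha_1+\epsilon,\alpha_2+\epsilon)$. Moreover, for every $\delta_0>0$ and every $r>0$ there is a constant $C>0$ such that, for all $\delta\in(0,\delta_0]$, $$E_{\delta,\alpha+\epsilon,m-1}\bigl[F[w]-F[\hat w]\bigr](t)\le C\,\tilde E_{\delta,\alpha,m}[w-\hat w](t)\qquad\text{for all } t\in(0,\delta]$$ and all $w,\hat w\in\tilde X_{\delta,\alpha,m}$ with $\|w\|^{\sim}_{\delta,\alpha,m}\le r$ and $\|\hat w\|^{\sim}_{\delta,\alpha,m}\le r$. In particular, on each bounded range of $\delta$ the constant does not depend on $\delta$. -/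

import Mathlib

open MeasureTheory Set
open scoped ENNReal ContDiff

noncomputable section

namespace GowdyFuchs

/-- Lebesgue measure on one period of the spatial variable; `U` is the periodicity domain of
length `2π` (the choice of the included endpoint is immaterial). -/
abbrev measU : Measure ℝ := volume.restrict (Ioc 0 (2 * Real.pi))

/-- The real Hilbert space `L²(U)`. -/
abbrev L2U : Type := Lp ℝ 2 measU

/-- `g` is the weak derivative of `f` on the circle: test functions are the smooth functions that
are periodic with period `2π`. -/
def HasWeakDeriv (f g : L2U) : Prop :=
  ∀ φ : ℝ → ℝ, ContDiff ℝ ∞ φ → Function.Periodic φ (2 * Real.pi) →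
    ∫ x, f x * deriv φ x ∂measU = - ∫ x, g x * φ x ∂measU

theorem integrable_mul_cont (f : L2U) {φ : ℝ → ℝ} (hφ : Continuous φ) :
    Integrable (fun x => f x * φ x) measU := by
  have h1 : MemLp φ ∞ measU := by
    obtain ⟨C, hC⟩ := (isCompact_Icc (a := (0 : ℝ)) (b := 2 * Real.pi)).exists_bound_of_continuousOn
      hφ.continuousOn
    refine memLp_top_of_bound hφ.aestronglyMeasurable C ?_
    filter_upwards [ae_restrict_mem measurableSet_Ioc] with x hx
    exact hC x (Ioc_subset_Icc_self hx)
  have h2 : Integrable (f : ℝ → ℝ) measU := (Lp.memLp f).integrable (by norm_num)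
  exact h2.mul_of_top_left h1

theorem HasWeakDeriv.add {f g f' g' : L2U} (h : HasWeakDeriv f g) (h' : HasWeakDeriv f' g') :
    HasWeakDeriv (f + f') (g + g') := by
  intro φ hφ hp
  have hd : Continuous (deriv φ) := hφ.continuous_deriv (by simp)
  have e1 : ∫ x, (f + f' : L2U) x * deriv φ x ∂measU
      = ∫ x, f x * deriv φ x + f' x * deriv φ x ∂measU := by
    refine integral_congr_ae ?_
    filter_upwards [Lp.coeFn_add f f'] with x hx
    rw [hx, Pi.add_apply, add_mul]
  have e2 : ∫ x, (g + g' : L2U) x * φ x ∂measU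
      = ∫ x, g x * φ x + g' x * φ x ∂measU := by
    refine integral_congr_ae ?_
    filter_upwards [Lp.coeFn_add g g'] with x hx
    rw [hx, Pi.add_apply, add_mul]
  rw [e1, e2, integral_add (integrable_mul_cont f hd) (integrable_mul_cont f' hd),
    integral_add (integrable_mul_cont g hφ.continuous) (integrable_mul_cont g' hφ.continuous),
    h φ hφ hp, h' φ hφ hp]
  ring

theorem HasWeakDeriv.smul {f g : L2U} (c : ℝ) (h : HasWeakDeriv f g) :
    HasWeakDeriv (c • f) (c • g) := by
  intro φ hφ hp
  have e1 : ∫ x, (c • f : L2U) x * deriv φ x ∂measU = ∫ x, c * (f x * deriv φ x) ∂measU := by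
    refine integral_congr_ae ?_
    filter_upwards [Lp.coeFn_smul c f] with x hx
    rw [hx, Pi.smul_apply, smul_eq_mul, mul_assoc]
  have e2 : ∫ x, (c • g : L2U) x * φ x ∂measU = ∫ x, c * (g x * φ x) ∂measU := by
    refine integral_congr_ae ?_
    filter_upwards [Lp.coeFn_smul c g] with x hx
    rw [hx, Pi.smul_apply, smul_eq_mul, mul_assoc]
  rw [e1, e2, integral_const_mul, integral_const_mul, h φ hφ hp]
  ring

theorem HasWeakDeriv.zero : HasWeakDeriv 0 0 := by
  intro φ hφ hp
  have h : ∀ ψ : ℝ → ℝ, ∫ x, (0 : L2U) x * ψ x ∂measU = 0 := by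
    intro ψ
    rw [← integral_zero ℝ ℝ (μ := measU)]
    refine integral_congr_ae ?_
    filter_upwards [Lp.coeFn_zero ℝ 2 measU] with x hx
    rw [hx, Pi.zero_apply, zero_mul]
  rw [h, h, neg_zero]

/-- The periodic Sobolev space `H^m(U)`. An element `f` is recorded as `(f, ∂ₓf, …, ∂ₓ^m f)`, each
entry being the weak derivative of the preceding one, so that the inherited norm is
`(∑_{q ≤ m} ‖∂ₓ^q f‖²_{L²})^{1/2}`. -/
def Sobolev (m : ℕ) : Submodule ℝ (PiLp 2 fun _ : Fin (m + 1) => L2U) where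
  carrier := {u | ∀ q : Fin m, HasWeakDeriv (u q.castSucc) (u q.succ)}
  add_mem' := fun ha hb q => (ha q).add (hb q)
  zero_mem' := fun _ => HasWeakDeriv.zero
  smul_mem' := fun c _ ha q => (ha q).smul c

/-- The function underlying an element of `H^m(U)`. -/
def sobFn {m : ℕ} (u : Sobolev m) : L2U := u.1 0

/-- `f ∈ H^m(U)`, for a function `f`. -/
def MemSobolev (m : ℕ) (f : ℝ → ℝ) : Prop := ∃ u : Sobolev m, f =ᵐ[measU] sobFn u

open Classical in
/-- The class in `L²(U)` of a square integrable function (and `0` for other functions). -/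
def toL2 (f : ℝ → ℝ) : L2U := if h : MemLp f 2 measU then h.toLp f else 0

open Classical in
/-- The weak derivative `∂ₓ f` of `f ∈ L²(U)` (and `0` if there is none in `L²(U)`). -/
def wderiv (f : L2U) : L2U := if h : ∃ g, HasWeakDeriv f g then h.choose else 0

/-- The weak derivative of a function of `x`. -/
def dx (f : ℝ → ℝ) : ℝ → ℝ := wderiv (toL2 f)

/-- `D = t ∂_t` on `L²(U)`-valued functions on `(0,δ]` (one-sided derivative at `t = δ`). -/
def DL2 (δ : ℝ) (c : ℝ → L2U) : ℝ → L2U := fun t => t • derivWithin c (Ioc 0 δ) t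

/-- `∂ₓ^q D^p w (t)` in `L²(U)`, for a function `w = w(t,x)` on `(0,δ] × U`. -/
def mixedDeriv (δ : ℝ) (p q : ℕ) (w : ℝ → ℝ → ℝ) (t : ℝ) : L2U :=
  wderiv^[q] ((DL2 δ)^[p] (fun s => toL2 (w s)) t)

/-- `w ∈ C^p((0,δ], H^j(U))`, for a function `w = w(t,x)`. -/
def MemC (δ : ℝ) (p j : ℕ) (w : ℝ → ℝ → ℝ) : Prop :=
  ∃ W : ℝ → Sobolev j, ContDiffOn ℝ p W (Ioc 0 δ) ∧ ∀ t ∈ Ioc 0 δ, w t =ᵐ[measU] sobFn (W t)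

/-- The quantity
`∑_i ∑_{p' ≤ p} ∑_{q ≤ j} ∫_U t^{2(λ^{(i)}(x) - α^{(i)}(x) + s(q))} |∂ₓ^q D^{p'} w^{(i)}(t,x)|² dx`
for vector-valued `w`, where `s q` is an additional exponent of the weight of `∂ₓ^q`.
For `s = 0` its supremum over `t ∈ (0,δ]` is the square of `‖w‖_{δ,α,p,j}`. -/
def slice {n : ℕ} (δ : ℝ) (lam al : Fin n → ℝ → ℝ) (s : ℕ → ℝ) (p j : ℕ)
    (w : Fin n → ℝ → ℝ → ℝ) (t : ℝ) : ℝ :=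
  ∑ i, ∑ p' ∈ Finset.range (p + 1), ∑ q ∈ Finset.range (j + 1),
    ∫ x, t ^ (2 * (lam i x - al i x + s q)) * (mixedDeriv δ p' q (w i) t x) ^ 2 ∂measU

/-- `(∑_{p ≤ l} slice_{p,l-p}(t))^{1/2}`: the norm before the supremum in `t` is taken. -/
def energy {n : ℕ} (δ : ℝ) (lam al : Fin n → ℝ → ℝ) (s : ℕ → ℝ) (l : ℕ)
    (w : Fin n → ℝ → ℝ → ℝ) (t : ℝ) : ℝ :=
  Real.sqrt (∑ p ∈ Finset.range (l + 1), slice δ lam al s p (l - p) w t)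

/-- `(∑_{p ≤ l} ‖w‖²_{δ,α,p,l-p})^{1/2}`, with values in `[0,∞]`. -/
def wnorm {n : ℕ} (δ : ℝ) (lam al : Fin n → ℝ → ℝ) (s : ℕ → ℝ) (l : ℕ)
    (w : Fin n → ℝ → ℝ → ℝ) : ℝ≥0∞ :=
  (∑ p ∈ Finset.range (l + 1),
    (⨆ t ∈ Ioc 0 δ, ENNReal.ofReal (Real.sqrt (slice δ lam al s p (l - p) w t))) ^ 2) ^ (1 / 2 : ℝ)

/-- The additional exponent in the spaces with a tilde: the highest spatial derivative `∂ₓ^l` gets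
the additional factor `t^{β+1}`, where `β = 0` because the characteristic speeds of both Gowdy
equations are identically `1`. -/
def topWeight (l : ℕ) (q : ℕ) : ℝ := if q = l then 1 else 0

/-- The function `E_{δ,α,l}[w]` on `(0,δ]`. -/
def E {n : ℕ} (δ : ℝ) (lam al : Fin n → ℝ → ℝ) (l : ℕ) (w : Fin n → ℝ → ℝ → ℝ) : ℝ → ℝ :=
  energy δ lam al 0 l w

/-- The function `Ẽ_{δ,α,l}[w]` on `(0,δ]`. -/
def Et {n : ℕ} (δ : ℝ) (lam al : Fin n → ℝ → ℝ) (l : ℕ) (w : Fin n → ℝ → ℝ → ℝ) : ℝ → ℝ :=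
  energy δ lam al (topWeight l) l w

/-- The norm of `X_{δ,α,l}`. -/
def normX {n : ℕ} (δ : ℝ) (lam al : Fin n → ℝ → ℝ) (l : ℕ) (w : Fin n → ℝ → ℝ → ℝ) : ℝ≥0∞ :=
  wnorm δ lam al 0 l w

/-- The norm of `X̃_{δ,α,l}`. -/
def normXt {n : ℕ} (δ : ℝ) (lam al : Fin n → ℝ → ℝ) (l : ℕ) (w : Fin n → ℝ → ℝ → ℝ) : ℝ≥0∞ :=
  wnorm δ lam al (topWeight l) l w

/-- The space `X_{δ,α,l}` (of functions, two of which are identified if for each `t ∈ (0,δ]` they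
agree almost everywhere in `U`). -/
def X {n : ℕ} (δ : ℝ) (lam al : Fin n → ℝ → ℝ) (l : ℕ) : Set (Fin n → ℝ → ℝ → ℝ) :=
  {w | (∀ i, ∀ p ≤ l, MemC δ p (l - p) (w i)) ∧ normX δ lam al l w < ⊤}

/-- The space `X̃_{δ,α,l}`. -/
def Xt {n : ℕ} (δ : ℝ) (lam al : Fin n → ℝ → ℝ) (l : ℕ) : Set (Fin n → ℝ → ℝ → ℝ) :=
  {w | (∀ i, ∀ p ≤ l, MemC δ p (l - p) (w i)) ∧ normXt δ lam al l w < ⊤}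

/-- The root functions `λ₂` of the two Gowdy equations. -/
def gowdyLam (k : ℝ → ℝ) : Fin 2 → ℝ → ℝ := ![fun _ => 0, fun x => -2 * k x]

/-- `D w` as a function of `(t,x)`. -/
def Dt (δ : ℝ) (w : ℝ → ℝ → ℝ) (t x : ℝ) : ℝ := DL2 δ (fun s => toL2 (w s)) t x

/-- The source-term operator `F = (F₁, F₂)` for the asymptotic data
`Ps = P_*`, `Pss = P_{**}`, `Qs = Q_*`, `Qss = Q_{**}`. -/
def gowdyF (δ : ℝ) (k Ps Pss Qs Qss : ℝ → ℝ) (w : Fin 2 → ℝ → ℝ → ℝ) : Fin 2 → ℝ → ℝ → ℝ :=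
  ![fun t x =>
      (t ^ Ps x * Real.exp (Pss x) * Real.exp (w 0 t x) *
        (2 * k x * t ^ (2 * k x) * Qss x + Dt δ (w 1) t x)) ^ 2
      - (t ^ Ps x * Real.exp (Pss x) * Real.exp (w 0 t x) *
        (t * dx Qs x + 2 * deriv k x * t ^ (2 * k x) * t * Real.log t * Qss x
          + t ^ (2 * k x) * t * dx Qss x + t * dx (w 1 t) x)) ^ 2,
    fun t x =>
      -2 * Dt δ (w 0) t x * (2 * k x * t ^ (2 * k x) * Qss x + Dt δ (w 1) t x)
      + 2 * (t * dx Ps x * Real.log t + t * dx Pss x + t * dx (w 0 t) x) *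
        (t * dx Qs x + 2 * deriv k x * t ^ (2 * k x) * t * Real.log t * Qss x
          + t ^ (2 * k x) * t * dx Qss x + t * dx (w 1 t) x)]

end GowdyFuchs

end

open GowdyFuchs

/-!
All bounds are by powers of `t` with variable exponent. A family of functions has order `t^κ` if its
mixed derivatives of total order at most `n` are `O(t^μ)` in `L²(U)` for every `μ < κ`: the
arbitrarily small loss absorbs the logarithms which appear when `t^κ` is differentiated in `x`, and
the strict inequalities of the hypotheses leave room for it. In dimension one `H¹(U) ⊆ L^∞(U)`, and
the weighted product estimate makes orders add up under multiplication as soon as one derivative is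
available. Writing `P = P_* log t + P_{**} + w⁽¹⁾` and `Q = Q_* + t^{2k} Q_{**} + w⁽²⁾`, the source
`F` is a polynomial in `e^P`, `t ∂ₓ P`, `D w⁽¹⁾`, `D Q` and `t ∂ₓ Q`; for `w` in a ball of `X̃`
these factors have orders `P_*`, `min(1, α₁)`, `α₁`, `2k` and `min(1, α₂ + 2k)`, with one derivative
less, and their differences for two functions `w`, `ŵ` have the same orders with the additional
factor `Ẽ[w - ŵ]`. Adding up, the two components of `F` have orders larger than `α₁ + ε` and
`α₂ + ε + 2k`.
-/

noncomputable section

namespace GowdyFuchs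

open Filter Topology

/-! ### Square integrable functions on the circle -/

theorem toL2_ae_eq {f : ℝ → ℝ} (h : MemLp f 2 measU) : toL2 f =ᵐ[measU] f := by
  rw [toL2, dif_pos h]
  exact h.coeFn_toLp

theorem toL2_coeFn (f : L2U) : toL2 f = f := by
  rw [toL2, dif_pos (Lp.memLp f)]
  exact Lp.toLp_coeFn f _

theorem toL2_congr {f g : ℝ → ℝ} (h : f =ᵐ[measU] g) : toL2 f = toL2 g := by
  by_cases hf : MemLp f 2 measU
  · have hg : MemLp g 2 measU := hf.ae_eq h
    rw [toL2, toL2, dif_pos hf, dif_pos hg]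
    exact (MemLp.toLp_eq_toLp_iff hf hg).2 h
  · have hg : ¬ MemLp g 2 measU := fun hg => hf (hg.ae_eq h.symm)
    rw [toL2, toL2, dif_neg hf, dif_neg hg]

theorem toL2_eq_of_ae_eq {f : ℝ → ℝ} {g : L2U} (h : f =ᵐ[measU] g) : toL2 f = g := by
  rw [toL2_congr h, toL2_coeFn]

theorem toL2_add {f g : ℝ → ℝ} (hf : MemLp f 2 measU) (hg : MemLp g 2 measU) :
    toL2 (f + g) = toL2 f + toL2 g := by
  refine toL2_eq_of_ae_eq ?_
  filter_upwards [Lp.coeFn_add (toL2 f) (toL2 g), toL2_ae_eq hf, toL2_ae_eq hg] with x h h₁ h₂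
  rw [h, Pi.add_apply, Pi.add_apply, h₁, h₂]

theorem toL2_sub {f g : ℝ → ℝ} (hf : MemLp f 2 measU) (hg : MemLp g 2 measU) :
    toL2 (f - g) = toL2 f - toL2 g := by
  refine toL2_eq_of_ae_eq ?_
  filter_upwards [Lp.coeFn_sub (toL2 f) (toL2 g), toL2_ae_eq hf, toL2_ae_eq hg] with x h h₁ h₂
  rw [h, Pi.sub_apply, Pi.sub_apply, h₁, h₂]

theorem toL2_zero : toL2 (fun _ => 0) = 0 :=
  toL2_eq_of_ae_eq (Lp.coeFn_zero ℝ 2 measU).symm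

theorem ae_measU_of_forall_mem_Icc {p : ℝ → Prop} (h : ∀ x ∈ Icc 0 (2 * Real.pi), p x) :
    ∀ᵐ x ∂measU, p x := by
  filter_upwards [ae_restrict_mem measurableSet_Ioc] with x hx
  exact h x (Ioc_subset_Icc_self hx)

theorem ae_measU_of_ae_uIcc {p : ℝ → Prop} (h : ∀ᵐ x, x ∈ uIcc 0 (2 * Real.pi) → p x) :
    ∀ᵐ x ∂measU, p x := by
  filter_upwards [ae_restrict_mem measurableSet_Ioc, ae_restrict_of_ae h] with x hx h'
  exact h' (uIcc_of_le Real.two_pi_pos.le ▸ Ioc_subset_Icc_self hx)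

theorem integral_measU (f : ℝ → ℝ) : ∫ x, f x ∂measU = ∫ x in (0 : ℝ)..(2 * Real.pi), f x := by
  rw [intervalIntegral.integral_of_le Real.two_pi_pos.le]

theorem integral_measU_const (c : ℝ) : ∫ _, c ∂measU = 2 * Real.pi * c := by
  rw [integral_measU, intervalIntegral.integral_const, sub_zero, smul_eq_mul]

theorem L2U.integrable (f : L2U) : Integrable (f : ℝ → ℝ) measU :=
  (Lp.memLp f).integrable (by norm_num)

theorem L2U.intervalIntegrable (f : L2U) :
    IntervalIntegrable (f : ℝ → ℝ) volume 0 (2 * Real.pi) := by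
  rw [intervalIntegrable_iff_integrableOn_Ioc_of_le Real.two_pi_pos.le]
  exact f.integrable

theorem memLp_of_continuousOn {p : ℝ≥0∞} {F : ℝ → ℝ} (hF : ContinuousOn F (Icc 0 (2 * Real.pi))) :
    MemLp F p measU := by
  obtain ⟨C, hC⟩ := isCompact_Icc.exists_bound_of_continuousOn hF
  exact MemLp.of_bound ((hF.mono Ioc_subset_Icc_self).aestronglyMeasurable measurableSet_Ioc) C
    (ae_measU_of_forall_mem_Icc hC)

theorem integral_mul_eq_inner (f : L2U) {φ : ℝ → ℝ} (hφ : Continuous φ) :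
    ∫ x, f x * φ x ∂measU = inner ℝ (toL2 φ) f := by
  rw [L2.inner_def]
  refine integral_congr_ae ?_
  filter_upwards [toL2_ae_eq (memLp_of_continuousOn hφ.continuousOn)] with x hx
  rw [hx, RCLike.inner_apply, conj_trivial]

/-! ### Periodic test functions -/

theorem contDiff_of_periodic {ψ : ℝ → ℝ} {T : ℝ} {n : ℕ∞} (hT : 0 < T)
    (hψ : Function.Periodic ψ T) (h : ∀ y ∈ Ioc 0 T, ContDiffAt ℝ n ψ y) : ContDiff ℝ n ψ := by
  rw [contDiff_iff_contDiffAt]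
  intro x
  have hmem : toIocMod hT 0 x ∈ Ioc 0 T := by simpa only [zero_add] using toIocMod_mem_Ioc hT 0 x
  have hshift : ψ = ψ ∘ fun z => z - toIocDiv hT 0 x • T :=
    funext fun z => (hψ.sub_zsmul_eq (toIocDiv hT 0 x)).symm
  rw [hshift]
  exact ContDiffAt.comp x (h _ hmem) (contDiffAt_id.sub contDiffAt_const)

theorem exists_periodic_extension {χ : ℝ → ℝ} {T : ℝ} {n : ℕ∞} (hT : 0 < T) (hχ : ContDiff ℝ n χ)
    (hs : tsupport χ ⊆ Ioo 0 T) :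
    ∃ ψ : ℝ → ℝ, ContDiff ℝ n ψ ∧ Function.Periodic ψ T ∧ ∀ x ∈ Ioc 0 T, ψ x = χ x := by
  let ψ : ℝ → ℝ := fun x => χ (toIocMod hT 0 x)
  have hper : Function.Periodic ψ T := fun x => by simp only [ψ, toIocMod_add_right]
  have heq : ∀ x ∈ Ioc 0 T, ψ x = χ x := fun x hx =>
    congrArg χ ((toIocMod_eq_self hT).2 (by simpa only [zero_add] using hx))
  refine ⟨ψ, contDiff_of_periodic hT hper fun y hy => ?_, hper, heq⟩
  rcases hy.2.lt_or_eq with hlt | rfl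
  · refine hχ.contDiffAt.congr_of_eventuallyEq ?_
    filter_upwards [Ioo_mem_nhds hy.1 hlt] with x hx
    exact heq x ⟨hx.1, hx.2.le⟩
  · have near_right : ∀ᶠ x in 𝓝 y, x ∉ tsupport χ :=
      (isClosed_tsupport χ).isOpen_compl.mem_nhds fun h => (hs h).2.ne rfl
    have near_left : ∀ᶠ x in 𝓝 y, x - y ∉ tsupport χ := by
      have : Tendsto (fun x => x - y) (𝓝 y) (𝓝 0) := by
        simpa only [sub_self] using (continuous_sub_right y).tendsto y
      exact this.eventually ((isClosed_tsupport χ).isOpen_compl.mem_nhds fun h => (hs h).1.ne rfl)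
    refine (contDiffAt_const (c := (0 : ℝ))).congr_of_eventuallyEq ?_
    filter_upwards [near_right, near_left, Ioo_mem_nhds hy.1 (lt_add_of_pos_right y hT)]
      with x h₁ h₂ hx
    rcases le_or_gt x y with hxy | hxy
    · rw [heq x ⟨hx.1, hxy⟩, image_eq_zero_of_notMem_tsupport h₁]
    · rw [← hper.sub_eq x, heq (x - y) ⟨by linarith, by linarith [hx.2]⟩,
        image_eq_zero_of_notMem_tsupport h₂]

theorem ae_eq_zero_of_forall_periodic {h : ℝ → ℝ} (hi : Integrable h measU)
    (H : ∀ ψ : ℝ → ℝ, ContDiff ℝ ∞ ψ → Function.Periodic ψ (2 * Real.pi) →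
      ∫ x, h x * ψ x ∂measU = 0) : h =ᵐ[measU] 0 := by
  have hloc : LocallyIntegrableOn h (Ioo 0 (2 * Real.pi)) volume :=
    IntegrableOn.locallyIntegrableOn (IntegrableOn.mono_set hi Ioo_subset_Ioc_self)
  have hae := isOpen_Ioo.ae_eq_zero_of_integral_contDiff_smul_eq_zero hloc (by
    intro χ hχ _ hs
    obtain ⟨ψ, hψ, hper, heq⟩ := exists_periodic_extension Real.two_pi_pos hχ hs
    rw [← H ψ hψ hper,
      ← setIntegral_eq_integral_of_forall_compl_eq_zero (s := Ioc 0 (2 * Real.pi))]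
    · refine setIntegral_congr_fun measurableSet_Ioc fun x hx => ?_
      simp only [smul_eq_mul]
      rw [heq x hx, mul_comm]
    · intro x hx
      rw [image_eq_zero_of_notMem_tsupport fun h' => hx (Ioo_subset_Ioc_self (hs h')), zero_smul])
  rw [Filter.EventuallyEq, measU, ← restrict_Ioo_eq_restrict_Ioc,
    ae_restrict_iff' measurableSet_Ioo]
  exact hae

theorem exists_periodic_primitive {ψ : ℝ → ℝ} {T : ℝ} (hψ : ContDiff ℝ ∞ ψ)
    (hp : Function.Periodic ψ T) (h0 : ∫ y in (0 : ℝ)..T, ψ y = 0) :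
    ∃ φ : ℝ → ℝ, ContDiff ℝ ∞ φ ∧ Function.Periodic φ T ∧ deriv φ = ψ := by
  let φ : ℝ → ℝ := fun x => ∫ y in (0 : ℝ)..x, ψ y
  have hcont := hψ.continuous
  have hder : ∀ x, HasDerivAt φ (ψ x) x :=
    fun x => (hcont.integral_hasStrictDerivAt 0 x).hasDerivAt
  have hderiv : deriv φ = ψ := funext fun x => (hder x).deriv
  refine ⟨φ, ?_, fun x => ?_, hderiv⟩
  · rw [contDiff_infty_iff_deriv, hderiv]
    exact ⟨fun x => (hder x).differentiableAt, hψ⟩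
  · have hperiod : ∫ y in x..(x + T), ψ y = 0 := by
      rw [hp.intervalIntegral_add_eq x 0, zero_add, h0]
    change ∫ y in (0 : ℝ)..(x + T), ψ y = φ x
    rw [← intervalIntegral.integral_add_adjacent_intervals (hcont.intervalIntegrable 0 x)
      (hcont.intervalIntegrable x _), hperiod, add_zero]

/-! ### Weak derivatives -/

theorem HasWeakDeriv.unique {f g g' : L2U} (h : HasWeakDeriv f g) (h' : HasWeakDeriv f g') :
    g = g' := by
  have hzero : (fun x => g x - g' x) =ᵐ[measU] 0 := by
    refine ae_eq_zero_of_forall_periodic (g.integrable.sub g'.integrable) fun ψ hψ hper => ?_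
    simp only [sub_mul]
    rw [integral_sub (integrable_mul_cont g hψ.continuous) (integrable_mul_cont g' hψ.continuous)]
    linarith [h ψ hψ hper, h' ψ hψ hper]
  refine Lp.ext ?_
  filter_upwards [hzero] with x hx
  exact sub_eq_zero.1 hx

theorem HasWeakDeriv.wderiv_eq {f g : L2U} (h : HasWeakDeriv f g) : wderiv f = g := by
  have h' : ∃ g, HasWeakDeriv f g := ⟨g, h⟩
  rw [wderiv, dif_pos h']
  exact h'.choose_spec.unique h

theorem HasWeakDeriv.self {f g : L2U} (h : HasWeakDeriv f g) : HasWeakDeriv f (wderiv f) :=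
  h.wderiv_eq.symm ▸ h

theorem HasWeakDeriv.neg {f g : L2U} (h : HasWeakDeriv f g) : HasWeakDeriv (-f) (-g) := by
  simpa only [neg_one_smul] using h.smul (-1)

theorem HasWeakDeriv.sub {f g f' g' : L2U} (h : HasWeakDeriv f g) (h' : HasWeakDeriv f' g') :
    HasWeakDeriv (f - f') (g - g') := by
  simpa only [sub_eq_add_neg] using h.add h'.neg

theorem HasWeakDeriv.of_tendsto {ι : Type*} {l : Filter ι} [l.NeBot] {f g : ι → L2U} {f' g' : L2U}
    (h : ∀ᶠ i in l, HasWeakDeriv (f i) (g i)) (hf : Tendsto f l (𝓝 f')) (hg : Tendsto g l (𝓝 g')) :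
    HasWeakDeriv f' g' := by
  intro φ hφ hper
  have hd : Continuous (deriv φ) := hφ.continuous_deriv (by simp)
  rw [integral_mul_eq_inner f' hd, integral_mul_eq_inner g' hφ.continuous]
  have hlim : Tendsto (fun i => inner ℝ (toL2 (deriv φ)) (f i)) l
      (𝓝 (inner ℝ (toL2 (deriv φ)) f')) := tendsto_const_nhds.inner hf
  have hlim' : Tendsto (fun i => -inner ℝ (toL2 φ) (g i)) l
      (𝓝 (-inner ℝ (toL2 φ) g')) := (tendsto_const_nhds.inner hg).neg
  refine tendsto_nhds_unique (hlim.congr' ?_) hlim'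
  filter_upwards [h] with i hi
  rw [← integral_mul_eq_inner _ hd, ← integral_mul_eq_inner _ hφ.continuous, hi φ hφ hper]

theorem HasWeakDeriv.exists_ae_eq_const {d : L2U} (h : HasWeakDeriv d 0) :
    ∃ c : ℝ, d =ᵐ[measU] fun _ => c := by
  set c : ℝ := (2 * Real.pi)⁻¹ * ∫ x, d x ∂measU with hc
  have hdc : ∫ x, d x ∂measU = 2 * Real.pi * c := by rw [hc]; field_simp
  refine ⟨c, ?_⟩
  suffices hzero : (fun x => d x - c) =ᵐ[measU] 0 by
    filter_upwards [hzero] with x hx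
    exact sub_eq_zero.1 hx
  refine ae_eq_zero_of_forall_periodic (d.integrable.sub (integrable_const c)) fun ψ hψ hper => ?_
  -- Up to its mean `e`, the test function `ψ` is the derivative of a test function.
  set e : ℝ := (2 * Real.pi)⁻¹ * ∫ x, ψ x ∂measU with he
  have hψe : ∫ x, ψ x ∂measU = 2 * Real.pi * e := by rw [he]; field_simp
  have hψi : Integrable ψ measU :=
    (memLp_of_continuousOn (p := 1) hψ.continuous.continuousOn).integrable le_rfl
  have hmean : ∫ y in (0 : ℝ)..(2 * Real.pi), (ψ y - e) = 0 := by
    rw [← integral_measU, integral_sub hψi (integrable_const e), hψe, integral_measU_const,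
      sub_self]
  obtain ⟨φ, hφ, hφper, hφder⟩ := exists_periodic_primitive (hψ.sub contDiff_const)
    (fun x => by rw [hper x]) hmean
  have hweak := h φ hφ hφper
  have hright : ∫ x, (0 : L2U) x * φ x ∂measU = 0 := by
    refine integral_eq_zero_of_ae ?_
    filter_upwards [Lp.coeFn_zero ℝ 2 measU] with x hx
    simp only [hx, Pi.zero_apply, zero_mul]
  have hdψ := integrable_mul_cont d hψ.continuous
  simp only [hφder, hright, neg_zero, mul_sub] at hweak
  rw [integral_sub hdψ (d.integrable.mul_const e), integral_mul_const, hdc] at hweak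
  simp only [sub_mul]
  rw [integral_sub hdψ (hψi.const_mul c), integral_const_mul, hψe]
  linarith

/-! ### Absolutely continuous representatives -/

/-- `F` is the absolutely continuous periodic representative of `f ∈ H¹(U)`, and `g = ∂ₓf`. Only
the restriction of `F` to `[0, 2π]` is relevant, so that periodicity reads `F (2π) = F 0`. -/
structure IsACRep (F : ℝ → ℝ) (f g : L2U) : Prop where
  ac : AbsolutelyContinuousOnInterval F 0 (2 * Real.pi)
  periodic : F (2 * Real.pi) = F 0
  ae_eq : f =ᵐ[measU] F
  ae_hasDerivAt : ∀ᵐ x ∂measU, HasDerivAt F (g x) x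

namespace IsACRep

variable {F : ℝ → ℝ} {f g : L2U}

theorem hasWeakDeriv (h : IsACRep F f g) : HasWeakDeriv f g := by
  intro φ hφ hper
  have hac : AbsolutelyContinuousOnInterval φ 0 (2 * Real.pi) :=
    ((hφ.of_le (by simp)).contDiffOn).absolutelyContinuousOnInterval
  have hleft : ∫ x, f x * deriv φ x ∂measU = ∫ x, F x * deriv φ x ∂measU := by
    refine integral_congr_ae ?_
    filter_upwards [h.ae_eq] with x hx
    rw [hx]
  have hright : ∫ x, g x * φ x ∂measU = ∫ x, deriv F x * φ x ∂measU := by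
    refine integral_congr_ae ?_
    filter_upwards [h.ae_hasDerivAt] with x hx
    rw [hx.deriv]
  have hφ0 : φ (2 * Real.pi) = φ 0 := by simpa only [zero_add] using hper 0
  rw [hleft, hright, integral_measU, integral_measU, h.ac.integral_mul_deriv_eq_deriv_mul hac,
    h.periodic, hφ0, sub_self, zero_sub]

theorem continuousOn (h : IsACRep F f g) : ContinuousOn F (Icc 0 (2 * Real.pi)) := by
  simpa only [uIcc_of_le Real.two_pi_pos.le] using h.ac.continuousOn

theorem sub_eq_integral (h : IsACRep F f g) {x y : ℝ} (hx : x ∈ Icc 0 (2 * Real.pi))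
    (hy : y ∈ Icc 0 (2 * Real.pi)) : F y - F x = ∫ z in x..y, g z := by
  have hs : uIcc x y ⊆ uIcc 0 (2 * Real.pi) := by
    rw [uIcc_of_le Real.two_pi_pos.le]
    exact uIcc_subset_Icc hx hy
  rw [← (h.ac.mono hs).integral_deriv_eq_sub]
  refine intervalIntegral.integral_congr_ae ?_
  filter_upwards [(ae_restrict_iff' measurableSet_Ioc).1 h.ae_hasDerivAt] with z hz hz'
  exact (hz ⟨(le_min hx.1 hy.1).trans_lt hz'.1, hz'.2.trans (max_le hx.2 hy.2)⟩).deriv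

theorem abs_sub_le (h : IsACRep F f g) {a b x y : ℝ} (ha : 0 ≤ a) (hb : b ≤ 2 * Real.pi)
    (hx : x ∈ Icc a b) (hy : y ∈ Icc a b) : |F x - F y| ≤ ∫ z in Ioc a b, |g z| := by
  have hcc : Icc a b ⊆ Icc 0 (2 * Real.pi) := Icc_subset_Icc ha hb
  have hint : IntegrableOn (fun z => |g z|) (Ioc a b) :=
    g.integrable.abs.mono_measure (Measure.restrict_mono_set _ (Ioc_subset_Ioc ha hb))
  have hsub : uIoc y x ⊆ Ioc a b :=
    fun z hz => ⟨(le_min hy.1 hx.1).trans_lt hz.1, hz.2.trans (max_le hy.2 hx.2)⟩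
  rw [h.sub_eq_integral (hcc hy) (hcc hx)]
  exact (intervalIntegral.norm_integral_le_integral_norm_uIoc (f := fun z => g z)).trans
    (setIntegral_mono_set hint (ae_of_all _ fun _ => abs_nonneg _) hsub.eventuallyLE)

theorem mul_abs_le_integral (h : IsACRep F f g) {a b x : ℝ} (ha : 0 ≤ a) (hb : b ≤ 2 * Real.pi)
    (hx : x ∈ Icc a b) :
    (b - a) * |F x| ≤ (∫ y in Ioc a b, |f y|) + (b - a) * ∫ y in Ioc a b, |g y| := by
  have hm : volume.restrict (Ioc a b) ≤ measU :=
    Measure.restrict_mono_set _ (Ioc_subset_Ioc ha hb)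
  have hvol : ∀ c : ℝ, ∫ _ in Ioc a b, c = (b - a) * c := fun c => by
    rw [setIntegral_const, Real.volume_real_Ioc_of_le (hx.1.trans hx.2), smul_eq_mul]
  have hf : IntegrableOn (fun y => |f y|) (Ioc a b) := f.integrable.abs.mono_measure hm
  rw [← hvol |F x|, ← hvol, ← integral_add hf (integrable_const _)]
  refine integral_mono_ae (integrable_const _) (hf.add (integrable_const _)) ?_
  filter_upwards [ae_mono hm h.ae_eq, ae_restrict_mem measurableSet_Ioc] with y hfy hy
  have hsub := h.abs_sub_le ha hb hx (Ioc_subset_Icc_self hy)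
  have htri := abs_add_le (F y) (F x - F y)
  rw [add_sub_cancel] at htri
  rw [hfy]
  linarith

theorem of_primitive (hg : ∫ x, g x ∂measU = 0) (c : ℝ)
    (hf : f =ᵐ[measU] fun x => c + ∫ y in (0 : ℝ)..x, g y) :
    IsACRep (fun x => c + ∫ y in (0 : ℝ)..x, g y) f g where
  ac := (contDiffOn_const (𝕜 := ℝ) (c := c)).absolutelyContinuousOnInterval.add
    (g.intervalIntegrable.absolutelyContinuousOnInterval_intervalIntegral left_mem_uIcc)
  periodic := by simp only [← integral_measU, hg, intervalIntegral.integral_same]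
  ae_eq := hf
  ae_hasDerivAt := by
    refine ae_measU_of_ae_uIcc ?_
    filter_upwards [g.intervalIntegrable.ae_hasDerivAt_integral] with x hx hx'
    exact (hx hx' 0 left_mem_uIcc).const_add c

end IsACRep

namespace HasWeakDeriv

theorem integral_eq_zero {f g : L2U} (h : HasWeakDeriv f g) : ∫ x, g x ∂measU = 0 := by
  simpa using h (fun _ => 1) contDiff_const fun _ => rfl

theorem exists_isACRep {f g : L2U} (h : HasWeakDeriv f g) : ∃ F, IsACRep F f g := by
  have hg := h.integral_eq_zero
  let G : ℝ → ℝ := fun x => 0 + ∫ y in (0 : ℝ)..x, g y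
  have hGac : ContinuousOn G (uIcc 0 (2 * Real.pi)) :=
    continuousOn_const.add
      (g.intervalIntegrable.absolutelyContinuousOnInterval_intervalIntegral
        left_mem_uIcc).continuousOn
  rw [uIcc_of_le Real.two_pi_pos.le] at hGac
  have hG : toL2 G =ᵐ[measU] G := toL2_ae_eq (memLp_of_continuousOn hGac)
  have hdiff : HasWeakDeriv (f - toL2 G) 0 := by
    simpa only [sub_self] using h.sub (IsACRep.of_primitive hg 0 hG).hasWeakDeriv
  obtain ⟨c, hc⟩ := hdiff.exists_ae_eq_const
  refine ⟨_, IsACRep.of_primitive hg c ?_⟩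
  filter_upwards [hc, Lp.coeFn_sub f (toL2 G), hG] with x h₁ h₂ h₃
  rw [h₂, Pi.sub_apply, h₃] at h₁
  linarith

end HasWeakDeriv

/-! ### Essentially bounded functions -/

/-- `B` is a bound for the norm of `φ` in `L^∞(U)`. -/
def EssBoundedBy (φ : ℝ → ℝ) (B : ℝ) : Prop :=
  AEStronglyMeasurable φ measU ∧ ∀ᵐ x ∂measU, |φ x| ≤ B

namespace EssBoundedBy

variable {φ : ℝ → ℝ} {B : ℝ}

theorem memLp_mul (h : EssBoundedBy φ B) {f : ℝ → ℝ} (hf : MemLp f 2 measU) :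
    MemLp (fun x => φ x * f x) 2 measU := by
  refine MemLp.of_le_mul (c := B) hf (h.1.mul hf.1) ?_
  filter_upwards [h.2] with x hx
  rw [norm_mul]
  exact mul_le_mul_of_nonneg_right hx (norm_nonneg _)

theorem memLp (h : EssBoundedBy φ B) : MemLp φ 2 measU :=
  MemLp.of_bound h.1 B h.2

theorem norm_toL2_mul_le (h : EssBoundedBy φ B) (f : L2U) :
    ‖toL2 (fun x => φ x * f x)‖ ≤ B * ‖f‖ := by
  refine Lp.norm_le_mul_norm_of_ae_le_mul ?_
  filter_upwards [h.2, toL2_ae_eq (h.memLp_mul (Lp.memLp f))] with x hx hφf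
  rw [hφf, norm_mul]
  exact mul_le_mul_of_nonneg_right hx (norm_nonneg _)

theorem exp (h : EssBoundedBy φ B) : EssBoundedBy (fun x => Real.exp (φ x)) (Real.exp B) := by
  refine ⟨Real.continuous_exp.comp_aestronglyMeasurable h.1, ?_⟩
  filter_upwards [h.2] with x hx
  rw [abs_of_pos (Real.exp_pos _)]
  exact Real.exp_le_exp.2 ((le_abs_self _).trans hx)

end EssBoundedBy

theorem exists_essBoundedBy_of_continuous {φ : ℝ → ℝ} (hφ : Continuous φ) :
    ∃ B, EssBoundedBy φ B := by
  obtain ⟨C, hC⟩ := isCompact_Icc.exists_bound_of_continuousOn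
    (hφ.continuousOn (s := Icc 0 (2 * Real.pi)))
  exact ⟨C, hφ.aestronglyMeasurable, ae_measU_of_forall_mem_Icc hC⟩

theorem HasWeakDeriv.exists_essBoundedBy {f g : L2U} (h : HasWeakDeriv f g) :
    ∃ B, EssBoundedBy f B := by
  obtain ⟨F, hF⟩ := h.exists_isACRep
  obtain ⟨C, hC⟩ := isCompact_Icc.exists_bound_of_continuousOn hF.continuousOn
  refine ⟨C, (Lp.memLp f).1, ?_⟩
  filter_upwards [hF.ae_eq, ae_measU_of_forall_mem_Icc hC] with x hx hCx
  rw [hx]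
  exact hCx

/-! ### Weak derivatives of products and exponentials -/

theorem absolutelyContinuousOnInterval_comp_of_lipschitzOnWith {X Y : Type*} [PseudoMetricSpace X]
    [PseudoMetricSpace Y] {φ : X → Y} {K : NNReal} {s : Set X} (hφ : LipschitzOnWith K φ s)
    {F : ℝ → X} {a b : ℝ} (hF : AbsolutelyContinuousOnInterval F a b)
    (hs : MapsTo F (uIcc a b) s) : AbsolutelyContinuousOnInterval (φ ∘ F) a b := by
  unfold AbsolutelyContinuousOnInterval at hF ⊢
  have hlim := hF.const_mul (K : ℝ)
  rw [mul_zero] at hlim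
  refine squeeze_zero' (Eventually.of_forall fun _ => Finset.sum_nonneg fun _ _ => dist_nonneg) ?_
    hlim
  rw [eventually_inf_principal]
  filter_upwards with (n, I) hnI
  rw [Finset.mul_sum]
  refine Finset.sum_le_sum fun i hi => ?_
  exact hφ.dist_le_mul _ (hs (hnI.1 i hi).1) _ (hs (hnI.1 i hi).2)

theorem lipschitzOnWith_exp_Iic (C : ℝ) :
    LipschitzOnWith (Real.exp C).toNNReal Real.exp (Iic C) := by
  refine Convex.lipschitzOnWith_of_nnnorm_deriv_le (fun z _ => Real.differentiableAt_exp)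
    (fun z hz => ?_) (convex_Iic C)
  rw [Real.deriv_exp, ← norm_toNNReal, Real.norm_eq_abs, abs_of_pos (Real.exp_pos _)]
  exact Real.toNNReal_le_toNNReal (Real.exp_le_exp.2 hz)

theorem HasWeakDeriv.mul {u u' v v' : L2U} (h : HasWeakDeriv u u') (h' : HasWeakDeriv v v') :
    HasWeakDeriv (toL2 fun x => u x * v x)
      (toL2 (fun x => v x * u' x) + toL2 fun x => u x * v' x) := by
  obtain ⟨F, hF⟩ := h.exists_isACRep
  obtain ⟨G, hG⟩ := h'.exists_isACRep
  obtain ⟨B, hB⟩ := h.exists_essBoundedBy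
  obtain ⟨B', hB'⟩ := h'.exists_essBoundedBy
  refine IsACRep.hasWeakDeriv (F := fun x => F x * G x) ⟨hF.ac.mul hG.ac, ?_, ?_, ?_⟩
  · simp only [hF.periodic, hG.periodic]
  · filter_upwards [toL2_ae_eq (hB.memLp_mul (Lp.memLp v)), hF.ae_eq, hG.ae_eq] with x h₁ h₂ h₃
    rw [h₁, h₂, h₃]
  · filter_upwards [Lp.coeFn_add (toL2 fun x => v x * u' x) (toL2 fun x => u x * v' x),
      toL2_ae_eq (hB'.memLp_mul (Lp.memLp u')), toL2_ae_eq (hB.memLp_mul (Lp.memLp v')), hF.ae_eq,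
      hG.ae_eq, hF.ae_hasDerivAt, hG.ae_hasDerivAt] with x h₁ h₂ h₃ h₄ h₅ hFx hGx
    rw [h₁, Pi.add_apply, h₂, h₃, h₄, h₅, mul_comm (G x)]
    exact hFx.mul hGx

theorem HasWeakDeriv.exp {u u' : L2U} (h : HasWeakDeriv u u') :
    HasWeakDeriv (toL2 fun x => Real.exp (u x)) (toL2 fun x => Real.exp (u x) * u' x) := by
  obtain ⟨F, hF⟩ := h.exists_isACRep
  obtain ⟨B, hB⟩ := h.exists_essBoundedBy
  obtain ⟨C, hC⟩ := hF.ac.exists_bound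
  refine IsACRep.hasWeakDeriv (F := Real.exp ∘ F)
    ⟨absolutelyContinuousOnInterval_comp_of_lipschitzOnWith (lipschitzOnWith_exp_Iic C) hF.ac
      fun x hx => (le_abs_self _).trans (hC x hx), ?_, ?_, ?_⟩
  · simp only [Function.comp_apply, hF.periodic]
  · filter_upwards [toL2_ae_eq hB.exp.memLp, hF.ae_eq] with x h₁ h₂
    rw [h₁, h₂, Function.comp_apply]
  · filter_upwards [toL2_ae_eq (hB.exp.memLp_mul (Lp.memLp u')), hF.ae_eq, hF.ae_hasDerivAt]
      with x h₁ h₂ h₃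
    rw [h₁, h₂]
    exact h₃.exp

theorem hasWeakDeriv_of_contDiff {f : ℝ → ℝ} (hf : ContDiff ℝ 1 f)
    (hp : Function.Periodic f (2 * Real.pi)) : HasWeakDeriv (toL2 f) (toL2 (deriv f)) := by
  refine IsACRep.hasWeakDeriv (F := f) ⟨hf.contDiffOn.absolutelyContinuousOnInterval,
    by simpa only [zero_add] using hp 0,
    toL2_ae_eq (memLp_of_continuousOn hf.continuous.continuousOn), ?_⟩
  filter_upwards [toL2_ae_eq (memLp_of_continuousOn (hf.continuous_deriv le_rfl).continuousOn)]
    with x hx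
  rw [hx]
  exact (hf.differentiable one_ne_zero x).hasDerivAt

/-! ### Weighted norms and a weighted Sobolev inequality -/

theorem continuous_rpow_neg {μ : ℝ → ℝ} (hμ : Continuous μ) {t : ℝ} (ht : 0 < t) :
    Continuous fun x => t ^ (-μ x) :=
  continuous_const.rpow hμ.neg fun _ => Or.inl ht.ne'

/-- The weighted norm `‖t^{-μ} f‖_{L²(U)}`. -/
def weightedNorm (μ : ℝ → ℝ) (t : ℝ) (f : L2U) : ℝ := ‖toL2 (fun x => t ^ (-μ x) * f x)‖

theorem weightedNorm_nonneg (μ : ℝ → ℝ) (t : ℝ) (f : L2U) : 0 ≤ weightedNorm μ t f :=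
  norm_nonneg _

theorem weightedNorm_zero (μ : ℝ → ℝ) (t : ℝ) : weightedNorm μ t 0 = 0 := by
  rw [weightedNorm, norm_eq_zero]
  refine toL2_eq_of_ae_eq ?_
  filter_upwards [Lp.coeFn_zero ℝ 2 measU] with x hx
  rw [hx, Pi.zero_apply, mul_zero]

theorem weightedNorm_one_eq_norm (μ : ℝ → ℝ) (f : L2U) : weightedNorm μ 1 f = ‖f‖ := by
  simp only [weightedNorm, Real.one_rpow, one_mul, toL2_coeFn]

section

variable {μ : ℝ → ℝ} (hμ : Continuous μ) {t : ℝ} (ht : 0 < t)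

include hμ ht

theorem memLp_rpow_neg_mul (f : L2U) : MemLp (fun x => t ^ (-μ x) * f x) 2 measU := by
  obtain ⟨B, hB⟩ := exists_essBoundedBy_of_continuous (continuous_rpow_neg hμ ht)
  exact hB.memLp_mul (Lp.memLp f)

theorem weightedNorm_le_of_ae_le {ρ : ℝ → ℝ} (hρ : Continuous ρ) {f g : L2U} {B : ℝ}
    (h : ∀ᵐ x ∂measU, t ^ (-ρ x) * |f x| ≤ B * (t ^ (-μ x) * |g x|)) :
    weightedNorm ρ t f ≤ B * weightedNorm μ t g := by
  refine Lp.norm_le_mul_norm_of_ae_le_mul ?_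
  filter_upwards [h, toL2_ae_eq (memLp_rpow_neg_mul hμ ht g),
    toL2_ae_eq (memLp_rpow_neg_mul hρ ht f)] with x hx hg hf
  rw [hg, hf, Real.norm_eq_abs, Real.norm_eq_abs, abs_mul, abs_mul,
    abs_of_pos (Real.rpow_pos_of_pos ht _), abs_of_pos (Real.rpow_pos_of_pos ht _)]
  exact hx

theorem weightedNorm_add_le (f g : L2U) :
    weightedNorm μ t (f + g) ≤ weightedNorm μ t f + weightedNorm μ t g := by
  have hadd : toL2 (fun x => t ^ (-μ x) * (f + g : L2U) x) =
      toL2 (fun x => t ^ (-μ x) * f x) + toL2 (fun x => t ^ (-μ x) * g x) := by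
    rw [← toL2_add (memLp_rpow_neg_mul hμ ht f) (memLp_rpow_neg_mul hμ ht g)]
    refine toL2_congr ?_
    filter_upwards [Lp.coeFn_add f g] with x hx
    rw [hx, Pi.add_apply, Pi.add_apply, mul_add]
  rw [weightedNorm, hadd]
  exact norm_add_le _ _

theorem weightedNorm_smul (c : ℝ) (f : L2U) :
    weightedNorm μ t (c • f) = |c| * weightedNorm μ t f := by
  have hsmul : toL2 (fun x => t ^ (-μ x) * (c • f : L2U) x) =
      c • toL2 (fun x => t ^ (-μ x) * f x) := by
    refine toL2_eq_of_ae_eq ?_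
    filter_upwards [Lp.coeFn_smul c f, Lp.coeFn_smul c (toL2 (fun x => t ^ (-μ x) * f x)),
      toL2_ae_eq (memLp_rpow_neg_mul hμ ht f)] with x h₁ h₂ h₃
    rw [h₁, h₂, Pi.smul_apply, Pi.smul_apply, h₃, smul_eq_mul, smul_eq_mul, mul_left_comm]
  rw [weightedNorm, hsmul, norm_smul, Real.norm_eq_abs, weightedNorm]

theorem sq_weightedNorm (f : L2U) :
    weightedNorm μ t f ^ 2 = ∫ x, t ^ (2 * (-μ x)) * (f x) ^ 2 ∂measU := by
  rw [weightedNorm, ← real_inner_self_eq_norm_sq, L2.inner_def]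
  refine integral_congr_ae ?_
  filter_upwards [toL2_ae_eq (memLp_rpow_neg_mul hμ ht f)] with x hx
  rw [hx, real_inner_self_eq_norm_sq, Real.norm_eq_abs, sq_abs, mul_pow, mul_comm 2 (-μ x),
    Real.rpow_mul ht.le, Real.rpow_two]

end

theorem exists_pos_add_le {μ ρ : ℝ → ℝ} (hμ : Continuous μ) (hρ : Continuous ρ)
    (h : ∀ x, ρ x < μ x) : ∃ η > 0, ∀ x ∈ Icc 0 (2 * Real.pi), ρ x + η ≤ μ x := by
  obtain ⟨x₀, -, hx₀⟩ := isCompact_Icc.exists_isMinOn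
    (nonempty_Icc.2 Real.two_pi_pos.le) (hμ.sub hρ).continuousOn
  refine ⟨μ x₀ - ρ x₀, sub_pos.2 (h x₀), fun x hx => ?_⟩
  have hmin : μ x₀ - ρ x₀ ≤ μ x - ρ x := hx₀ hx
  linarith

theorem exists_abs_le_of_continuous {μ : ℝ → ℝ} (hμ : Continuous μ) :
    ∃ M, 0 ≤ M ∧ ∀ x ∈ Icc 0 (2 * Real.pi), |μ x| ≤ M := by
  obtain ⟨C, hC⟩ := isCompact_Icc.exists_bound_of_continuousOn
    (hμ.continuousOn (s := Icc 0 (2 * Real.pi)))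
  exact ⟨max C 0, le_max_right _ _, fun x hx => (hC x hx).trans (le_max_left _ _)⟩

theorem rpow_le_max_one_rpow {t δ₀ s M : ℝ} (ht : 0 < t) (hδ : t ≤ δ₀) (hs : 0 ≤ s)
    (hM : s ≤ M) : t ^ s ≤ (max 1 δ₀) ^ M :=
  (Real.rpow_le_rpow ht.le (hδ.trans (le_max_right _ _)) hs).trans
    (Real.rpow_le_rpow_of_exponent_le (le_max_left _ _) hM)

theorem exists_rpow_le {μ ρ : ℝ → ℝ} (hμ : Continuous μ) (hρ : Continuous ρ)
    (h : ∀ x, ρ x ≤ μ x) (δ₀ : ℝ) : ∃ C, 0 ≤ C ∧ ∀ t, 0 < t → t ≤ δ₀ →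
      ∀ x ∈ Icc 0 (2 * Real.pi), t ^ (μ x) ≤ C * t ^ (ρ x) := by
  obtain ⟨M, -, hb⟩ := exists_abs_le_of_continuous (hμ.sub hρ)
  refine ⟨(max 1 δ₀) ^ M, by positivity, fun t ht htδ x hx => ?_⟩
  rw [← sub_add_cancel (μ x) (ρ x), Real.rpow_add ht]
  exact mul_le_mul_of_nonneg_right (rpow_le_max_one_rpow ht htδ (sub_nonneg.2 (h x))
    ((le_abs_self _).trans (hb x hx))) (Real.rpow_nonneg ht.le _)

theorem exists_weightedNorm_le {μ ρ : ℝ → ℝ} (hμ : Continuous μ) (hρ : Continuous ρ)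
    (h : ∀ x, ρ x ≤ μ x) (δ₀ : ℝ) : ∃ C, 0 ≤ C ∧ ∀ t, 0 < t → t ≤ δ₀ →
      ∀ f : L2U, weightedNorm ρ t f ≤ C * weightedNorm μ t f := by
  obtain ⟨C, hC, hrpow⟩ := exists_rpow_le hρ.neg hμ.neg (fun x => neg_le_neg (h x)) δ₀
  refine ⟨C, hC, fun t ht htδ f => weightedNorm_le_of_ae_le hμ ht hρ ?_⟩
  refine ae_measU_of_forall_mem_Icc fun x hx => ?_
  rw [← mul_assoc]
  exact mul_le_mul_of_nonneg_right (hrpow t ht htδ x hx) (abs_nonneg _)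

theorem integral_abs_le (f : L2U) : ∫ x, |f x| ∂measU ≤ ‖toL2 (fun _ => 1)‖ * ‖f‖ := by
  have habs : ∫ x, (|f| : L2U) x * 1 ∂measU = ∫ x, |f x| ∂measU := by
    refine integral_congr_ae ?_
    filter_upwards [Lp.coeFn_abs f] with x hx
    rw [hx, mul_one]
  rw [← habs, integral_mul_eq_inner |f| continuous_const, ← norm_abs_eq_norm f]
  exact real_inner_le_norm _ _

theorem setIntegral_abs_le_of_one_le_mul {φ : ℝ → ℝ} {B : ℝ} (hφ : EssBoundedBy φ B) (f : L2U)
    {a b K : ℝ} (ha : 0 ≤ a) (hb : b ≤ 2 * Real.pi) (hK : 0 ≤ K)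
    (hKφ : ∀ y ∈ Icc a b, 1 ≤ K * |φ y|) :
    ∫ y in Ioc a b, |f y| ≤ K * (‖toL2 (fun _ => 1)‖ * ‖toL2 (fun x => φ x * f x)‖) := by
  have hm : volume.restrict (Ioc a b) ≤ measU :=
    Measure.restrict_mono_set _ (Ioc_subset_Ioc ha hb)
  have hint : ∀ w : L2U, IntegrableOn (fun y => |w y|) (Ioc a b) := fun w =>
    w.integrable.abs.mono_measure hm
  set v := toL2 (fun x => φ x * f x)
  have hae : ∀ᵐ y ∂measU, v y = φ y * f y := toL2_ae_eq (hφ.memLp_mul (Lp.memLp f))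
  calc ∫ y in Ioc a b, |f y| ≤ ∫ y in Ioc a b, K * |v y| := by
        refine integral_mono_ae (hint f) ((hint v).const_mul K) ?_
        filter_upwards [ae_mono hm hae, ae_restrict_mem measurableSet_Ioc] with y hvy hy
        rw [hvy, abs_mul, ← mul_assoc]
        exact le_mul_of_one_le_left (abs_nonneg _) (hKφ y (Ioc_subset_Icc_self hy))
    _ = K * ∫ y in Ioc a b, |v y| := integral_const_mul _ _
    _ ≤ K * (‖toL2 (fun _ => 1)‖ * ‖v‖) := by
        refine mul_le_mul_of_nonneg_left ?_ hK
        exact (integral_mono_measure hm (ae_of_all _ fun _ => abs_nonneg _)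
          v.integrable.abs).trans (integral_abs_le v)

theorem IsACRep.abs_le_of_one_le_mul {F : ℝ → ℝ} {f g : L2U} (hF : IsACRep F f g) {φ : ℝ → ℝ}
    {B : ℝ} (hφ : EssBoundedBy φ B) {a b x K : ℝ} (ha : 0 ≤ a) (hb : b ≤ 2 * Real.pi) (hab : a < b)
    (hx : x ∈ Icc a b) (hK : 0 ≤ K) (hKφ : ∀ y ∈ Icc a b, 1 ≤ K * |φ y|) :
    |F x| ≤ K * ((b - a)⁻¹ + 1) * ‖toL2 (fun _ => 1)‖ *
      (‖toL2 (fun x => φ x * f x)‖ + ‖toL2 (fun x => φ x * g x)‖) := by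
  have hba : 0 < b - a := sub_pos.2 hab
  set P := K * (‖toL2 (fun _ => 1)‖ * ‖toL2 (fun x => φ x * f x)‖) with hP
  set Q := K * (‖toL2 (fun _ => 1)‖ * ‖toL2 (fun x => φ x * g x)‖) with hQ
  have hfP := setIntegral_abs_le_of_one_le_mul hφ f ha hb hK hKφ
  have hgQ := setIntegral_abs_le_of_one_le_mul hφ g ha hb hK hKφ
  have hP0 : 0 ≤ P := by positivity
  have hQ0 : 0 ≤ (b - a)⁻¹ * Q := by positivity
  calc |F x| = (b - a)⁻¹ * ((b - a) * |F x|) := (inv_mul_cancel_left₀ hba.ne' _).symm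
    _ ≤ (b - a)⁻¹ * (P + (b - a) * Q) :=
        mul_le_mul_of_nonneg_left ((hF.mul_abs_le_integral ha hb hx).trans
          (add_le_add hfP (mul_le_mul_of_nonneg_left hgQ hba.le))) (inv_nonneg.2 hba.le)
    _ = (b - a)⁻¹ * P + Q := by rw [mul_add, inv_mul_cancel_left₀ hba.ne']
    _ ≤ (b - a)⁻¹ * P + Q + (P + (b - a)⁻¹ * Q) := le_add_of_nonneg_right (add_nonneg hP0 hQ0)
    _ = _ := by rw [hP, hQ]; ring

theorem exists_one_le_mul_rpow_of_near {μ ρ : ℝ → ℝ} (hμ : Continuous μ) (hρ : Continuous ρ)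
    (h : ∀ x, ρ x < μ x) (δ₀ : ℝ) : ∃ A l : ℝ, 0 ≤ A ∧ 0 < l ∧ l ≤ Real.pi ∧
      ∀ t, 0 < t → t ≤ δ₀ → ∀ x ∈ Icc 0 (2 * Real.pi), ∀ y ∈ Icc 0 (2 * Real.pi), |x - y| ≤ l →
        1 ≤ A * t ^ ρ x * t ^ (-μ y) := by
  obtain ⟨η, hη, hgap⟩ := exists_pos_add_le hμ hρ h
  obtain ⟨M₁, -, hb₁⟩ := exists_abs_le_of_continuous hμ
  obtain ⟨M₂, -, hb₂⟩ := exists_abs_le_of_continuous hρ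
  obtain ⟨d, hd, hdμ⟩ := Metric.uniformContinuousOn_iff.1
    ((isCompact_Icc (a := 0) (b := 2 * Real.pi)).uniformContinuousOn_of_continuous
      hμ.continuousOn) η hη
  refine ⟨(max 1 δ₀) ^ (M₁ + M₂), min (d / 2) Real.pi, by positivity,
    lt_min (by positivity) Real.pi_pos, min_le_right _ _, fun t ht htδ x hx y hy hxy => ?_⟩
  have hxyd : dist x y < d := (hxy.trans (min_le_left _ _)).trans_lt (half_lt_self hd)
  have hμxy := hdμ x hx y hy hxyd
  rw [Real.dist_eq, abs_lt] at hμxy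
  have hrpow : t ^ (μ y - ρ x) ≤ (max 1 δ₀) ^ (M₁ + M₂) := by
    refine rpow_le_max_one_rpow ht htδ (by linarith [hgap x hx]) ?_
    linarith [le_abs_self (μ y), hb₁ y hy, neg_abs_le (ρ x), hb₂ x hx]
  have hinv : t ^ ρ x * t ^ (-μ y) = (t ^ (μ y - ρ x))⁻¹ := by
    rw [← Real.rpow_add ht, ← Real.rpow_neg ht.le, neg_sub, sub_eq_add_neg]
  rw [mul_assoc, hinv, ← div_eq_mul_inv, one_le_div (Real.rpow_pos_of_pos ht _)]
  exact hrpow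

theorem exists_interval_of_le_pi {l x : ℝ} (hl : 0 < l) (hlpi : l ≤ Real.pi)
    (hx : x ∈ Icc 0 (2 * Real.pi)) :
    ∃ a b, 0 ≤ a ∧ b ≤ 2 * Real.pi ∧ b - a = l ∧ x ∈ Icc a b := by
  rcases le_total x Real.pi with hxp | hxp
  · exact ⟨x, x + l, hx.1, by linarith, by ring, le_rfl, by linarith⟩
  · exact ⟨x - l, x, by linarith, hx.2, by ring, by linarith, le_rfl⟩

-- The loss in the exponent absorbs the oscillation of `μ` over a short interval around `x`, on
-- which the Sobolev inequality without weights is applied.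
theorem exists_ae_abs_le_weightedNorm {μ ρ : ℝ → ℝ} (hμ : Continuous μ) (hρ : Continuous ρ)
    (h : ∀ x, ρ x < μ x) (δ₀ : ℝ) : ∃ C, 0 ≤ C ∧ ∀ t, 0 < t → t ≤ δ₀ →
      ∀ f g : L2U, HasWeakDeriv f g →
        ∀ᵐ x ∂measU, |f x| ≤ C * t ^ (ρ x) * (weightedNorm μ t f + weightedNorm μ t g) := by
  obtain ⟨A, l, hA, hl, hlpi, hnear⟩ := exists_one_le_mul_rpow_of_near hμ hρ h δ₀
  refine ⟨A * (l⁻¹ + 1) * ‖toL2 (fun _ => 1)‖, by positivity, fun t ht htδ f g hfg => ?_⟩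
  obtain ⟨F, hF⟩ := hfg.exists_isACRep
  obtain ⟨B, hB⟩ := exists_essBoundedBy_of_continuous (continuous_rpow_neg hμ ht)
  have hpoint : ∀ x ∈ Icc 0 (2 * Real.pi), |F x| ≤ A * (l⁻¹ + 1) * ‖toL2 (fun _ => 1)‖ *
      t ^ (ρ x) * (weightedNorm μ t f + weightedNorm μ t g) := by
    intro x hx
    obtain ⟨a, b, ha, hb, hab, hxab⟩ := exists_interval_of_le_pi hl hlpi hx
    have hweight : ∀ y ∈ Icc a b, 1 ≤ A * t ^ ρ x * |t ^ (-μ y)| := fun y hy => by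
      rw [abs_of_pos (Real.rpow_pos_of_pos ht _)]
      refine hnear t ht htδ x hx y ⟨ha.trans hy.1, hy.2.trans hb⟩ (abs_le.2 ⟨?_, ?_⟩) <;>
        linarith [hxab.1, hxab.2, hy.1, hy.2]
    refine (hF.abs_le_of_one_le_mul hB ha hb (by linarith) hxab (by positivity) hweight).trans_eq ?_
    rw [hab, weightedNorm, weightedNorm]
    ring
  filter_upwards [hF.ae_eq, ae_measU_of_forall_mem_Icc hpoint] with x hx hbound
  rw [hx]
  exact hbound

theorem exists_essBoundedBy_norm_add_norm : ∃ C, 0 ≤ C ∧ ∀ f g : L2U, HasWeakDeriv f g →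
    EssBoundedBy f (C * (‖f‖ + ‖g‖)) := by
  obtain ⟨C, hC, hsup⟩ := exists_ae_abs_le_weightedNorm (μ := fun _ => 1) (ρ := fun _ => 0)
    continuous_const continuous_const (fun _ => one_pos) 1
  refine ⟨C, hC, fun f g h => ⟨(Lp.memLp f).1, ?_⟩⟩
  filter_upwards [hsup 1 one_pos le_rfl f g h] with x hx
  simpa only [weightedNorm_one_eq_norm, Real.one_rpow, mul_one] using hx

/-! ### Pointwise products and exponentials in `L²(U)` -/

/-- The pointwise product of two classes in `L²(U)`, which is `0` if it is not square integrable. -/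
def pmul (f g : L2U) : L2U := toL2 (fun x => f x * g x)

/-- The pointwise exponential of a class in `L²(U)`, which is `0` if it is not square integrable. -/
def pexp (f : L2U) : L2U := toL2 (fun x => Real.exp (f x))

theorem pmul_comm (f g : L2U) : pmul f g = pmul g f := by
  simp only [pmul, mul_comm]

theorem EssBoundedBy.congr {φ ψ : ℝ → ℝ} {B : ℝ} (h : EssBoundedBy φ B) (e : ψ =ᵐ[measU] φ) :
    EssBoundedBy ψ B := by
  refine ⟨h.1.congr e.symm, ?_⟩
  filter_upwards [h.2, e] with x hx hex
  rwa [hex]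

section

variable {f g h : L2U} {B : ℝ} (hf : EssBoundedBy f B)

include hf

theorem pmul_ae_eq : pmul f g =ᵐ[measU] fun x => f x * g x :=
  toL2_ae_eq (hf.memLp_mul (Lp.memLp g))

theorem pexp_ae_eq : pexp f =ᵐ[measU] fun x => Real.exp (f x) :=
  toL2_ae_eq hf.exp.memLp

theorem norm_pmul_le : ‖pmul f g‖ ≤ B * ‖g‖ :=
  hf.norm_toL2_mul_le g

theorem pmul_add : pmul f (g + h) = pmul f g + pmul f h := by
  refine toL2_eq_of_ae_eq ?_
  filter_upwards [Lp.coeFn_add g h, Lp.coeFn_add (pmul f g) (pmul f h), pmul_ae_eq hf,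
    pmul_ae_eq hf] with x h₁ h₂ h₃ h₄
  rw [h₁, h₂, Pi.add_apply, Pi.add_apply, h₃, h₄, mul_add]

theorem pmul_smul (c : ℝ) : pmul f (c • g) = c • pmul f g := by
  refine toL2_eq_of_ae_eq ?_
  filter_upwards [Lp.coeFn_smul c g, Lp.coeFn_smul c (pmul f g), pmul_ae_eq hf] with x h₁ h₂ h₃
  rw [h₁, h₂, Pi.smul_apply, Pi.smul_apply, h₃, smul_eq_mul, smul_eq_mul, mul_left_comm]

theorem pmul_sub : pmul f (g - h) = pmul f g - pmul f h := by
  have hneg : g - h = g + (-1 : ℝ) • h := by rw [neg_one_smul, sub_eq_add_neg]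
  rw [hneg, pmul_add hf, pmul_smul hf, neg_one_smul, sub_eq_add_neg]

theorem pmul_sub_left {f' : L2U} {B' : ℝ} (hf' : EssBoundedBy f' B') :
    pmul (f - f') g = pmul f g - pmul f' g := by
  refine toL2_eq_of_ae_eq ?_
  filter_upwards [Lp.coeFn_sub f f', Lp.coeFn_sub (pmul f g) (pmul f' g), pmul_ae_eq hf,
    pmul_ae_eq hf'] with x h₁ h₂ h₃ h₄
  rw [h₁, h₂, Pi.sub_apply, Pi.sub_apply, h₃, h₄, sub_mul]

end

section

variable {ι : Type*} {l : Filter ι} {f f' h : ι → L2U} {g g' k : L2U}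

theorem tendsto_pmul_of_essBoundedBy_sub {B : ℝ} {e : ι → ℝ}
    (hf : ∀ᶠ i in l, ∃ A, EssBoundedBy (f i) A) (hg : EssBoundedBy g B)
    (hfg : ∀ᶠ i in l, EssBoundedBy (f i - g : L2U) (e i)) (he : Tendsto e l (𝓝 0))
    (hh : Tendsto h l (𝓝 k)) : Tendsto (fun i => pmul (f i) (h i)) l (𝓝 (pmul g k)) := by
  have hbound : Tendsto (fun i => e i * ‖h i‖ + B * ‖h i - k‖) l (𝓝 0) := by
    simpa only [zero_mul, mul_zero, add_zero] using
      (he.mul hh.norm).add ((tendsto_iff_norm_sub_tendsto_zero.1 hh).const_mul B)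
  rw [tendsto_iff_norm_sub_tendsto_zero]
  refine squeeze_zero' (Eventually.of_forall fun _ => norm_nonneg _) ?_ hbound
  filter_upwards [hf, hfg] with i ⟨_, hfi⟩ hfgi
  have hsplit : pmul (f i) (h i) - pmul g k = pmul (f i - g) (h i) + pmul g (h i - k) := by
    rw [pmul_sub hg, pmul_sub_left hfi hg, sub_add_sub_cancel]
  rw [hsplit]
  exact (norm_add_le _ _).trans (add_le_add (norm_pmul_le hfgi) (norm_pmul_le hg))

theorem tendsto_norm_sub_add_norm_sub (hf : Tendsto f l (𝓝 g)) (hf' : Tendsto f' l (𝓝 g'))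
    (C : ℝ) : Tendsto (fun i => C * (‖f i - g‖ + ‖f' i - g'‖)) l (𝓝 0) := by
  simpa only [add_zero, mul_zero] using ((tendsto_iff_norm_sub_tendsto_zero.1 hf).add
    (tendsto_iff_norm_sub_tendsto_zero.1 hf')).const_mul C

theorem tendsto_pmul (hff' : ∀ᶠ i in l, HasWeakDeriv (f i) (f' i)) (hgg' : HasWeakDeriv g g')
    (hf : Tendsto f l (𝓝 g)) (hf' : Tendsto f' l (𝓝 g')) (hh : Tendsto h l (𝓝 k)) :
    Tendsto (fun i => pmul (f i) (h i)) l (𝓝 (pmul g k)) := by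
  obtain ⟨C, -, hsup⟩ := exists_essBoundedBy_norm_add_norm
  exact tendsto_pmul_of_essBoundedBy_sub (hff'.mono fun _ h => h.exists_essBoundedBy)
    (hsup _ _ hgg') (hff'.mono fun _ h => hsup _ _ (h.sub hgg'))
    (tendsto_norm_sub_add_norm_sub hf hf' C) hh

end

theorem hasDerivWithinAt_pmul {s : Set ℝ} {t : ℝ} {u v ux : ℝ → L2U} {u' v' vx : L2U}
    (ht : t ∈ s) (hu : HasDerivWithinAt u u' s t) (hv : HasDerivWithinAt v v' s t)
    (hux : ∀ τ ∈ s, HasWeakDeriv (u τ) (ux τ)) (hc : ContinuousWithinAt ux s t)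
    (hvx : HasWeakDeriv (v t) vx) :
    HasDerivWithinAt (fun τ => pmul (u τ) (v τ)) (pmul (v t) u' + pmul (u t) v') s t := by
  have hucont : ContinuousWithinAt u s t := hu.continuousWithinAt
  rw [hasDerivWithinAt_iff_tendsto_slope] at hu hv ⊢
  have hss : 𝓝[s \ {t}] t ≤ 𝓝[s] t := nhdsWithin_mono _ sdiff_subset
  have hmem : ∀ᶠ τ in 𝓝[s \ {t}] t, τ ∈ s := by
    filter_upwards [self_mem_nhdsWithin] with τ hτ using hτ.1
  have hfst : Tendsto (fun τ => pmul (v t) (slope u t τ)) (𝓝[s \ {t}] t) (𝓝 (pmul (v t) u')) :=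
    tendsto_pmul (f' := fun _ => vx) (Eventually.of_forall fun _ => hvx) hvx tendsto_const_nhds
      tendsto_const_nhds hu
  have hsnd : Tendsto (fun τ => pmul (u τ) (slope v t τ)) (𝓝[s \ {t}] t) (𝓝 (pmul (u t) v')) :=
    tendsto_pmul (hmem.mono hux) (hux t ht) (hucont.tendsto.mono_left hss)
      (hc.tendsto.mono_left hss) hv
  refine (hfst.add hsnd).congr' ?_
  filter_upwards [hmem] with τ hτ
  obtain ⟨_, bv⟩ := hvx.exists_essBoundedBy
  obtain ⟨_, bu⟩ := (hux τ hτ).exists_essBoundedBy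
  rw [slope_def_module, slope_def_module, slope_def_module, pmul_smul bv, pmul_smul bu,
    pmul_sub bv, pmul_sub bu, ← smul_add, pmul_comm (v t) (u τ), pmul_comm (v t) (u t),
    add_comm, sub_add_sub_cancel]

theorem HasWeakDeriv.pexp {u u' : L2U} (h : HasWeakDeriv u u') :
    HasWeakDeriv (pexp u) (pmul (pexp u) u') := by
  obtain ⟨B, hB⟩ := h.exists_essBoundedBy
  have hmul : toL2 (fun x => Real.exp (u x) * u' x) = pmul (GowdyFuchs.pexp u) u' := by
    refine toL2_congr ?_
    filter_upwards [pexp_ae_eq hB] with x hx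
    rw [hx]
  rw [← hmul]
  exact h.exp

theorem abs_exp_sub_sub_le {a b : ℝ} (h : |b - a| ≤ 1) :
    |Real.exp b - Real.exp a - Real.exp a * (b - a)| ≤ Real.exp a * (b - a) ^ 2 := by
  have hfactor : Real.exp b - Real.exp a - Real.exp a * (b - a) =
      Real.exp a * (Real.exp (b - a) - 1 - (b - a)) := by
    rw [← add_sub_cancel a b, Real.exp_add, add_sub_cancel_left]
    ring
  rw [hfactor, abs_mul, abs_of_pos (Real.exp_pos a)]
  exact mul_le_mul_of_nonneg_left (Real.abs_exp_sub_one_sub_id_le h) (Real.exp_pos a).le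

theorem norm_pexp_sub_sub_le {u v : L2U} {A B b : ℝ} (hu : EssBoundedBy u A)
    (hv : EssBoundedBy v B) (huv : EssBoundedBy (u - v : L2U) b) (hb : b ≤ 1) :
    ‖pexp u - pexp v - pmul (pexp v) (u - v)‖ ≤ Real.exp B * b * ‖u - v‖ := by
  have hev : EssBoundedBy (pexp v) (Real.exp B) := hv.exp.congr (pexp_ae_eq hv)
  refine Lp.norm_le_mul_norm_of_ae_le_mul ?_
  filter_upwards [Lp.coeFn_sub (pexp u - pexp v) (pmul (pexp v) (u - v)),
    Lp.coeFn_sub (pexp u) (pexp v), pmul_ae_eq (g := u - v) hev, pexp_ae_eq hu, pexp_ae_eq hv,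
    Lp.coeFn_sub u v, huv.2, hv.exp.2] with x h₁ h₂ h₃ h₄ h₅ h₆ hbx hBx
  rw [h₁, Pi.sub_apply, h₂, Pi.sub_apply, h₃, h₄, h₅]
  rw [h₆, Pi.sub_apply] at hbx ⊢
  rw [abs_of_pos (Real.exp_pos _)] at hBx
  calc |Real.exp (u x) - Real.exp (v x) - Real.exp (v x) * (u x - v x)|
      ≤ Real.exp (v x) * (u x - v x) ^ 2 := abs_exp_sub_sub_le (hbx.trans hb)
    _ = Real.exp (v x) * (|u x - v x| * |u x - v x|) := by rw [abs_mul_abs_self, sq]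
    _ ≤ Real.exp B * (b * |u x - v x|) := by gcongr
    _ = _ := by rw [mul_assoc, Real.norm_eq_abs]

-- `exp (u τ)` differs from its linearization `exp (u t) u τ` at `t` by a term of vanishing
-- derivative.
theorem hasDerivWithinAt_pexp {s : Set ℝ} {t : ℝ} {u ux : ℝ → L2U} {u' : L2U}
    (ht : t ∈ s) (hu : HasDerivWithinAt u u' s t)
    (hux : ∀ τ ∈ s, HasWeakDeriv (u τ) (ux τ)) (hc : ContinuousWithinAt ux s t) :
    HasDerivWithinAt (fun τ => pexp (u τ)) (pmul (pexp (u t)) u') s t := by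
  obtain ⟨C, -, hsup⟩ := exists_essBoundedBy_norm_add_norm
  have hexp := (hux t ht).pexp
  obtain ⟨_, hbexp⟩ := hexp.exists_essBoundedBy
  have hlin : HasDerivWithinAt (fun τ => pmul (pexp (u t)) (u τ)) (pmul (pexp (u t)) u') s t := by
    have hzero : pmul (u t) (0 : L2U) = 0 := by
      simpa only [zero_smul] using pmul_smul (g := 0) (hsup _ _ (hux t ht)) 0
    simpa only [hzero, zero_add] using hasDerivWithinAt_pmul ht (hasDerivWithinAt_const t s _) hu
      (fun _ _ => hexp) continuousWithinAt_const (hux t ht)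
  set e : ℝ → ℝ := fun τ => C * (‖u τ - u t‖ + ‖ux τ - ux t‖)
  have he : Tendsto e (𝓝[s] t) (𝓝 0) :=
    tendsto_norm_sub_add_norm_sub hu.continuousWithinAt hc C
  have hrem : HasDerivWithinAt (fun τ => pexp (u τ) - pmul (pexp (u t)) (u τ)) 0 s t := by
    have hsmall : (fun τ => e τ * ‖u τ - u t‖) =o[𝓝[s] t] fun τ => τ - t := by
      simpa only [one_mul] using
        ((Asymptotics.isLittleO_one_iff ℝ).2 he).mul_isBigO
          hu.hasFDerivWithinAt.isBigO_sub.norm_left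
    rw [hasDerivWithinAt_iff_isLittleO]
    refine Asymptotics.IsBigO.trans_isLittleO (Asymptotics.IsBigO.of_bound
      (Real.exp (C * (‖u t‖ + ‖ux t‖))) ?_) hsmall
    filter_upwards [self_mem_nhdsWithin, he.eventually (ge_mem_nhds one_pos)] with τ hτ hτ1
    have hbound := norm_pexp_sub_sub_le (hsup _ _ (hux τ hτ)) (hsup _ _ (hux t ht))
      (hsup _ _ ((hux τ hτ).sub (hux t ht))) hτ1
    rw [smul_zero, sub_zero, sub_sub_sub_comm, ← pmul_sub hbexp]
    exact hbound.trans (by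
      rw [mul_assoc]
      exact mul_le_mul_of_nonneg_left (le_abs_self _) (Real.exp_pos _).le)
  refine ((hlin.add hrem).congr_deriv (add_zero _)).congr_of_mem (fun τ _ => ?_) ht
  exact (add_sub_cancel _ _).symm

theorem essBoundedBy_pexp_sub {u v : L2U} {A B b : ℝ} (hu : EssBoundedBy u A)
    (hv : EssBoundedBy v B) (huv : EssBoundedBy (u - v : L2U) b) (hb : b ≤ 1) :
    EssBoundedBy (pexp u - pexp v : L2U) (Real.exp B * (2 * b)) := by
  refine ⟨(Lp.memLp _).1, ?_⟩
  filter_upwards [Lp.coeFn_sub (pexp u) (pexp v), pexp_ae_eq hu, pexp_ae_eq hv, Lp.coeFn_sub u v,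
    huv.2, hv.exp.2] with x h₁ h₂ h₃ h₄ hbx hBx
  rw [h₄, Pi.sub_apply] at hbx
  have hfactor : Real.exp (u x) - Real.exp (v x) =
      Real.exp (v x) * (Real.exp (u x - v x) - 1) := by
    rw [mul_sub, ← Real.exp_add, add_sub_cancel, mul_one]
  rw [h₁, Pi.sub_apply, h₂, h₃, hfactor, abs_mul]
  exact mul_le_mul hBx ((Real.abs_exp_sub_one_le (hbx.trans hb)).trans (by gcongr)) (abs_nonneg _)
    (Real.exp_pos _).le

theorem tendsto_pmul_pexp {ι : Type*} {l : Filter ι} {f f' h : ι → L2U} {g g' k : L2U}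
    (hff' : ∀ᶠ i in l, HasWeakDeriv (f i) (f' i)) (hgg' : HasWeakDeriv g g')
    (hf : Tendsto f l (𝓝 g)) (hf' : Tendsto f' l (𝓝 g')) (hh : Tendsto h l (𝓝 k)) :
    Tendsto (fun i => pmul (pexp (f i)) (h i)) l (𝓝 (pmul (pexp g) k)) := by
  obtain ⟨C, -, hsup⟩ := exists_essBoundedBy_norm_add_norm
  have he := tendsto_norm_sub_add_norm_sub hf hf' C
  have hg := hsup _ _ hgg'
  refine tendsto_pmul_of_essBoundedBy_sub (hff'.mono fun _ h => h.pexp.exists_essBoundedBy)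
    (hg.exp.congr (pexp_ae_eq hg)) ?_
    (by simpa only [mul_zero] using (he.const_mul 2).const_mul (Real.exp (C * (‖g‖ + ‖g'‖)))) hh
  filter_upwards [hff', he.eventually (ge_mem_nhds one_pos)] with i hi hei
  exact essBoundedBy_pexp_sub (hsup _ _ hi) hg (hsup _ _ (hi.sub hgg')) hei

/-! ### Curves in `L²(U)` with derivatives in both variables -/

/-- `v = D u` on `(0,δ]`, with `D = t ∂_t` and a one-sided derivative at `t = δ`. -/
def HasEulerDeriv (δ : ℝ) (u v : ℝ → L2U) : Prop :=
  ∀ t ∈ Ioc 0 δ, HasDerivWithinAt u (t⁻¹ • v t) (Ioc 0 δ) t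

/-- `v = ∂ₓ u` on `(0,δ]`, as a weak derivative. -/
def HasSpatialDeriv (δ : ℝ) (u v : ℝ → L2U) : Prop :=
  ∀ t ∈ Ioc 0 δ, HasWeakDeriv (u t) (v t)

section

variable {δ : ℝ} {n k : ℕ} {u v u' v' ux vx : ℝ → L2U}

theorem HasEulerDeriv.eqOn_DL2 (h : HasEulerDeriv δ u v) : EqOn (DL2 δ u) v (Ioc 0 δ) :=
  fun t ht => by
    rw [DL2, (h t ht).derivWithin (uniqueDiffOn_Ioc 0 δ t ht), smul_inv_smul₀ ht.1.ne']

theorem HasSpatialDeriv.eqOn_wderiv (h : HasSpatialDeriv δ u v) :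
    EqOn (fun t => wderiv (u t)) v (Ioc 0 δ) :=
  fun t ht => (h t ht).wderiv_eq

theorem HasEulerDeriv.congr (h : HasEulerDeriv δ u v) (hu : EqOn u' u (Ioc 0 δ))
    (hv : EqOn v' v (Ioc 0 δ)) : HasEulerDeriv δ u' v' := fun t ht => by
  rw [hv ht]
  exact (h t ht).congr hu (hu ht)

theorem HasSpatialDeriv.congr (h : HasSpatialDeriv δ u v) (hu : EqOn u' u (Ioc 0 δ))
    (hv : EqOn v' v (Ioc 0 δ)) : HasSpatialDeriv δ u' v' := fun t ht => by
  rw [hv ht, hu ht]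
  exact h t ht

theorem DL2_congr (h : EqOn u v (Ioc 0 δ)) : EqOn (DL2 δ u) (DL2 δ v) (Ioc 0 δ) := fun t ht => by
  rw [DL2, DL2, derivWithin_congr h (h ht)]

theorem HasEulerDeriv.add (h : HasEulerDeriv δ u v) (h' : HasEulerDeriv δ u' v') :
    HasEulerDeriv δ (u + u') (v + v') := fun t ht => by
  rw [Pi.add_apply, smul_add]
  exact (h t ht).add (h' t ht)

theorem HasSpatialDeriv.add (h : HasSpatialDeriv δ u v) (h' : HasSpatialDeriv δ u' v') :
    HasSpatialDeriv δ (u + u') (v + v') :=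
  fun t ht => (h t ht).add (h' t ht)

theorem HasEulerDeriv.smul (c : ℝ) (h : HasEulerDeriv δ u v) :
    HasEulerDeriv δ (c • u) (c • v) := fun t ht => by
  rw [Pi.smul_apply, smul_comm]
  exact (h t ht).const_smul c

theorem HasSpatialDeriv.smul (c : ℝ) (h : HasSpatialDeriv δ u v) :
    HasSpatialDeriv δ (c • u) (c • v) :=
  fun t ht => (h t ht).smul c

theorem HasEulerDeriv.mul (h : HasEulerDeriv δ u u') (h' : HasEulerDeriv δ v v')
    (hx : HasSpatialDeriv δ u ux) (hx' : HasSpatialDeriv δ v vx)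
    (hc : ContinuousOn ux (Ioc 0 δ)) :
    HasEulerDeriv δ (fun t => pmul (u t) (v t))
      ((fun t => pmul (v t) (u' t)) + fun t => pmul (u t) (v' t)) := fun t ht => by
  obtain ⟨_, hu⟩ := (hx t ht).exists_essBoundedBy
  obtain ⟨_, hv⟩ := (hx' t ht).exists_essBoundedBy
  rw [Pi.add_apply, smul_add, ← pmul_smul hv, ← pmul_smul hu]
  exact hasDerivWithinAt_pmul ht (h t ht) (h' t ht) hx (hc t ht) (hx' t ht)

theorem HasSpatialDeriv.mul (hx : HasSpatialDeriv δ u ux) (hx' : HasSpatialDeriv δ v vx) :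
    HasSpatialDeriv δ (fun t => pmul (u t) (v t))
      ((fun t => pmul (v t) (ux t)) + fun t => pmul (u t) (vx t)) :=
  fun t ht => (hx t ht).mul (hx' t ht)

theorem HasEulerDeriv.exp (h : HasEulerDeriv δ u u') (hx : HasSpatialDeriv δ u ux)
    (hc : ContinuousOn ux (Ioc 0 δ)) :
    HasEulerDeriv δ (fun t => pexp (u t)) (fun t => pmul (pexp (u t)) (u' t)) := fun t ht => by
  obtain ⟨_, hexp⟩ := (hx t ht).pexp.exists_essBoundedBy
  rw [← pmul_smul hexp]
  exact hasDerivWithinAt_pexp ht (h t ht) hx (hc t ht)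

theorem HasSpatialDeriv.exp (hx : HasSpatialDeriv δ u ux) :
    HasSpatialDeriv δ (fun t => pexp (u t)) (fun t => pmul (pexp (u t)) (ux t)) :=
  fun t ht => (hx t ht).pexp

end

/-- All derivatives of `u` in `D` and `∂ₓ` of total order at most `n` exist and are continuous
curves in `L²(U)`. -/
def ContJet (δ : ℝ) : ℕ → (ℝ → L2U) → Prop
  | 0, u => ContinuousOn u (Ioc 0 δ)
  | n + 1, u => HasEulerDeriv δ u (DL2 δ u) ∧ HasSpatialDeriv δ u (fun t => wderiv (u t)) ∧
      ContJet δ n (DL2 δ u) ∧ ContJet δ n (fun t => wderiv (u t))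

namespace ContJet

variable {δ : ℝ} {n k : ℕ} {u v w : ℝ → L2U}

theorem hasEulerDeriv (h : ContJet δ (n + 1) u) : HasEulerDeriv δ u (DL2 δ u) := h.1

theorem hasSpatialDeriv (h : ContJet δ (n + 1) u) :
    HasSpatialDeriv δ u (fun t => wderiv (u t)) := h.2.1

theorem eulerDeriv (h : ContJet δ (n + 1) u) : ContJet δ n (DL2 δ u) := h.2.2.1

theorem spatialDeriv (h : ContJet δ (n + 1) u) : ContJet δ n (fun t => wderiv (u t)) := h.2.2.2

theorem congr (h : ContJet δ n u) (e : EqOn v u (Ioc 0 δ)) : ContJet δ n v := by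
  induction n generalizing u v with
  | zero => exact ContinuousOn.congr h e
  | succ n ih =>
    have ex : EqOn (fun t => wderiv (v t)) (fun t => wderiv (u t)) (Ioc 0 δ) := fun t ht =>
      congrArg wderiv (e ht)
    exact ⟨h.hasEulerDeriv.congr e (DL2_congr e), h.hasSpatialDeriv.congr e ex,
      ih h.eulerDeriv (DL2_congr e), ih h.spatialDeriv ex⟩

theorem mk_succ (hv : HasEulerDeriv δ u v) (hw : HasSpatialDeriv δ u w) (hvn : ContJet δ n v)
    (hwn : ContJet δ n w) : ContJet δ (n + 1) u :=
  ⟨hv.congr (fun _ _ => rfl) hv.eqOn_DL2, hw.congr (fun _ _ => rfl) hw.eqOn_wderiv,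
    hvn.congr hv.eqOn_DL2, hwn.congr hw.eqOn_wderiv⟩

theorem continuousOn (h : ContJet δ n u) : ContinuousOn u (Ioc 0 δ) := by
  cases n with
  | zero => exact h
  | succ n => exact fun t ht => (h.hasEulerDeriv t ht).continuousWithinAt

theorem of_succ (h : ContJet δ (n + 1) u) : ContJet δ n u := by
  induction n generalizing u with
  | zero => exact h.continuousOn
  | succ n ih => exact ⟨h.hasEulerDeriv, h.hasSpatialDeriv, ih h.eulerDeriv, ih h.spatialDeriv⟩

theorem mono (h : ContJet δ n u) (hk : k ≤ n) : ContJet δ k u := by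
  induction hk with
  | refl => exact h
  | step _ ih => exact ih h.of_succ

theorem add (h : ContJet δ n u) (h' : ContJet δ n v) : ContJet δ n (u + v) := by
  induction n generalizing u v with
  | zero => exact ContinuousOn.add h h'
  | succ n ih =>
    exact mk_succ (h.hasEulerDeriv.add h'.hasEulerDeriv) (h.hasSpatialDeriv.add h'.hasSpatialDeriv)
      (ih h.eulerDeriv h'.eulerDeriv) (ih h.spatialDeriv h'.spatialDeriv)

theorem smul (c : ℝ) (h : ContJet δ n u) : ContJet δ n (c • u) := by
  induction n generalizing u with
  | zero => exact ContinuousOn.const_smul h c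
  | succ n ih =>
    exact mk_succ (h.hasEulerDeriv.smul c) (h.hasSpatialDeriv.smul c) (ih h.eulerDeriv)
      (ih h.spatialDeriv)

-- In dimension one `H¹(U)` is an algebra acting on `L²(U)`, so one factor needs a spatial
-- derivative even for `n = 0`.
theorem mul (h : ContJet δ n u) (h' : ContJet δ (max n 1) v) :
    ContJet δ n (fun t => pmul (u t) (v t)) := by
  induction n generalizing u v with
  | zero =>
    intro t ht
    simp only [pmul_comm (u _)]
    exact tendsto_pmul (eventually_mem_nhdsWithin.mono h'.hasSpatialDeriv)
      (h'.hasSpatialDeriv t ht) (h'.continuousOn t ht) (h'.spatialDeriv.continuousOn t ht)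
      (h.continuousOn t ht)
  | succ n ih =>
    have hle : max n 1 ≤ n + 1 := max_le n.le_succ (Nat.le_add_left 1 n)
    have hv : ContJet δ (n + 1) v := h'.mono (le_max_left _ _)
    refine mk_succ (h.hasEulerDeriv.mul hv.hasEulerDeriv h.hasSpatialDeriv hv.hasSpatialDeriv
      h.spatialDeriv.continuousOn) (h.hasSpatialDeriv.mul hv.hasSpatialDeriv) (add ?_ ?_)
      (add ?_ ?_) <;> simp only [pmul_comm (u _), pmul_comm (v _) (DL2 δ u _),
        pmul_comm (v _) (wderiv (u _))]
    · exact ih h.eulerDeriv (hv.mono hle)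
    · exact ih hv.eulerDeriv (h.mono hle)
    · exact ih h.spatialDeriv (hv.mono hle)
    · exact ih hv.spatialDeriv (h.mono hle)

theorem exp (h : ContJet δ (n + 1) u) : ContJet δ (n + 1) (fun t => pexp (u t)) := by
  induction n with
  | zero =>
    have hmul : ∀ v : ℝ → L2U, ContinuousOn v (Ioc 0 δ) →
        ContinuousOn (fun t => pmul (pexp (u t)) (v t)) (Ioc 0 δ) := fun v hv t ht =>
      tendsto_pmul_pexp (eventually_mem_nhdsWithin.mono h.hasSpatialDeriv)
        (h.hasSpatialDeriv t ht) (h.continuousOn t ht) (h.spatialDeriv.continuousOn t ht) (hv t ht)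
    exact mk_succ (h.hasEulerDeriv.exp h.hasSpatialDeriv h.spatialDeriv.continuousOn)
      h.hasSpatialDeriv.exp (hmul _ h.eulerDeriv.continuousOn) (hmul _ h.spatialDeriv.continuousOn)
  | succ n ih =>
    have hle : max (n + 1) 1 ≤ n + 1 := max_le le_rfl (Nat.le_add_left 1 n)
    refine mk_succ (h.hasEulerDeriv.exp h.hasSpatialDeriv h.spatialDeriv.continuousOn)
      h.hasSpatialDeriv.exp ?_ ?_ <;> simp only [pmul_comm (pexp _)]
    · exact h.eulerDeriv.mul ((ih h.of_succ).mono hle)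
    · exact h.spatialDeriv.mul ((ih h.of_succ).mono hle)

theorem hasSpatialDeriv_DL2 (h : ContJet δ 2 u) :
    HasSpatialDeriv δ (DL2 δ u) (DL2 δ (fun t => wderiv (u t))) := by
  intro t ht
  have hu := h.hasEulerDeriv t ht
  have hux := h.spatialDeriv.hasEulerDeriv t ht
  rw [hasDerivWithinAt_iff_tendsto_slope] at hu hux
  have : (𝓝[Ioc 0 δ \ {t}] t).NeBot :=
    accPt_principal_iff_nhdsWithin.1 (uniqueDiffWithinAt_iff_accPt.1 (uniqueDiffOn_Ioc 0 δ t ht))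
  have hslope : ∀ᶠ τ in 𝓝[Ioc 0 δ \ {t}] t,
      HasWeakDeriv (slope u t τ) (slope (fun s => wderiv (u s)) t τ) := by
    filter_upwards [self_mem_nhdsWithin] with τ hτ
    rw [slope_def_module, slope_def_module]
    exact ((h.hasSpatialDeriv τ hτ.1).sub (h.hasSpatialDeriv t ht)).smul _
  have hlim := (HasWeakDeriv.of_tendsto hslope hu hux).smul t
  rwa [smul_inv_smul₀ ht.1.ne', smul_inv_smul₀ ht.1.ne'] at hlim

end ContJet

/-- The sum of the weighted norms of all derivatives of `u` in `D` and `∂ₓ` of total order at most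
`n`, with one summand for each word in `D` and `∂ₓ`. -/
def jetNorm (μ : ℝ → ℝ) (δ : ℝ) : ℕ → (ℝ → L2U) → ℝ → ℝ
  | 0, u, t => weightedNorm μ t (u t)
  | n + 1, u, t => weightedNorm μ t (u t) + jetNorm μ δ n (DL2 δ u) t +
      jetNorm μ δ n (fun s => wderiv (u s)) t

section

variable {μ ν ρ : ℝ → ℝ} {δ t : ℝ} {n k : ℕ} {u v w : ℝ → L2U}

theorem jetNorm_nonneg : 0 ≤ jetNorm μ δ n u t := by
  induction n generalizing u with
  | zero => exact weightedNorm_nonneg _ _ _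
  | succ n ih => exact add_nonneg (add_nonneg (weightedNorm_nonneg _ _ _) ih) ih

theorem weightedNorm_le_jetNorm : weightedNorm μ t (u t) ≤ jetNorm μ δ n u t := by
  cases n with
  | zero => exact le_rfl
  | succ n =>
    exact (le_add_of_nonneg_right jetNorm_nonneg).trans (le_add_of_nonneg_right jetNorm_nonneg)

theorem jetNorm_DL2_le_succ : jetNorm μ δ n (DL2 δ u) t ≤ jetNorm μ δ (n + 1) u t :=
  (le_add_of_nonneg_left (weightedNorm_nonneg _ _ _)).trans (le_add_of_nonneg_right jetNorm_nonneg)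

theorem jetNorm_wderiv_le_succ :
    jetNorm μ δ n (fun s => wderiv (u s)) t ≤ jetNorm μ δ (n + 1) u t :=
  le_add_of_nonneg_left (add_nonneg (weightedNorm_nonneg _ _ _) jetNorm_nonneg)

theorem jetNorm_le_succ : jetNorm μ δ n u t ≤ jetNorm μ δ (n + 1) u t := by
  induction n generalizing u with
  | zero => exact weightedNorm_le_jetNorm
  | succ n ih => exact add_le_add (add_le_add le_rfl ih) ih

theorem jetNorm_mono (h : k ≤ n) : jetNorm μ δ k u t ≤ jetNorm μ δ n u t :=
  monotone_nat_of_le_succ (f := fun n => jetNorm μ δ n u t) (fun _ => jetNorm_le_succ) h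

theorem jetNorm_congr (e : EqOn u v (Ioc 0 δ)) (ht : t ∈ Ioc 0 δ) :
    jetNorm μ δ n u t = jetNorm μ δ n v t := by
  induction n generalizing u v with
  | zero => rw [jetNorm, jetNorm, e ht]
  | succ n ih =>
    have ex : EqOn (fun t => wderiv (u t)) (fun t => wderiv (v t)) (Ioc 0 δ) := fun t ht =>
      congrArg wderiv (e ht)
    rw [jetNorm, jetNorm, e ht, ih (DL2_congr e), ih ex]

theorem jetNorm_succ_eq (hv : HasEulerDeriv δ u v) (hw : HasSpatialDeriv δ u w)
    (ht : t ∈ Ioc 0 δ) :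
    jetNorm μ δ (n + 1) u t = weightedNorm μ t (u t) + jetNorm μ δ n v t + jetNorm μ δ n w t := by
  rw [jetNorm, jetNorm_congr hv.eqOn_DL2 ht, jetNorm_congr hw.eqOn_wderiv ht]

theorem jetNorm_add_le (hμ : Continuous μ) (hu : ContJet δ n u) (hv : ContJet δ n v)
    (ht : t ∈ Ioc 0 δ) : jetNorm μ δ n (u + v) t ≤ jetNorm μ δ n u t + jetNorm μ δ n v t := by
  induction n generalizing u v with
  | zero => exact weightedNorm_add_le hμ ht.1 _ _
  | succ n ih =>
    rw [jetNorm_succ_eq (hu.hasEulerDeriv.add hv.hasEulerDeriv)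
      (hu.hasSpatialDeriv.add hv.hasSpatialDeriv) ht, jetNorm, jetNorm, Pi.add_apply]
    linarith [weightedNorm_add_le hμ ht.1 (u t) (v t), ih hu.eulerDeriv hv.eulerDeriv,
      ih hu.spatialDeriv hv.spatialDeriv]

theorem jetNorm_smul (hμ : Continuous μ) (c : ℝ) (hu : ContJet δ n u) (ht : t ∈ Ioc 0 δ) :
    jetNorm μ δ n (c • u) t = |c| * jetNorm μ δ n u t := by
  induction n generalizing u with
  | zero => exact weightedNorm_smul hμ ht.1 _ _
  | succ n ih =>
    rw [jetNorm_succ_eq (hu.hasEulerDeriv.smul c) (hu.hasSpatialDeriv.smul c) ht, ih hu.eulerDeriv,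
      ih hu.spatialDeriv, Pi.smul_apply, weightedNorm_smul hμ ht.1, jetNorm]
    ring

theorem exists_jetNorm_le (hμ : Continuous μ) (hρ : Continuous ρ) (h : ∀ x, ρ x ≤ μ x) (δ₀ : ℝ)
    (n : ℕ) : ∃ C, 0 ≤ C ∧
      ∀ δ ≤ δ₀, ∀ t ∈ Ioc 0 δ, ∀ u, jetNorm ρ δ n u t ≤ C * jetNorm μ δ n u t := by
  obtain ⟨C, hC, hle⟩ := exists_weightedNorm_le hμ hρ h δ₀
  refine ⟨C, hC, fun δ hδ t ht u => ?_⟩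
  induction n generalizing u with
  | zero => exact hle t ht.1 (ht.2.trans hδ) _
  | succ n ih =>
    rw [jetNorm, jetNorm, mul_add, mul_add]
    exact add_le_add (add_le_add (hle t ht.1 (ht.2.trans hδ) _) (ih _)) (ih _)

theorem exists_weightedNorm_pmul_le (hμ : Continuous μ) (hν : Continuous ν) (hρ : Continuous ρ)
    (h : ∀ x, ρ x < μ x + ν x) (δ₀ : ℝ) : ∃ C, 0 ≤ C ∧ ∀ δ ≤ δ₀, ∀ t ∈ Ioc 0 δ, ∀ u v : ℝ → L2U,
      ContJet δ 1 v →
      weightedNorm ρ t (pmul (u t) (v t)) ≤ C * weightedNorm μ t (u t) * jetNorm ν δ 1 v t := by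
  obtain ⟨C, hC, hsup⟩ := exists_ae_abs_le_weightedNorm hν (hρ.sub hμ)
    (fun x => sub_lt_iff_lt_add'.2 (h x)) δ₀
  refine ⟨C, hC, fun δ hδ t ht u v hv => ?_⟩
  have hvx := hv.hasSpatialDeriv t ht
  obtain ⟨_, hB⟩ := hvx.exists_essBoundedBy
  have hJ : weightedNorm ν t (v t) + weightedNorm ν t (wderiv (v t)) ≤ jetNorm ν δ 1 v t := by
    rw [jetNorm]
    exact add_le_add (le_add_of_nonneg_right jetNorm_nonneg) le_rfl
  rw [mul_right_comm]
  refine weightedNorm_le_of_ae_le hμ ht.1 hρ ?_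
  filter_upwards [hsup t ht.1 (ht.2.trans hδ) _ _ hvx, pmul_ae_eq (g := u t) hB] with x hx hpx
  have hrpow : t ^ (-μ x) = t ^ (-ρ x) * t ^ (ρ x - μ x) := by
    rw [← Real.rpow_add ht.1, sub_eq_add_neg, neg_add_cancel_left]
  rw [pmul_comm, hpx, abs_mul]
  calc t ^ (-ρ x) * (|v t x| * |u t x|)
      ≤ t ^ (-ρ x) * ((C * t ^ (ρ x - μ x) * jetNorm ν δ 1 v t) * |u t x|) := by
        have ht0 := ht.1.le
        gcongr
        exact hx.trans (mul_le_mul_of_nonneg_left hJ (mul_nonneg hC (Real.rpow_nonneg ht0 _)))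
    _ = _ := by rw [hrpow]; ring

theorem jetNorm_pmul_succ_le (hρ : Continuous ρ) (hu : ContJet δ (n + 1) u)
    (hv : ContJet δ (n + 1) v) (ht : t ∈ Ioc 0 δ) :
    jetNorm ρ δ (n + 1) (fun s => pmul (u s) (v s)) t ≤
      weightedNorm ρ t (pmul (u t) (v t)) +
        (jetNorm ρ δ n (fun s => pmul (DL2 δ u s) (v s)) t +
          jetNorm ρ δ n (fun s => pmul (DL2 δ v s) (u s)) t) +
        (jetNorm ρ δ n (fun s => pmul (wderiv (u s)) (v s)) t +
          jetNorm ρ δ n (fun s => pmul (wderiv (v s)) (u s)) t) := by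
  have hle : max n 1 ≤ n + 1 := max_le n.le_succ (Nat.le_add_left 1 n)
  have hD := jetNorm_add_le hρ (hu.eulerDeriv.mul (hv.mono hle)) (hv.eulerDeriv.mul (hu.mono hle))
    ht
  have hX := jetNorm_add_le hρ (hu.spatialDeriv.mul (hv.mono hle))
    (hv.spatialDeriv.mul (hu.mono hle)) ht
  rw [jetNorm_succ_eq (hu.hasEulerDeriv.mul hv.hasEulerDeriv hu.hasSpatialDeriv hv.hasSpatialDeriv
    hu.spatialDeriv.continuousOn) (hu.hasSpatialDeriv.mul hv.hasSpatialDeriv) ht]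
  simp only [pmul_comm (v _) (DL2 δ u _), pmul_comm (v _) (wderiv (u _)),
    pmul_comm (u _) (DL2 δ v _), pmul_comm (u _) (wderiv (v _))]
  exact add_le_add (add_le_add le_rfl hD) hX

theorem exists_jetNorm_pmul_le (hμ : Continuous μ) (hν : Continuous ν) (hρ : Continuous ρ)
    (h : ∀ x, ρ x < μ x + ν x) (δ₀ : ℝ) (n : ℕ) : ∃ C, 0 ≤ C ∧ ∀ δ ≤ δ₀, ∀ t ∈ Ioc 0 δ, ∀ u v,
      ContJet δ n u → ContJet δ (max n 1) v → jetNorm ρ δ n (fun s => pmul (u s) (v s)) t ≤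
        C * jetNorm μ δ n u t * jetNorm ν δ (max n 1) v t := by
  induction n generalizing μ ν with
  | zero =>
    obtain ⟨C, hC, hmul⟩ := exists_weightedNorm_pmul_le hμ hν hρ h δ₀
    exact ⟨C, hC, fun δ hδ t ht u v _ hv => hmul δ hδ t ht u v hv⟩
  | succ n ih =>
    obtain ⟨C₀, hC₀, h₀⟩ := exists_weightedNorm_pmul_le hμ hν hρ h δ₀
    obtain ⟨C₁, hC₁, h₁⟩ := ih hμ hν h
    obtain ⟨C₂, hC₂, h₂⟩ := ih hν hμ (fun x => (h x).trans_eq (add_comm _ _))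
    refine ⟨C₀ + (C₁ + C₂) + (C₁ + C₂), by positivity, fun δ hδ t ht u v hu hv => ?_⟩
    have hle : max n 1 ≤ n + 1 := max_le n.le_succ (Nat.le_add_left 1 n)
    rw [max_eq_left (Nat.le_add_left 1 n)] at hv ⊢
    set U := jetNorm μ δ (n + 1) u t
    set V := jetNorm ν δ (n + 1) v t
    have hU : 0 ≤ U := jetNorm_nonneg
    have hV : 0 ≤ V := jetNorm_nonneg
    have huM : jetNorm μ δ (max n 1) u t ≤ U := jetNorm_mono hle
    have hvM : jetNorm ν δ (max n 1) v t ≤ V := jetNorm_mono hle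
    have bound : ∀ {C a b A B : ℝ}, 0 ≤ C → a ≤ A → b ≤ B → 0 ≤ A → 0 ≤ b →
        C * a * b ≤ C * A * B := fun hC ha hb hA hb0 =>
      mul_le_mul (mul_le_mul_of_nonneg_left ha hC) hb hb0 (mul_nonneg hC hA)
    have b₀ := (h₀ δ hδ t ht u v (hv.mono (Nat.le_add_left 1 n))).trans
      (bound hC₀ weightedNorm_le_jetNorm (jetNorm_mono (Nat.le_add_left 1 n)) hU jetNorm_nonneg)
    have bDu := (h₁ δ hδ t ht _ _ hu.eulerDeriv (hv.mono hle)).trans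
      (bound hC₁ jetNorm_DL2_le_succ hvM hU jetNorm_nonneg)
    have bDv := (h₂ δ hδ t ht _ _ hv.eulerDeriv (hu.mono hle)).trans
      (bound hC₂ jetNorm_DL2_le_succ huM hV jetNorm_nonneg)
    have bXu := (h₁ δ hδ t ht _ _ hu.spatialDeriv (hv.mono hle)).trans
      (bound hC₁ jetNorm_wderiv_le_succ hvM hU jetNorm_nonneg)
    have bXv := (h₂ δ hδ t ht _ _ hv.spatialDeriv (hu.mono hle)).trans
      (bound hC₂ jetNorm_wderiv_le_succ huM hV jetNorm_nonneg)
    calc _ ≤ _ := jetNorm_pmul_succ_le hρ hu hv ht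
      _ ≤ C₀ * U * V + (C₁ * U * V + C₂ * V * U) + (C₁ * U * V + C₂ * V * U) :=
        add_le_add (add_le_add b₀ (add_le_add bDu bDv)) (add_le_add bXu bXv)
      _ = (C₀ + (C₁ + C₂) + (C₁ + C₂)) * U * V := by ring

end

section

variable {μ : ℝ → ℝ} {δ t B : ℝ} {n p q : ℕ} {u v w : ℝ → L2U}

theorem DL2_iterate_congr (p : ℕ) (e : EqOn u v (Ioc 0 δ)) :
    EqOn ((DL2 δ)^[p] u) ((DL2 δ)^[p] v) (Ioc 0 δ) := by
  induction p generalizing u v with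
  | zero => exact e
  | succ _ ih => exact ih (DL2_congr e)

theorem ContJet.eqOn_DL2_iterate_wderiv (h : ContJet δ (p + 1) u) :
    EqOn ((DL2 δ)^[p] (fun s => wderiv (u s))) (fun s => wderiv ((DL2 δ)^[p] u s)) (Ioc 0 δ) := by
  induction p generalizing u with
  | zero => exact fun _ _ => rfl
  | succ p ih =>
    intro t ht
    have hcomm := (h.mono (Nat.le_add_left 2 p)).hasSpatialDeriv_DL2.eqOn_wderiv
    rw [Function.iterate_succ_apply, Function.iterate_succ_apply, ← DL2_iterate_congr p hcomm ht,
      ih h.eulerDeriv ht]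

theorem ContJet.wderiv_iterate_DL2_iterate_wderiv (h : ContJet δ (n + 1) u) (hpq : p + q ≤ n)
    (ht : t ∈ Ioc 0 δ) :
    wderiv^[q] ((DL2 δ)^[p] (fun s => wderiv (u s)) t) = wderiv^[q + 1] ((DL2 δ)^[p] u t) := by
  rw [(h.mono (by omega : p + 1 ≤ n + 1)).eqOn_DL2_iterate_wderiv ht,
    Function.iterate_succ_apply]

theorem jetNorm_le_of_mixed_le (h : ContJet δ n u) (ht : t ∈ Ioc 0 δ)
    (hB : ∀ p q, p + q ≤ n → weightedNorm μ t (wderiv^[q] ((DL2 δ)^[p] u t)) ≤ B) :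
    jetNorm μ δ n u t ≤ 3 ^ n * B := by
  induction n generalizing u with
  | zero =>
    rw [pow_zero, one_mul]
    exact hB 0 0 le_rfl
  | succ n ih =>
    have hu : weightedNorm μ t (u t) ≤ B := hB 0 0 (Nat.zero_le _)
    have hD := ih h.eulerDeriv fun p q hpq => hB (p + 1) q (by omega)
    have hX := ih h.spatialDeriv fun p q hpq => by
      rw [h.wderiv_iterate_DL2_iterate_wderiv hpq ht]
      exact hB p (q + 1) (by omega)
    have hpow : B ≤ 3 ^ n * B := le_mul_of_one_le_left ((weightedNorm_nonneg _ _ _).trans hu)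
      (one_le_pow₀ (by norm_num))
    rw [jetNorm, pow_succ]
    linarith

theorem mixed_le_jetNorm (hpq : p + q ≤ n) :
    weightedNorm μ t (wderiv^[q] ((DL2 δ)^[p] u t)) ≤ jetNorm μ δ n u t := by
  induction n generalizing u p q with
  | zero =>
    obtain ⟨rfl, rfl⟩ : p = 0 ∧ q = 0 := by omega
    exact le_rfl
  | succ n ih =>
    rcases p with _ | p
    · rcases q with _ | q
      · exact weightedNorm_le_jetNorm
      · exact (ih (u := fun s => wderiv (u s)) (p := 0) (q := q) (by omega)).trans
          jetNorm_wderiv_le_succ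
    · exact (ih (u := DL2 δ u) (p := p) (q := q) (by omega)).trans jetNorm_DL2_le_succ

theorem HasEulerDeriv.id_smul (h : HasEulerDeriv δ u v) :
    HasEulerDeriv δ (fun s => s • u s) ((fun s => s • u s) + fun s => s • v s) := by
  intro t ht
  refine ((hasDerivWithinAt_id t (Ioc 0 δ)).smul (h t ht)).congr_deriv ?_
  rw [id, one_smul, Pi.add_apply, smul_add, inv_smul_smul₀ ht.1.ne', inv_smul_smul₀ ht.1.ne',
    smul_inv_smul₀ ht.1.ne', add_comm]

theorem HasSpatialDeriv.id_smul (h : HasSpatialDeriv δ u v) :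
    HasSpatialDeriv δ (fun s => s • u s) (fun s => s • v s) :=
  fun t ht => (h t ht).smul t

theorem ContJet.id_smul (h : ContJet δ n u) : ContJet δ n (fun s => s • u s) := by
  induction n generalizing u with
  | zero => exact continuousOn_id.smul h
  | succ n ih =>
    exact ContJet.mk_succ h.hasEulerDeriv.id_smul h.hasSpatialDeriv.id_smul
      ((ih h.of_succ).add (ih h.eulerDeriv)) (ih h.spatialDeriv)

theorem jetNorm_id_smul_le (hμ : Continuous μ) (h : ContJet δ n u) (ht : t ∈ Ioc 0 δ)
    (hB : ∀ p q, p + q ≤ n → t * weightedNorm μ t (wderiv^[q] ((DL2 δ)^[p] u t)) ≤ B) :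
    jetNorm μ δ n (fun s => s • u s) t ≤ 4 ^ n * B := by
  have hsmul : ∀ f : L2U, weightedNorm μ t (t • f) = t * weightedNorm μ t f := fun f => by
    rw [weightedNorm_smul hμ ht.1, abs_of_pos ht.1]
  induction n generalizing u with
  | zero =>
    rw [pow_zero, one_mul, jetNorm, hsmul]
    exact hB 0 0 le_rfl
  | succ n ih =>
    have hu : t * weightedNorm μ t (u t) ≤ B := hB 0 0 (Nat.zero_le _)
    have h₀ := ih h.of_succ fun p q hpq => hB p q (by omega)
    have hD := ih h.eulerDeriv fun p q hpq => hB (p + 1) q (by omega)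
    have hX := ih h.spatialDeriv fun p q hpq => by
      rw [h.wderiv_iterate_DL2_iterate_wderiv hpq ht]
      exact hB p (q + 1) (by omega)
    have hadd := jetNorm_add_le hμ h.of_succ.id_smul h.eulerDeriv.id_smul ht
    have hpow : B ≤ 4 ^ n * B := le_mul_of_one_le_left
      ((mul_nonneg ht.1.le (weightedNorm_nonneg _ _ _)).trans hu) (one_le_pow₀ (by norm_num))
    rw [jetNorm_succ_eq h.hasEulerDeriv.id_smul h.hasSpatialDeriv.id_smul ht, pow_succ, hsmul]
    linarith

theorem exists_jetNorm_le_of_mixed_le (hμ : Continuous μ) (δ₀ : ℝ) (n : ℕ) : ∃ C, 0 ≤ C ∧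
    ∀ δ ≤ δ₀, ∀ t ∈ Ioc 0 δ, ∀ u B, ContJet δ (n + 1) u →
      (∀ p q, p + q ≤ n + 1 → (if q = n + 1 then t else 1) *
        weightedNorm μ t (wderiv^[q] ((DL2 δ)^[p] u t)) ≤ B) →
      jetNorm μ δ n u t ≤ C * B ∧ jetNorm μ δ n (DL2 δ u) t ≤ C * B ∧
        jetNorm μ δ n (fun s => s • wderiv (u s)) t ≤ C * B := by
  refine ⟨4 ^ n * max 1 δ₀, by positivity, fun δ hδ t ht u B hu htop => ?_⟩
  have hlow : ∀ p q, p + q ≤ n + 1 → q ≤ n →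
      weightedNorm μ t (wderiv^[q] ((DL2 δ)^[p] u t)) ≤ B := fun p q hpq hq => by
    simpa only [if_neg (show q ≠ n + 1 by omega), one_mul] using htop p q hpq
  have hB : 0 ≤ B := (weightedNorm_nonneg _ _ _).trans (hlow 0 0 (Nat.zero_le _) (Nat.zero_le _))
  have hpow : (3 : ℝ) ^ n * B ≤ 4 ^ n * max 1 δ₀ * B :=
    mul_le_mul_of_nonneg_right ((pow_le_pow_left₀ (by norm_num) (by norm_num) n).trans
      (le_mul_of_one_le_right (by positivity) (le_max_left _ _))) hB
  refine ⟨?_, ?_, ?_⟩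
  · exact (jetNorm_le_of_mixed_le hu.of_succ ht fun p q hpq =>
      hlow p q (by omega) (by omega)).trans hpow
  · exact (jetNorm_le_of_mixed_le hu.eulerDeriv ht fun p q hpq =>
      hlow (p + 1) q (by omega) (by omega)).trans hpow
  · rw [mul_assoc]
    refine jetNorm_id_smul_le hμ hu.spatialDeriv ht fun p q hpq => ?_
    rw [hu.wderiv_iterate_DL2_iterate_wderiv hpq ht]
    rcases eq_or_ne (q + 1) (n + 1) with hq | hq
    · have htop' := htop p (q + 1) (by omega)
      rw [if_pos hq] at htop'
      exact htop'.trans (le_mul_of_one_le_left hB (le_max_left _ _))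
    · exact mul_le_mul (ht.2.trans (hδ.trans (le_max_right _ _)))
        (hlow p (q + 1) (by omega) (by omega)) (weightedNorm_nonneg _ _ _) (by positivity)

end

/-! ### Curves in Sobolev spaces -/

section

variable {δ t : ℝ} {m n p q j : ℕ} {u v : ℝ → L2U} {f : ℝ → ℝ} {w : ℝ → ℝ → ℝ}

/-- The continuous linear map `H^j(U) → L²(U)` taking an element to its underlying function. -/
def sobFnCLM (j : ℕ) : Sobolev j →L[ℝ] L2U :=
  (PiLp.proj 2 (fun _ : Fin (j + 1) => L2U) 0).comp (Sobolev j).subtypeL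

/-- The weak derivative as a linear map `H^{j+1}(U) → H^j(U)`. -/
def sobDerivₗ (j : ℕ) : Sobolev (j + 1) →ₗ[ℝ] Sobolev j where
  toFun u := ⟨WithLp.toLp 2 fun q : Fin (j + 1) => u.1 q.succ, fun q => u.2 q.succ⟩
  map_add' _ _ := rfl
  map_smul' _ _ := rfl

theorem norm_sobDerivₗ_le (u : Sobolev (j + 1)) : ‖sobDerivₗ j u‖ ≤ 1 * ‖u‖ := by
  rw [one_mul, Submodule.coe_norm, Submodule.coe_norm, PiLp.norm_eq_of_L2, PiLp.norm_eq_of_L2,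
    Fin.sum_univ_succ (n := j + 1)]
  exact Real.sqrt_le_sqrt (le_add_of_nonneg_left (sq_nonneg _))

/-- The weak derivative as a continuous linear map `H^{j+1}(U) → H^j(U)`. -/
def sobDerivCLM (j : ℕ) : Sobolev (j + 1) →L[ℝ] Sobolev j :=
  (sobDerivₗ j).mkContinuous 1 norm_sobDerivₗ_le

theorem hasWeakDeriv_sobDerivCLM (u : Sobolev (j + 1)) :
    HasWeakDeriv (sobFn u) (sobFn (sobDerivCLM j u)) := u.2 0

/-- `u ∈ C^p((0,δ], H^j(U))`, for a curve `u` in `L²(U)`. -/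
def CurveMemC (δ : ℝ) (p j : ℕ) (u : ℝ → L2U) : Prop :=
  ∃ W : ℝ → Sobolev j, ContDiffOn ℝ p W (Ioc 0 δ) ∧ ∀ t ∈ Ioc 0 δ, u t = sobFn (W t)

theorem hasEulerDeriv_sobFn {W : ℝ → Sobolev j} (hW : DifferentiableOn ℝ W (Ioc 0 δ)) :
    HasEulerDeriv δ (fun t => sobFn (W t)) (fun t => sobFn (t • derivWithin W (Ioc 0 δ) t)) := by
  intro t ht
  have hinv : t⁻¹ • sobFn (t • derivWithin W (Ioc 0 δ) t) = sobFn (derivWithin W (Ioc 0 δ) t) :=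
    inv_smul_smul₀ ht.1.ne' (sobFn (derivWithin W (Ioc 0 δ) t))
  rw [hinv]
  exact (sobFnCLM j).hasFDerivAt.comp_hasDerivWithinAt t (hW t ht).hasDerivWithinAt

theorem CurveMemC.hasEulerDeriv (h : CurveMemC δ (p + 1) j u) :
    HasEulerDeriv δ u (DL2 δ u) := by
  obtain ⟨W, hW, e⟩ := h
  have hD := hasEulerDeriv_sobFn (hW.differentiableOn (by simp))
  exact hD.congr e fun t ht => (DL2_congr e ht).trans (hD.eqOn_DL2 ht)

theorem CurveMemC.eulerDeriv (h : CurveMemC δ (p + 1) j u) : CurveMemC δ p j (DL2 δ u) := by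
  obtain ⟨W, hW, e⟩ := h
  exact ⟨_, contDiffOn_id.smul (hW.derivWithin (uniqueDiffOn_Ioc 0 δ) le_rfl), fun t ht =>
    (DL2_congr e ht).trans ((hasEulerDeriv_sobFn (hW.differentiableOn (by simp))).eqOn_DL2 ht)⟩

theorem CurveMemC.hasSpatialDeriv (h : CurveMemC δ p (j + 1) u) :
    HasSpatialDeriv δ u (fun t => wderiv (u t)) := by
  obtain ⟨W, -, e⟩ := h
  intro t ht
  beta_reduce
  rw [e t ht]
  exact (hasWeakDeriv_sobDerivCLM (W t)).self

theorem CurveMemC.spatialDeriv (h : CurveMemC δ p (j + 1) u) :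
    CurveMemC δ p j (fun t => wderiv (u t)) := by
  obtain ⟨W, hW, e⟩ := h
  refine ⟨fun t => sobDerivCLM j (W t), (sobDerivCLM j).contDiff.comp_contDiffOn hW, fun t ht => ?_⟩
  beta_reduce
  rw [e t ht]
  exact (hasWeakDeriv_sobDerivCLM (W t)).wderiv_eq

theorem ContJet.of_curveMemC (h : ∀ p j, p + j = m → CurveMemC δ p j u) : ContJet δ m u := by
  induction m generalizing u with
  | zero =>
    obtain ⟨W, hW, e⟩ := h 0 0 rfl
    exact ((sobFnCLM 0).continuous.comp_continuousOn hW.continuousOn).congr e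
  | succ m ih =>
    exact ⟨(h (0 + 1) m (by omega)).hasEulerDeriv, (h 0 (m + 1) (by omega)).hasSpatialDeriv,
      ih fun p j hpj => (h (p + 1) j (by omega)).eulerDeriv,
      ih fun p j hpj => (h p (j + 1) (by omega)).spatialDeriv⟩

theorem ContJet.hasWeakDeriv_iterate (h : ContJet δ n u) (ht : t ∈ Ioc 0 δ) (hq : q < n) :
    HasWeakDeriv (wderiv^[q] (u t)) (wderiv^[q + 1] (u t)) := by
  obtain ⟨n, rfl⟩ : ∃ k, n = k + 1 := ⟨n - 1, by omega⟩
  induction q generalizing n u with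
  | zero => exact h.hasSpatialDeriv t ht
  | succ q ih =>
    obtain ⟨n, rfl⟩ : ∃ k, n = k + 1 := ⟨n - 1, by omega⟩
    exact ih n h.spatialDeriv (by omega)

theorem ContJet.iterate_spatialDeriv (h : ContJet δ (n + q) u) :
    ContJet δ n (fun t => wderiv^[q] (u t)) := by
  induction q generalizing u with
  | zero => exact h
  | succ q ih => exact ih (u := fun t => wderiv (u t)) h.spatialDeriv

theorem ContJet.hasEulerDeriv_iterate (h : ContJet δ (q + 1) u) :
    HasEulerDeriv δ (fun t => wderiv^[q] (u t)) (fun t => wderiv^[q] (DL2 δ u t)) := by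
  induction q generalizing u with
  | zero => exact h.hasEulerDeriv
  | succ q ih =>
    refine (ih h.spatialDeriv).congr (fun _ _ => rfl) fun t ht => ?_
    rw [Function.iterate_succ_apply]
    exact congrArg _
      ((h.mono (by omega : 2 ≤ q + 1 + 1)).hasSpatialDeriv_DL2.eqOn_wderiv ht)

open Classical in
/-- The curve in `H^j(U)` underlying a curve in `L²(U)`, with the value `0` where the curve does
not have `j` weak derivatives. -/
def sobolevLift (j : ℕ) (u : ℝ → L2U) (t : ℝ) : Sobolev j :=
  if h : ∀ q < j, HasWeakDeriv (wderiv^[q] (u t)) (wderiv^[q + 1] (u t)) then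
    ⟨WithLp.toLp 2 fun q : Fin (j + 1) => wderiv^[q] (u t), fun q => h q q.2⟩
  else 0

theorem coe_sobolevLift (h : ContJet δ n u) (hj : j ≤ n) (ht : t ∈ Ioc 0 δ) :
    (sobolevLift j u t : PiLp 2 fun _ : Fin (j + 1) => L2U) =
      WithLp.toLp 2 fun q : Fin (j + 1) => wderiv^[q] (u t) := by
  rw [sobolevLift, dif_pos fun q hq => h.hasWeakDeriv_iterate ht (hq.trans_le hj)]

theorem ContJet.continuousOn_sobolevLift (h : ContJet δ j u) :
    ContinuousOn (sobolevLift j u) (Ioc 0 δ) := by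
  rw [Topology.IsInducing.subtypeVal.continuousOn_iff]
  refine ContinuousOn.congr ?_ fun t ht => coe_sobolevLift h le_rfl ht
  refine (PiLp.continuous_toLp 2 _).comp_continuousOn (continuousOn_pi.2 fun q => ?_)
  exact (h.mono (by omega : 0 + (q : ℕ) ≤ j)).iterate_spatialDeriv.continuousOn

theorem hasDerivWithinAt_of_coe {E : Type*} [NormedAddCommGroup E] [NormedSpace ℝ E]
    {V : Submodule ℝ E} {s : Set ℝ} {c : ℝ → V} {c' : V}
    (h : HasDerivWithinAt (fun r => (c r : E)) c' s t) : HasDerivWithinAt c c' s t := by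
  rw [hasDerivWithinAt_iff_tendsto_slope] at h ⊢
  rw [tendsto_subtype_rng]
  exact h.congr fun r => by rw [slope_def_module, slope_def_module]; rfl

theorem ContJet.hasDerivWithinAt_sobolevLift (h : ContJet δ (n + 1) u) (hj : j ≤ n)
    (ht : t ∈ Ioc 0 δ) :
    HasDerivWithinAt (sobolevLift j u) (t⁻¹ • sobolevLift j (DL2 δ u) t) (Ioc 0 δ) t := by
  have hpi : HasDerivWithinAt (fun t => fun q : Fin (j + 1) => wderiv^[q] (u t))
      (fun q : Fin (j + 1) => t⁻¹ • wderiv^[q] (DL2 δ u t)) (Ioc 0 δ) t :=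
    hasDerivWithinAt_pi.2 fun q =>
      (h.mono (by omega : (q : ℕ) + 1 ≤ n + 1)).hasEulerDeriv_iterate t ht
  have hcoe := (PiLp.continuousLinearEquiv 2 ℝ
    (fun _ : Fin (j + 1) => L2U)).symm.hasFDerivAt.comp_hasDerivWithinAt t hpi
  refine hasDerivWithinAt_of_coe ((hcoe.congr (fun s hs => coe_sobolevLift h (by omega) hs)
    (coe_sobolevLift h (by omega) ht)).congr_deriv ?_)
  rw [Submodule.coe_smul, coe_sobolevLift h.eulerDeriv hj ht]
  rfl

theorem ContJet.contDiffOn_sobolevLift (h : ContJet δ (p + j) u) :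
    ContDiffOn ℝ p (sobolevLift j u) (Ioc 0 δ) := by
  induction p generalizing u with
  | zero =>
    rw [Nat.cast_zero, contDiffOn_zero]
    exact (h.mono (Nat.le_add_left j 0)).continuousOn_sobolevLift
  | succ p ih =>
    rw [Nat.add_right_comm] at h
    have hU : UniqueDiffOn ℝ (Ioc 0 δ) := uniqueDiffOn_Ioc 0 δ
    have hder : ∀ t ∈ Ioc 0 δ, _ := fun t ht =>
      h.hasDerivWithinAt_sobolevLift (Nat.le_add_left j p) ht
    rw [Nat.cast_succ, contDiffOn_succ_iff_derivWithin hU]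
    refine ⟨fun t ht => (hder t ht).differentiableWithinAt, by simp, ?_⟩
    exact ((contDiffOn_id.inv fun t ht => ht.1.ne').smul (ih h.eulerDeriv)).congr
      fun t ht => (hder t ht).derivWithin (hU t ht)

theorem ContJet.curveMemC (h : ContJet δ (p + j) u) : CurveMemC δ p j u :=
  ⟨sobolevLift j u, h.contDiffOn_sobolevLift, fun t ht => by
    rw [sobFn, coe_sobolevLift h (Nat.le_add_left j p) ht]
    rfl⟩

theorem MemC.curveMemC (h : MemC δ p j w) : CurveMemC δ p j (fun t => toL2 (w t)) := by
  obtain ⟨W, hW, e⟩ := h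
  exact ⟨W, hW, fun t ht => toL2_eq_of_ae_eq (e t ht)⟩

theorem CurveMemC.memC (hw : ∀ t ∈ Ioc 0 δ, MemLp (w t) 2 measU)
    (h : CurveMemC δ p j (fun t => toL2 (w t))) : MemC δ p j w := by
  obtain ⟨W, hW, e⟩ := h
  refine ⟨W, hW, fun t ht => ?_⟩
  rw [← e t ht]
  exact (toL2_ae_eq (hw t ht)).symm

/-- `f ∈ H^n(U)`, as the existence of the iterated weak derivatives of `f ∈ L²(U)`. -/
def HasWeakDerivs : ℕ → L2U → Prop
  | 0, _ => True
  | n + 1, f => HasWeakDeriv f (wderiv f) ∧ HasWeakDerivs n (wderiv f)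

theorem hasWeakDerivs_sobFn (u : Sobolev n) : HasWeakDerivs n (sobFn u) := by
  induction n with
  | zero => trivial
  | succ n ih =>
    have h := hasWeakDeriv_sobDerivCLM u
    exact ⟨h.self, h.wderiv_eq ▸ ih _⟩

theorem HasWeakDerivs.of_succ {f : L2U} (h : HasWeakDerivs (n + 1) f) : HasWeakDerivs n f := by
  induction n generalizing f with
  | zero => trivial
  | succ n ih => exact ⟨h.1, ih h.2⟩

theorem MemSobolev.hasWeakDerivs (h : MemSobolev n f) : HasWeakDerivs n (toL2 f) := by
  obtain ⟨u, hu⟩ := h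
  rw [toL2_eq_of_ae_eq hu]
  exact hasWeakDerivs_sobFn u

theorem MemSobolev.memLp (h : MemSobolev n f) : MemLp f 2 measU := by
  obtain ⟨u, hu⟩ := h
  exact (Lp.memLp (sobFn u)).ae_eq hu.symm

theorem hasWeakDerivs_of_contDiff (hf : ContDiff ℝ ∞ f)
    (hp : Function.Periodic f (2 * Real.pi)) : HasWeakDerivs n (toL2 f) := by
  induction n generalizing f with
  | zero => trivial
  | succ n ih =>
    have h := hasWeakDeriv_of_contDiff (hf.of_le (by simp)) hp
    refine ⟨h.self, ?_⟩
    rw [h.wderiv_eq]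
    exact ih (contDiff_infty_iff_deriv.1 hf).2 fun x => by
      rw [← deriv_comp_add_const, show (fun y => f (y + 2 * Real.pi)) = f from funext hp]

end

/-! ### Curves that are constant or logarithmic in time -/

section

variable {μ : ℝ → ℝ} {δ t : ℝ} {n : ℕ} {f g : L2U}

theorem hasEulerDeriv_const (f : L2U) : HasEulerDeriv δ (fun _ => f) (fun _ => 0) := fun t _ => by
  rw [smul_zero]
  exact hasDerivWithinAt_const _ _ _

theorem ContJet.zero : ContJet δ n (fun _ => 0) := by
  induction n with
  | zero => exact continuousOn_const
  | succ n ih => exact ContJet.mk_succ (hasEulerDeriv_const 0) (fun _ _ => HasWeakDeriv.zero) ih ih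

theorem jetNorm_zero (ht : t ∈ Ioc 0 δ) : jetNorm μ δ n (fun _ => 0) t = 0 := by
  induction n with
  | zero => exact weightedNorm_zero _ _
  | succ n ih =>
    rw [jetNorm_succ_eq (hasEulerDeriv_const 0) (fun _ _ => HasWeakDeriv.zero) ht, ih,
      weightedNorm_zero, add_zero, add_zero]

theorem ContJet.const (h : HasWeakDerivs n f) : ContJet δ n (fun _ => f) := by
  induction n generalizing f with
  | zero => exact continuousOn_const
  | succ n ih =>
    exact ContJet.mk_succ (hasEulerDeriv_const f) (fun _ _ => h.1) ContJet.zero (ih h.2)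

theorem weightedNorm_zero_weight (t : ℝ) (f : L2U) : weightedNorm (fun _ => 0) t f = ‖f‖ := by
  simp only [weightedNorm, neg_zero, Real.rpow_zero, one_mul, toL2_coeFn]

theorem exists_weightedNorm_le_norm (hμ : Continuous μ) (hμ0 : ∀ x, μ x ≤ 0) (δ₀ : ℝ) :
    ∃ C, 0 ≤ C ∧ ∀ t, 0 < t → t ≤ δ₀ → ∀ f : L2U, weightedNorm μ t f ≤ C * ‖f‖ := by
  obtain ⟨C, hC, hle⟩ := exists_weightedNorm_le (μ := fun _ => 0) continuous_const hμ hμ0 δ₀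
  exact ⟨C, hC, fun t ht htδ f => weightedNorm_zero_weight t f ▸ hle t ht htδ f⟩

theorem exists_jetNorm_const_le (hμ : Continuous μ) (hμ0 : ∀ x, μ x ≤ 0) (δ₀ : ℝ)
    (h : HasWeakDerivs n f) :
    ∃ C, 0 ≤ C ∧ ∀ δ ≤ δ₀, ∀ t ∈ Ioc 0 δ, jetNorm μ δ n (fun _ => f) t ≤ C := by
  obtain ⟨C, hC, hle⟩ := exists_weightedNorm_le_norm hμ hμ0 δ₀
  induction n generalizing f with
  | zero => exact ⟨C * ‖f‖, by positivity, fun δ hδ t ht => hle t ht.1 (ht.2.trans hδ) f⟩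
  | succ n ih =>
    obtain ⟨C', hC', hle'⟩ := ih h.2
    refine ⟨C * ‖f‖ + C', by positivity, fun δ hδ t ht => ?_⟩
    rw [jetNorm_succ_eq (hasEulerDeriv_const f) (fun _ _ => h.1) ht, jetNorm_zero ht, add_zero]
    exact add_le_add (hle t ht.1 (ht.2.trans hδ) f) (hle' δ hδ t ht)

/-- The constant function `1` as an element of `L²(U)`. -/
def oneL2 : L2U := toL2 fun _ => 1

theorem oneL2_ae_eq : oneL2 =ᵐ[measU] fun _ => (1 : ℝ) :=
  toL2_ae_eq (memLp_of_continuousOn continuousOn_const)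

theorem pmul_oneL2 (f : L2U) : pmul f oneL2 = f := by
  refine toL2_eq_of_ae_eq ?_
  filter_upwards [oneL2_ae_eq] with x hx
  rw [hx, mul_one]

theorem smul_oneL2_ae_eq (c : ℝ) : (c • oneL2 : L2U) =ᵐ[measU] fun _ => c := by
  filter_upwards [Lp.coeFn_smul c oneL2, oneL2_ae_eq] with x hsmul hone
  rw [hsmul, Pi.smul_apply, hone, smul_eq_mul, mul_one]

theorem hasWeakDerivs_oneL2 : HasWeakDerivs n oneL2 :=
  hasWeakDerivs_of_contDiff contDiff_const fun _ => rfl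

theorem hasWeakDeriv_oneL2 : HasWeakDeriv oneL2 0 := by
  have h := hasWeakDeriv_of_contDiff (f := fun _ => 1) contDiff_const (fun _ => rfl)
  rwa [deriv_const', toL2_zero] at h

theorem hasEulerDeriv_log : HasEulerDeriv δ (fun t => Real.log t • oneL2) (fun _ => oneL2) :=
  fun _ ht => ((Real.hasDerivAt_log ht.1.ne').hasDerivWithinAt).smul_const oneL2

theorem hasSpatialDeriv_log : HasSpatialDeriv δ (fun t => Real.log t • oneL2) (fun _ => 0) :=
  fun t _ => (smul_zero (Real.log t) : Real.log t • (0 : L2U) = 0) ▸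
    hasWeakDeriv_oneL2.smul (Real.log t)

theorem ContJet.log : ContJet δ n (fun t => Real.log t • oneL2) := by
  cases n with
  | zero => exact (Real.continuousOn_log.mono fun t ht => ht.1.ne').smul continuousOn_const
  | succ n =>
    exact ContJet.mk_succ hasEulerDeriv_log hasSpatialDeriv_log (ContJet.const hasWeakDerivs_oneL2)
      ContJet.zero

theorem rpow_mul_abs_log_le {η δ₀ : ℝ} (hη : 0 < η) (ht : 0 < t) (hδ : t ≤ δ₀) :
    t ^ η * |Real.log t| ≤ η⁻¹ + max 1 δ₀ ^ η * max 1 δ₀ := by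
  have hmax : 0 ≤ max 1 δ₀ ^ η * max 1 δ₀ := by positivity
  rcases le_or_gt t 1 with h | h
  · have hlog := (Real.abs_log_mul_self_rpow_lt t η ht h hη).le
    rw [abs_mul, abs_of_pos (Real.rpow_pos_of_pos ht η), one_div, mul_comm] at hlog
    linarith
  · have hlog : |Real.log t| ≤ max 1 δ₀ := by
      rw [abs_of_nonneg (Real.log_nonneg h.le)]
      linarith [Real.log_le_sub_one_of_pos ht, le_max_right 1 δ₀]
    refine le_add_of_nonneg_of_le (inv_nonneg.2 hη.le) ?_
    exact mul_le_mul (rpow_le_max_one_rpow ht hδ hη.le le_rfl) hlog (abs_nonneg _) (by positivity)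

theorem exists_rpow_neg_mul_abs_log_le (hμ : Continuous μ) (hμ0 : ∀ x, μ x < 0) (δ₀ : ℝ) :
    ∃ C, 0 ≤ C ∧ ∀ t, 0 < t → t ≤ δ₀ →
      ∀ x ∈ Icc 0 (2 * Real.pi), t ^ (-μ x) * |Real.log t| ≤ C := by
  obtain ⟨η, hη, hgap⟩ := exists_pos_add_le (μ := fun _ => 0) continuous_const hμ hμ0
  obtain ⟨C, hC, hle⟩ := exists_rpow_le (μ := fun x => max (-μ x) η) (ρ := fun _ => η)
    (hμ.neg.max continuous_const) continuous_const (fun x => le_max_right _ _) δ₀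
  refine ⟨C * (η⁻¹ + max 1 δ₀ ^ η * max 1 δ₀), by positivity, fun t ht htδ x hx => ?_⟩
  have hpow := hle t ht htδ x hx
  rw [max_eq_left (by linarith [hgap x hx])] at hpow
  calc t ^ (-μ x) * |Real.log t| ≤ C * t ^ η * |Real.log t| := by gcongr
    _ = C * (t ^ η * |Real.log t|) := mul_assoc _ _ _
    _ ≤ _ := by gcongr; exact rpow_mul_abs_log_le hη ht htδ

theorem exists_weightedNorm_log_le (hμ : Continuous μ) (hμ0 : ∀ x, μ x < 0) (δ₀ : ℝ) :
    ∃ C, 0 ≤ C ∧ ∀ t, 0 < t → t ≤ δ₀ → weightedNorm μ t (Real.log t • oneL2) ≤ C := by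
  obtain ⟨C, hC, hle⟩ := exists_rpow_neg_mul_abs_log_le hμ hμ0 δ₀
  refine ⟨C * ‖oneL2‖, by positivity, fun t ht htδ => ?_⟩
  rw [← weightedNorm_zero_weight t oneL2]
  refine weightedNorm_le_of_ae_le continuous_const ht hμ ?_
  filter_upwards [ae_measU_of_forall_mem_Icc (hle t ht htδ), smul_oneL2_ae_eq (Real.log t),
    oneL2_ae_eq] with x hx hlog hone
  rwa [hlog, hone, neg_zero, Real.rpow_zero, abs_one, one_mul, mul_one]

theorem exists_jetNorm_log_le (hμ : Continuous μ) (hμ0 : ∀ x, μ x < 0) (δ₀ : ℝ) (n : ℕ) :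
    ∃ C, 0 ≤ C ∧
      ∀ δ ≤ δ₀, ∀ t ∈ Ioc 0 δ, jetNorm μ δ n (fun t => Real.log t • oneL2) t ≤ C := by
  obtain ⟨C, hC, hle⟩ := exists_weightedNorm_log_le hμ hμ0 δ₀
  cases n with
  | zero => exact ⟨C, hC, fun δ hδ t ht => hle t ht.1 (ht.2.trans hδ)⟩
  | succ n =>
    obtain ⟨C', hC', hle'⟩ :=
      exists_jetNorm_const_le hμ (fun x => (hμ0 x).le) δ₀ (hasWeakDerivs_oneL2 (n := n))
    refine ⟨C + C', by positivity, fun δ hδ t ht => ?_⟩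
    rw [jetNorm_succ_eq hasEulerDeriv_log hasSpatialDeriv_log ht, jetNorm_zero ht, add_zero]
    exact add_le_add (hle t ht.1 (ht.2.trans hδ)) (hle' δ hδ t ht)

end

/-! ### Uniform orders of families of curves -/

theorem abs_exp_sub_one_le_mul_exp (d : ℝ) : |Real.exp d - 1| ≤ |d| * Real.exp |d| := by
  have h := Complex.norm_exp_sub_sum_le_norm_mul_exp d 1
  rw [Finset.sum_range_one, pow_zero, Nat.factorial_zero, Nat.cast_one, div_one, pow_one,
    ← Complex.ofReal_exp, ← Complex.ofReal_one, ← Complex.ofReal_sub, Complex.norm_real,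
    Complex.norm_real] at h
  exact h

/-- A family of time intervals `(0,δ]`, of length at most `δ₀`, with a time in each of them.
Estimates that are uniform in `δ`, in `t` and in the functions `w` are statements about families of
curves over such a family. -/
structure TimeFamily (ι : Type*) where
  δ : ι → ℝ
  t : ι → ℝ
  δ₀ : ℝ
  mem : ∀ i, t i ∈ Ioc 0 (δ i)
  le : ∀ i, δ i ≤ δ₀

/-- The curves `u i` have `n` derivatives, and at the times `T.t i` these are of order `B i * t^κ`,
up to an arbitrarily small loss in the exponent. -/
structure CurveHasOrder {ι : Type*} (T : TimeFamily ι) (n : ℕ) (κ : ℝ → ℝ) (B : ι → ℝ)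
    (u : ι → ℝ → L2U) : Prop where
  continuous : Continuous κ
  contJet : ∀ i, ContJet (T.δ i) n (u i)
  exists_le : ∀ μ : ℝ → ℝ, Continuous μ → (∀ x, μ x < κ x) →
    ∃ C, 0 ≤ C ∧ ∀ i, jetNorm μ (T.δ i) n (u i) (T.t i) ≤ C * B i

section

variable {ι : Type*} {T : TimeFamily ι} {n k : ℕ} {κ κ' : ℝ → ℝ} {B B' : ι → ℝ}

theorem TimeFamily.pos (T : TimeFamily ι) (i : ι) : 0 < T.t i := (T.mem i).1

theorem TimeFamily.t_le (T : TimeFamily ι) (i : ι) : T.t i ≤ T.δ₀ := (T.mem i).2.trans (T.le i)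

namespace CurveHasOrder

variable {u v w : ι → ℝ → L2U}

theorem congr (h : CurveHasOrder T n κ B u) (e : ∀ i, EqOn (v i) (u i) (Ioc 0 (T.δ i))) :
    CurveHasOrder T n κ B v := by
  refine ⟨h.continuous, fun i => (h.contJet i).congr (e i), fun μ hμ hlt => ?_⟩
  obtain ⟨C, hC, hle⟩ := h.exists_le μ hμ hlt
  exact ⟨C, hC, fun i => (jetNorm_congr (e i) (T.mem i)).trans_le (hle i)⟩

theorem mono (h : CurveHasOrder T n κ B u) (hc : Continuous κ') (hκ : ∀ x, κ' x ≤ κ x) :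
    CurveHasOrder T n κ' B u :=
  ⟨hc, h.contJet, fun μ hμ hlt => h.exists_le μ hμ fun x => (hlt x).trans_le (hκ x)⟩

theorem of_le (hk : k ≤ n) (h : CurveHasOrder T n κ B u) : CurveHasOrder T k κ B u := by
  refine ⟨h.continuous, fun i => (h.contJet i).mono hk, fun μ hμ hlt => ?_⟩
  obtain ⟨C, hC, hle⟩ := h.exists_le μ hμ hlt
  exact ⟨C, hC, fun i => (jetNorm_mono hk).trans (hle i)⟩

theorem add (h : CurveHasOrder T n κ B u) (h' : CurveHasOrder T n κ B v) :
    CurveHasOrder T n κ B (fun i => u i + v i) := by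
  refine ⟨h.continuous, fun i => (h.contJet i).add (h'.contJet i), fun μ hμ hlt => ?_⟩
  obtain ⟨C, hC, hle⟩ := h.exists_le μ hμ hlt
  obtain ⟨C', hC', hle'⟩ := h'.exists_le μ hμ hlt
  refine ⟨C + C', by positivity, fun i => ?_⟩
  rw [add_mul]
  exact (jetNorm_add_le hμ (h.contJet i) (h'.contJet i) (T.mem i)).trans
    (add_le_add (hle i) (hle' i))

theorem smul (c : ℝ) (h : CurveHasOrder T n κ B u) : CurveHasOrder T n κ B (fun i => c • u i) := by
  refine ⟨h.continuous, fun i => (h.contJet i).smul c, fun μ hμ hlt => ?_⟩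
  obtain ⟨C, hC, hle⟩ := h.exists_le μ hμ hlt
  refine ⟨|c| * C, by positivity, fun i => ?_⟩
  rw [jetNorm_smul hμ c (h.contJet i) (T.mem i), mul_assoc]
  exact mul_le_mul_of_nonneg_left (hle i) (abs_nonneg c)

theorem mul_max (h : CurveHasOrder T k κ B u) (h' : CurveHasOrder T (max k 1) κ' B' v)
    (hB : ∀ i, 0 ≤ B i) :
    CurveHasOrder T k (fun x => κ x + κ' x) (fun i => B i * B' i)
      (fun i s => pmul (u i s) (v i s)) := by
  have hκ := h.continuous
  have hκ' := h'.continuous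
  refine ⟨hκ.add hκ', fun i => (h.contJet i).mul (h'.contJet i), fun ρ hρ hlt => ?_⟩
  -- a third of the available loss goes to each factor and a third to the product estimate
  obtain ⟨C, hC, hle⟩ := h.exists_le (fun x => κ x - (κ x + κ' x - ρ x) / 3) (by fun_prop)
    (fun x => by linarith [hlt x])
  obtain ⟨C', hC', hle'⟩ := h'.exists_le (fun x => κ' x - (κ x + κ' x - ρ x) / 3) (by fun_prop)
    (fun x => by linarith [hlt x])
  obtain ⟨A, hA, hmul⟩ := exists_jetNorm_pmul_le (μ := fun x => κ x - (κ x + κ' x - ρ x) / 3)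
    (ν := fun x => κ' x - (κ x + κ' x - ρ x) / 3) (by fun_prop) (by fun_prop) hρ
    (fun x => by linarith [hlt x]) T.δ₀ k
  refine ⟨A * C * C', by positivity, fun i => ?_⟩
  have hBi := hB i
  refine (hmul _ (T.le i) _ (T.mem i) _ _ (h.contJet i) (h'.contJet i)).trans ?_
  calc _ ≤ A * (C * B i) * (C' * B' i) := by
        gcongr
        · exact jetNorm_nonneg
        · exact hle i
        · exact hle' i
    _ = _ := by ring

theorem mul (h : CurveHasOrder T (n + 1) κ B u) (h' : CurveHasOrder T (n + 1) κ' B' v)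
    (hB : ∀ i, 0 ≤ B i) :
    CurveHasOrder T (n + 1) (fun x => κ x + κ' x) (fun i => B i * B' i)
      (fun i s => pmul (u i s) (v i s)) := by
  have hmax : max (n + 1) 1 = n + 1 := max_eq_left (Nat.le_add_left 1 n)
  exact h.mul_max (hmax.symm ▸ h') hB

theorem eulerDeriv (h : CurveHasOrder T (n + 1) κ B u) :
    CurveHasOrder T n κ B (fun i => DL2 (T.δ i) (u i)) := by
  refine ⟨h.continuous, fun i => (h.contJet i).eulerDeriv, fun μ hμ hlt => ?_⟩
  obtain ⟨C, hC, hle⟩ := h.exists_le μ hμ hlt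
  exact ⟨C, hC, fun i => jetNorm_DL2_le_succ.trans (hle i)⟩

theorem spatialDeriv (h : CurveHasOrder T (n + 1) κ B u) :
    CurveHasOrder T n κ B (fun i s => wderiv (u i s)) := by
  refine ⟨h.continuous, fun i => (h.contJet i).spatialDeriv, fun μ hμ hlt => ?_⟩
  obtain ⟨C, hC, hle⟩ := h.exists_le μ hμ hlt
  exact ⟨C, hC, fun i => jetNorm_wderiv_le_succ.trans (hle i)⟩

theorem mk_succ (hu : CurveHasOrder T 0 κ B u) (hD : ∀ i, HasEulerDeriv (T.δ i) (u i) (v i))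
    (hX : ∀ i, HasSpatialDeriv (T.δ i) (u i) (w i)) (hv : CurveHasOrder T n κ B v)
    (hw : CurveHasOrder T n κ B w) : CurveHasOrder T (n + 1) κ B u := by
  refine ⟨hv.continuous, fun i => ContJet.mk_succ (hD i) (hX i) (hv.contJet i) (hw.contJet i),
    fun μ hμ hlt => ?_⟩
  obtain ⟨C₀, hC₀, hle₀⟩ := hu.exists_le μ hμ hlt
  obtain ⟨C₁, hC₁, hle₁⟩ := hv.exists_le μ hμ hlt
  obtain ⟨C₂, hC₂, hle₂⟩ := hw.exists_le μ hμ hlt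
  refine ⟨C₀ + C₁ + C₂, by positivity, fun i => ?_⟩
  rw [jetNorm_succ_eq (hD i) (hX i) (T.mem i), add_mul, add_mul]
  exact add_le_add (add_le_add (hle₀ i) (hle₁ i)) (hle₂ i)

theorem of_ae_abs_le {A : ℝ} (h : CurveHasOrder T 0 κ B v) (hκ' : Continuous κ') (hA : 0 ≤ A)
    (hw : ∀ i, ContinuousOn (w i) (Ioc 0 (T.δ i)))
    (hle : ∀ i, ∀ᵐ x ∂measU, |w i (T.t i) x| ≤ A * T.t i ^ κ' x * |v i (T.t i) x|) :
    CurveHasOrder T 0 (fun x => κ x + κ' x) B w := by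
  refine ⟨h.continuous.add hκ', hw, fun μ hμ hlt => ?_⟩
  obtain ⟨C, hC, hCle⟩ := h.exists_le (fun x => μ x - κ' x) (hμ.sub hκ')
    (fun x => sub_lt_iff_lt_add.2 (hlt x))
  refine ⟨A * C, mul_nonneg hA hC, fun i => ?_⟩
  rw [mul_assoc]
  refine le_trans ?_ (mul_le_mul_of_nonneg_left (hCle i) hA)
  refine weightedNorm_le_of_ae_le (hμ.sub hκ') (T.pos i) hμ ?_
  filter_upwards [hle i] with x hx
  have hpow : T.t i ^ (-(μ x - κ' x)) = T.t i ^ (-μ x) * T.t i ^ κ' x := by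
    rw [← Real.rpow_add (T.pos i), neg_sub, neg_add_eq_sub]
  calc T.t i ^ (-μ x) * |w i (T.t i) x|
      ≤ T.t i ^ (-μ x) * (A * T.t i ^ κ' x * |v i (T.t i) x|) :=
        mul_le_mul_of_nonneg_left hx (Real.rpow_nonneg (T.pos i).le _)
    _ = A * (T.t i ^ (-(μ x - κ' x)) * |v i (T.t i) x|) := by rw [hpow]; ring

theorem exists_ae_abs_le (h : CurveHasOrder T (n + 1) κ (fun _ => 1) u) (hκ : ∀ x, 0 < κ x) :
    ∃ C, ∀ i, ∀ᵐ x ∂measU, |u i (T.t i) x| ≤ C := by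
  have hc := h.continuous
  obtain ⟨C, hC, hsup⟩ := exists_ae_abs_le_weightedNorm (μ := fun x => κ x / 2) (ρ := fun _ => 0)
    (by fun_prop) continuous_const (fun x => half_pos (hκ x)) T.δ₀
  obtain ⟨C', -, hle⟩ := (h.of_le (Nat.succ_pos n)).exists_le (fun x => κ x / 2) (by fun_prop)
    (fun x => half_lt_self (hκ x))
  refine ⟨C * C', fun i => ?_⟩
  filter_upwards [hsup _ (T.pos i) (T.t_le i) _ _ ((h.contJet i).hasSpatialDeriv _ (T.mem i))]
    with x hx
  rw [Real.rpow_zero, mul_one] at hx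
  refine hx.trans (mul_le_mul_of_nonneg_left ?_ hC)
  have hjet := hle i
  rw [jetNorm, mul_one] at hjet
  exact (add_le_add_left (le_add_of_nonneg_right (weightedNorm_nonneg _ _ _)) _).trans hjet

theorem one : CurveHasOrder T n (fun _ => 0) (fun _ => 1) (fun _ _ => oneL2) := by
  refine ⟨continuous_const, fun i => ContJet.const hasWeakDerivs_oneL2, fun μ hμ hlt => ?_⟩
  obtain ⟨C, hC, hle⟩ :=
    exists_jetNorm_const_le hμ (fun x => (hlt x).le) T.δ₀ (hasWeakDerivs_oneL2 (n := n))
  exact ⟨C, hC, fun i => (mul_one C).symm ▸ hle _ (T.le i) _ (T.mem i)⟩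

theorem exp_mul_zero {A : ℝ} (h : ∀ i, ContJet (T.δ i) 1 (u i)) (hv : CurveHasOrder T 0 κ B v)
    (hκ' : Continuous κ') (hA : 0 ≤ A)
    (hexp : ∀ i, ∀ᵐ x ∂measU, Real.exp (u i (T.t i) x) ≤ A * T.t i ^ κ' x) :
    CurveHasOrder T 0 (fun x => κ x + κ' x) B (fun i s => pmul (pexp (u i s)) (v i s)) := by
  refine hv.of_ae_abs_le hκ' hA (fun i => ?_) fun i => ?_
  · exact ((hv.contJet i).mul (h i).exp).continuousOn.congr fun s _ => pmul_comm _ _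
  · obtain ⟨C, hC⟩ := ((h i).hasSpatialDeriv _ (T.mem i)).exists_essBoundedBy
    filter_upwards [hexp i, pexp_ae_eq hC,
      pmul_ae_eq (g := v i (T.t i)) (hC.exp.congr (pexp_ae_eq hC))] with x hx hpexp hpmul
    rw [hpmul, hpexp, abs_mul, Real.abs_exp]
    exact mul_le_mul_of_nonneg_right hx (abs_nonneg _)

theorem exp {A : ℝ} (h : CurveHasOrder T (n + 1) (fun _ => 0) (fun _ => 1) u)
    (hκ : Continuous κ) (hA : 0 ≤ A)
    (hexp : ∀ i, ∀ᵐ x ∂measU, Real.exp (u i (T.t i) x) ≤ A * T.t i ^ κ x) :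
    CurveHasOrder T (n + 1) κ (fun _ => 1) (fun i s => pexp (u i s)) := by
  have hjet : ∀ i, ContJet (T.δ i) 1 (u i) := fun i => (h.contJet i).mono (Nat.succ_pos n)
  have hD : ∀ i, HasEulerDeriv (T.δ i) (fun s => pexp (u i s)) _ := fun i =>
    (hjet i).hasEulerDeriv.exp (hjet i).hasSpatialDeriv (hjet i).spatialDeriv.continuousOn
  have hX : ∀ i, HasSpatialDeriv (T.δ i) (fun s => pexp (u i s)) _ := fun i =>
    (hjet i).hasSpatialDeriv.exp
  have hmul₀ : ∀ v, CurveHasOrder T 0 (fun _ => 0) (fun _ => 1) v →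
      CurveHasOrder T 0 κ (fun _ => 1) (fun i s => pmul (pexp (u i s)) (v i s)) :=
    fun v hv => by simpa only [zero_add] using exp_mul_zero hjet hv hκ hA hexp
  have hone : CurveHasOrder T 0 κ (fun _ => 1) (fun i s => pexp (u i s)) :=
    (hmul₀ _ one).congr fun i s _ => (pmul_oneL2 _).symm
  induction n with
  | zero => exact hone.mk_succ hD hX (hmul₀ _ h.eulerDeriv) (hmul₀ _ h.spatialDeriv)
  | succ n ih =>
    have hmul : ∀ v, CurveHasOrder T (n + 1) (fun _ => 0) (fun _ => 1) v →
        CurveHasOrder T (n + 1) κ (fun _ => 1)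
          (fun i s => pmul (pexp (u i s)) (v i s)) := fun v hv => by
      have hexp_u := ih (h.of_le (Nat.le_succ _))
      simpa only [add_zero, mul_one] using hexp_u.mul hv fun _ => zero_le_one
    exact hone.mk_succ hD hX (hmul _ h.eulerDeriv) (hmul _ h.spatialDeriv)

theorem exp_of_pos (h : CurveHasOrder T (n + 1) κ (fun _ => 1) u) (hκ : ∀ x, 0 < κ x) :
    CurveHasOrder T (n + 1) (fun _ => 0) (fun _ => 1) (fun i s => pexp (u i s)) := by
  obtain ⟨A, hA⟩ := h.exists_ae_abs_le hκ
  refine (h.mono continuous_const fun x => (hκ x).le).exp continuous_const (Real.exp_pos A).le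
    fun i => ?_
  filter_upwards [hA i] with x hx
  rw [Real.rpow_zero, mul_one]
  exact Real.exp_le_exp.2 ((le_abs_self _).trans hx)

theorem exp_sub_one_zero (h : CurveHasOrder T 0 κ B u)
    (h₁ : CurveHasOrder T (n + 1) κ (fun _ => 1) u) (hκ : ∀ x, 0 < κ x) :
    CurveHasOrder T 0 κ B (fun i s => pexp (u i s) - oneL2) := by
  obtain ⟨A, hA⟩ := h₁.exists_ae_abs_le hκ
  have hexp := h₁.exp_of_pos hκ
  have hle : ∀ i, ∀ᵐ x ∂measU, |(pexp (u i (T.t i)) - oneL2 : L2U) x| ≤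
      Real.exp A * T.t i ^ (0 : ℝ) * |u i (T.t i) x| := fun i => by
    obtain ⟨C, hC⟩ :=
      ((h₁.contJet i).hasSpatialDeriv _ (T.mem i)).exists_essBoundedBy
    filter_upwards [hA i, pexp_ae_eq hC, oneL2_ae_eq,
      Lp.coeFn_sub (pexp (u i (T.t i))) oneL2] with x hx hpexp hone hsub
    rw [hsub, Pi.sub_apply, hpexp, hone, Real.rpow_zero, mul_one, mul_comm]
    exact (abs_exp_sub_one_le_mul_exp _).trans (by gcongr)
  simpa only [add_zero] using h.of_ae_abs_le continuous_const (Real.exp_pos A).le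
    (w := fun i s => pexp (u i s) - oneL2)
    (fun i => (hexp.contJet i).continuousOn.sub continuousOn_const) hle

theorem exp_sub_one (h : CurveHasOrder T (n + 1) κ B u)
    (h₁ : CurveHasOrder T (n + 1) κ (fun _ => 1) u) (hκ : ∀ x, 0 < κ x) (hB : ∀ i, 0 ≤ B i) :
    CurveHasOrder T (n + 1) κ B (fun i s => pexp (u i s) - oneL2) := by
  have hexp := h₁.exp_of_pos hκ
  have hmul : ∀ v, CurveHasOrder T n κ B v →
      CurveHasOrder T n κ B (fun i s => pmul (pexp (u i s)) (v i s)) := fun v hv => by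
    have hprod := hv.mul_max (hexp.of_le (max_le (Nat.le_succ n) (Nat.le_add_left 1 n))) hB
    simp only [add_zero, mul_one] at hprod
    exact hprod.congr fun i s _ => pmul_comm _ _
  refine (exp_sub_one_zero (h.of_le (Nat.zero_le _)) h₁ hκ).mk_succ (fun i s hs => ?_)
    (fun i s hs => ?_) (hmul _ h.eulerDeriv) (hmul _ h.spatialDeriv)
  · have hjet := h.contJet i
    exact (hjet.hasEulerDeriv.exp hjet.hasSpatialDeriv hjet.spatialDeriv.continuousOn s
      hs).sub_const _
  · simpa only [sub_zero] using ((h.contJet i).hasSpatialDeriv.exp s hs).sub hasWeakDeriv_oneL2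

end CurveHasOrder
end

/-! ### Uniform orders of families of functions -/

/-- `CurveHasOrder` for families of functions of `(t,x)`. -/
structure HasOrder {ι : Type*} (T : TimeFamily ι) (n : ℕ) (κ : ℝ → ℝ) (B : ι → ℝ)
    (u : ι → ℝ → ℝ → ℝ) : Prop where
  memLp : ∀ i, ∀ s ∈ Ioc 0 (T.δ i), MemLp (u i s) 2 measU
  curveHasOrder : CurveHasOrder T n κ B (fun i s => toL2 (u i s))

section

variable {ι : Type*} {T : TimeFamily ι} {n : ℕ} {κ κ' : ℝ → ℝ} {B B' : ι → ℝ}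

namespace HasOrder

variable {u v : ι → ℝ → ℝ → ℝ}

theorem exists_essBoundedBy (h : HasOrder T (n + 1) κ B u) {i : ι} {s : ℝ}
    (hs : s ∈ Ioc 0 (T.δ i)) : ∃ C, EssBoundedBy (toL2 (u i s)) C :=
  ((h.curveHasOrder.contJet i).hasSpatialDeriv s hs).exists_essBoundedBy

theorem of_curve {c : ι → ℝ → L2U} (h : CurveHasOrder T n κ B c)
    (e : ∀ i, ∀ s ∈ Ioc 0 (T.δ i), v i s =ᵐ[measU] c i s) : HasOrder T n κ B v :=
  ⟨fun i s hs => (Lp.memLp _).ae_eq (e i s hs).symm,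
    h.congr fun i s hs => toL2_eq_of_ae_eq (e i s hs)⟩

theorem congr_ae (h : HasOrder T n κ B u)
    (e : ∀ i, ∀ s ∈ Ioc 0 (T.δ i), v i s =ᵐ[measU] u i s) : HasOrder T n κ B v :=
  of_curve h.curveHasOrder fun i s hs => (e i s hs).trans (toL2_ae_eq (h.memLp i s hs)).symm

theorem congr (h : HasOrder T n κ B u) (e : ∀ i s x, 0 < s → v i s x = u i s x) :
    HasOrder T n κ B v :=
  h.congr_ae fun i s hs => ae_of_all _ fun x => e i s x hs.1

theorem mono (h : HasOrder T n κ B u) (hc : Continuous κ') (hκ : ∀ x, κ' x ≤ κ x) :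
    HasOrder T n κ' B u :=
  ⟨h.memLp, h.curveHasOrder.mono hc hκ⟩

theorem add (h : HasOrder T n κ B u) (h' : HasOrder T n κ B v) :
    HasOrder T n κ B (fun i s x => u i s x + v i s x) :=
  ⟨fun i s hs => (h.memLp i s hs).add (h'.memLp i s hs),
    (h.curveHasOrder.add h'.curveHasOrder).congr fun i s hs =>
      toL2_add (h.memLp i s hs) (h'.memLp i s hs)⟩

theorem const_mul (c : ℝ) (h : HasOrder T n κ B u) : HasOrder T n κ B (fun i s x => c * u i s x) :=
  of_curve (h.curveHasOrder.smul c) fun i s hs => by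
    filter_upwards [Lp.coeFn_smul c (toL2 (u i s)), toL2_ae_eq (h.memLp i s hs)]
      with x hsmul hu
    rw [Pi.smul_apply, hsmul, Pi.smul_apply, hu, smul_eq_mul]

theorem sub (h : HasOrder T n κ B u) (h' : HasOrder T n κ B v) :
    HasOrder T n κ B (fun i s x => u i s x - v i s x) :=
  (h.add (h'.const_mul (-1))).congr fun i s x _ => by ring

theorem mul (h : HasOrder T (n + 1) κ B u) (h' : HasOrder T (n + 1) κ' B' v)
    (hB : ∀ i, 0 ≤ B i) :
    HasOrder T (n + 1) (fun x => κ x + κ' x) (fun i => B i * B' i)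
      (fun i s x => u i s x * v i s x) :=
  of_curve (h.curveHasOrder.mul h'.curveHasOrder hB) fun i s hs => by
    obtain ⟨C, hC⟩ := h.exists_essBoundedBy hs
    filter_upwards [pmul_ae_eq (g := toL2 (v i s)) hC, toL2_ae_eq (h.memLp i s hs),
      toL2_ae_eq (h'.memLp i s hs)] with x hmul hu hv
    rw [hmul, hu, hv]

theorem exp_ae_eq (h : HasOrder T (n + 1) κ B u) {i : ι} {s : ℝ} (hs : s ∈ Ioc 0 (T.δ i)) :
    (fun x => Real.exp (u i s x)) =ᵐ[measU] pexp (toL2 (u i s)) := by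
  obtain ⟨C, hC⟩ := h.exists_essBoundedBy hs
  filter_upwards [pexp_ae_eq hC, toL2_ae_eq (h.memLp i s hs)] with x hexp hu
  rw [hexp, hu]

theorem exp {A : ℝ} (h : HasOrder T (n + 1) (fun _ => 0) (fun _ => 1) u) (hκ : Continuous κ)
    (hA : 0 ≤ A) (hexp : ∀ i, ∀ᵐ x ∂measU, Real.exp (u i (T.t i) x) ≤ A * T.t i ^ κ x) :
    HasOrder T (n + 1) κ (fun _ => 1) (fun i s x => Real.exp (u i s x)) := by
  refine of_curve (h.curveHasOrder.exp hκ hA fun i => ?_) fun i s hs => h.exp_ae_eq hs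
  filter_upwards [hexp i, toL2_ae_eq (h.memLp i _ (T.mem i))] with x hx hu
  rwa [hu]

theorem exp_of_pos (h : HasOrder T (n + 1) κ (fun _ => 1) u) (hκ : ∀ x, 0 < κ x) :
    HasOrder T (n + 1) (fun _ => 0) (fun _ => 1) (fun i s x => Real.exp (u i s x)) :=
  of_curve (h.curveHasOrder.exp_of_pos hκ) fun _ _ hs => h.exp_ae_eq hs

theorem exp_sub_one (h : HasOrder T (n + 1) κ B u) (h₁ : HasOrder T (n + 1) κ (fun _ => 1) u)
    (hκ : ∀ x, 0 < κ x) (hB : ∀ i, 0 ≤ B i) :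
    HasOrder T (n + 1) κ B (fun i s x => Real.exp (u i s x) - 1) :=
  of_curve (h.curveHasOrder.exp_sub_one h₁.curveHasOrder hκ hB) fun i s hs => by
    filter_upwards [h.exp_ae_eq hs, oneL2_ae_eq,
      Lp.coeFn_sub (pexp (toL2 (u i s))) oneL2] with x hexp hone hsub
    rw [hsub, Pi.sub_apply, hone, hexp]

theorem zero (hκ : Continuous κ) : HasOrder T n κ B (fun _ _ _ => 0) := by
  refine ⟨fun _ _ _ => MemLp.zero, hκ, fun i => ?_, fun μ _ _ => ⟨0, le_rfl, fun i => ?_⟩⟩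
  · simp only [toL2_zero]
    exact ContJet.zero
  · simp only [toL2_zero]
    rw [jetNorm_zero (T.mem i), zero_mul]

theorem of_hasWeakDerivs {f : ℝ → ℝ} (hf : MemLp f 2 measU)
    (h : HasWeakDerivs n (toL2 f)) :
    HasOrder T n (fun _ => 0) (fun _ => 1) (fun _ _ => f) := by
  refine ⟨fun _ _ _ => hf, continuous_const, fun i => ContJet.const h, fun μ hμ hlt => ?_⟩
  obtain ⟨C, hC, hle⟩ := exists_jetNorm_const_le hμ (fun x => (hlt x).le) T.δ₀ h
  exact ⟨C, hC, fun i => (mul_one C).symm ▸ hle _ (T.le i) _ (T.mem i)⟩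

theorem of_contDiff {f : ℝ → ℝ} (hf : ContDiff ℝ ∞ f)
    (hper : Function.Periodic f (2 * Real.pi)) :
    HasOrder T n (fun _ => 0) (fun _ => 1) (fun _ _ => f) :=
  of_hasWeakDerivs (memLp_of_continuousOn hf.continuous.continuousOn)
    (hasWeakDerivs_of_contDiff hf hper)

theorem log : HasOrder T n (fun _ => 0) (fun _ => 1) (fun _ s _ => Real.log s) := by
  refine of_curve (c := fun _ s => Real.log s • oneL2) ?_ fun _ s _ =>
    (smul_oneL2_ae_eq (Real.log s)).symm
  refine ⟨continuous_const, fun i => ContJet.log, fun μ hμ hlt => ?_⟩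
  obtain ⟨C, hC, hle⟩ := exists_jetNorm_log_le hμ hlt T.δ₀ n
  exact ⟨C, hC, fun i => (mul_one C).symm ▸ hle _ (T.le i) _ (T.mem i)⟩

theorem rpow {f : ℝ → ℝ} (hc : Continuous f) (h : HasWeakDerivs (n + 1) (toL2 f)) :
    HasOrder T (n + 1) f (fun _ => 1) (fun _ s x => s ^ f x) := by
  have hlog := log (T := T).mul (of_hasWeakDerivs (memLp_of_continuousOn hc.continuousOn) h)
    fun _ => zero_le_one
  simp only [add_zero, mul_one] at hlog
  refine (hlog.exp hc zero_le_one fun i => ae_of_all _ fun x => ?_).congr fun _ _ _ hs =>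
    Real.rpow_def_of_pos hs _
  rw [one_mul, Real.rpow_def_of_pos (T.pos i)]

theorem time : HasOrder T (n + 1) (fun _ => 1) (fun _ => 1) (fun _ s _ => s) :=
  (rpow (f := fun _ => 1) continuous_const
    (hasWeakDerivs_of_contDiff contDiff_const fun _ => rfl)).congr fun _ s _ _ =>
      (Real.rpow_one s).symm

theorem of_const_bound {r : ℝ} (h : HasOrder T n κ (fun _ => r) u) :
    HasOrder T n κ (fun _ => 1) u := by
  refine ⟨h.memLp, h.curveHasOrder.continuous, h.curveHasOrder.contJet, fun μ hμ hlt => ?_⟩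
  obtain ⟨C, hC, hle⟩ := h.curveHasOrder.exists_le μ hμ hlt
  refine ⟨C * |r|, by positivity, fun i => (hle i).trans ?_⟩
  rw [mul_one]
  exact mul_le_mul_of_nonneg_left (le_abs_self r) hC

end HasOrder

namespace MemSobolev

variable {f : ℝ → ℝ}

theorem hasOrder (h : MemSobolev (n + 1) f) :
    HasOrder T n (fun _ => 0) (fun _ => 1) (fun _ _ => f) :=
  .of_hasWeakDerivs h.memLp h.hasWeakDerivs.of_succ

theorem hasOrder_dx (h : MemSobolev (n + 1) f) :
    HasOrder T n (fun _ => 0) (fun _ => 1) (fun _ _ => dx f) :=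
  .of_hasWeakDerivs (Lp.memLp _) <| by
    rw [dx, toL2_coeFn]
    exact h.hasWeakDerivs.2

theorem hasOrder_exp (h : MemSobolev (n + 2) f) :
    HasOrder T (n + 1) (fun _ => 0) (fun _ => 1) (fun _ _ x => Real.exp (f x)) := by
  obtain ⟨C, hC⟩ := h.hasWeakDerivs.1.exists_essBoundedBy
  refine h.hasOrder.exp continuous_const (Real.exp_pos C).le fun i => ?_
  filter_upwards [hC.2, toL2_ae_eq h.memLp] with x hx hf
  rw [Real.rpow_zero, mul_one, ← hf]
  exact Real.exp_le_exp.2 ((le_abs_self _).trans hx)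

end MemSobolev

/-- Two families which are of order `t^κ`, while their difference is of order `B i * t^κ`. -/
structure HasLipOrder (T : TimeFamily ι) (n : ℕ) (κ : ℝ → ℝ) (B : ι → ℝ)
    (u u' : ι → ℝ → ℝ → ℝ) : Prop where
  left : HasOrder T n κ (fun _ => 1) u
  right : HasOrder T n κ (fun _ => 1) u'
  diff : HasOrder T n κ B (fun i s x => u i s x - u' i s x)

theorem HasOrder.hasLipOrder {u : ι → ℝ → ℝ → ℝ} (h : HasOrder T n κ (fun _ => 1) u) :
    HasLipOrder T n κ B u u :=
  ⟨h, h, (HasOrder.zero h.curveHasOrder.continuous).congr fun _ _ _ _ => sub_self _⟩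

namespace HasLipOrder

variable {u u' v v' : ι → ℝ → ℝ → ℝ}

theorem mono (h : HasLipOrder T n κ B u u') (hc : Continuous κ') (hκ : ∀ x, κ' x ≤ κ x) :
    HasLipOrder T n κ' B u u' :=
  ⟨h.left.mono hc hκ, h.right.mono hc hκ, h.diff.mono hc hκ⟩

theorem add (h : HasLipOrder T n κ B u u') (h' : HasLipOrder T n κ B v v') :
    HasLipOrder T n κ B (fun i s x => u i s x + v i s x) (fun i s x => u' i s x + v' i s x) :=
  ⟨h.left.add h'.left, h.right.add h'.right, (h.diff.add h'.diff).congr fun i s x _ => by ring⟩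

theorem const_mul (c : ℝ) (h : HasLipOrder T n κ B u u') :
    HasLipOrder T n κ B (fun i s x => c * u i s x) (fun i s x => c * u' i s x) :=
  ⟨h.left.const_mul c, h.right.const_mul c, (h.diff.const_mul c).congr fun i s x _ => by ring⟩

theorem sub (h : HasLipOrder T n κ B u u') (h' : HasLipOrder T n κ B v v') :
    HasLipOrder T n κ B (fun i s x => u i s x - v i s x) (fun i s x => u' i s x - v' i s x) :=
  ⟨h.left.sub h'.left, h.right.sub h'.right, (h.diff.sub h'.diff).congr fun i s x _ => by ring⟩

theorem congr (h : HasLipOrder T n κ B u u') (e : ∀ i s x, v i s x = u i s x)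
    (e' : ∀ i s x, v' i s x = u' i s x) : HasLipOrder T n κ B v v' :=
  ⟨h.left.congr fun i s x _ => e i s x, h.right.congr fun i s x _ => e' i s x,
    h.diff.congr fun i s x _ => by rw [e, e']⟩

theorem mul (h : HasLipOrder T (n + 1) κ B u u') (h' : HasLipOrder T (n + 1) κ' B v v')
    (hB : ∀ i, 0 ≤ B i) :
    HasLipOrder T (n + 1) (fun x => κ x + κ' x) B (fun i s x => u i s x * v i s x)
      (fun i s x => u' i s x * v' i s x) := by
  have hleft := h.left.mul h'.left fun _ => zero_le_one
  have hright := h.right.mul h'.right fun _ => zero_le_one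
  have hdiff := h.diff.mul h'.left hB
  have hdiff' := h.right.mul h'.diff fun _ => zero_le_one
  simp only [mul_one, one_mul] at hleft hright hdiff hdiff'
  exact ⟨hleft, hright, (hdiff.add hdiff').congr fun i s x _ => by ring⟩

theorem exp (h : HasLipOrder T (n + 1) κ B u u') (hκ : ∀ x, 0 < κ x) (hB : ∀ i, 0 ≤ B i) :
    HasLipOrder T (n + 1) (fun _ => 0) B (fun i s x => Real.exp (u i s x))
      (fun i s x => Real.exp (u' i s x)) := by
  have hright := h.right.exp_of_pos hκ
  have hdiff := hright.mul (h.diff.exp_sub_one (h.left.sub h.right) hκ hB) fun _ => zero_le_one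
  simp only [zero_add, one_mul] at hdiff
  refine ⟨h.left.exp_of_pos hκ, hright,
    (hdiff.mono continuous_const fun x => (hκ x).le).congr fun i s x _ => ?_⟩
  rw [mul_sub, ← Real.exp_add, mul_one, add_sub_cancel]

end HasLipOrder
end

section

variable {ι : Type*} {T : TimeFamily ι} {n : ℕ} {κ : ℝ → ℝ} {B : ι → ℝ}

theorem CurveHasOrder.of_jetNorm_le {v : ι → ℝ → L2U} {C : ℝ} (hκ : Continuous κ)
    (hv : ∀ i, ContJet (T.δ i) n (v i)) (hC : 0 ≤ C)
    (hle : ∀ i, jetNorm κ (T.δ i) n (v i) (T.t i) ≤ C * B i) : CurveHasOrder T n κ B v := by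
  refine ⟨hκ, hv, fun μ hμ hlt => ?_⟩
  obtain ⟨A, hA, hAle⟩ := exists_jetNorm_le hκ hμ (fun x => (hlt x).le) T.δ₀ n
  refine ⟨A * C, mul_nonneg hA hC, fun i => (hAle _ (T.le i) _ (T.mem i) _).trans ?_⟩
  rw [mul_assoc]
  exact mul_le_mul_of_nonneg_left (hle i) hA

/-- The functions `u i` have `n + 1` derivatives which at the times `T.t i` are bounded by `B i` in
`L²(U)` with the weight `t^(-κ)`, where the highest spatial derivative gets the additional factor
`t`: a bound for one component of the norm of `X̃` of level `n + 1`. -/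
structure HasTildeBound (T : TimeFamily ι) (n : ℕ) (κ : ℝ → ℝ) (B : ι → ℝ)
    (u : ι → ℝ → ℝ → ℝ) : Prop where
  memLp : ∀ i, ∀ s ∈ Ioc 0 (T.δ i), MemLp (u i s) 2 measU
  contJet : ∀ i, ContJet (T.δ i) (n + 1) (fun s => toL2 (u i s))
  mixed_le : ∀ i p q, p + q ≤ n + 1 → (if q = n + 1 then T.t i else 1) *
    weightedNorm κ (T.t i) (mixedDeriv (T.δ i) p q (u i) (T.t i)) ≤ B i

namespace HasTildeBound

variable {u u' : ι → ℝ → ℝ → ℝ}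

theorem hasOrder (h : HasTildeBound T n κ B u) (hκ : Continuous κ) : HasOrder T n κ B u := by
  obtain ⟨C, hC, hle⟩ := exists_jetNorm_le_of_mixed_le hκ T.δ₀ n
  exact ⟨h.memLp, .of_jetNorm_le hκ (fun i => (h.contJet i).of_succ) hC fun i =>
    (hle _ (T.le i) _ (T.mem i) _ _ (h.contJet i) (h.mixed_le i)).1⟩

theorem hasOrder_Dt (h : HasTildeBound T n κ B u) (hκ : Continuous κ) :
    HasOrder T n κ B (fun i => Dt (T.δ i) (u i)) := by
  obtain ⟨C, hC, hle⟩ := exists_jetNorm_le_of_mixed_le hκ T.δ₀ n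
  exact .of_curve (.of_jetNorm_le hκ (fun i => (h.contJet i).eulerDeriv) hC fun i =>
    (hle _ (T.le i) _ (T.mem i) _ _ (h.contJet i) (h.mixed_le i)).2.1) fun _ _ _ => .rfl

theorem hasOrder_dx (h : HasTildeBound T n κ B u) (hκ : Continuous κ) :
    HasOrder T n κ B (fun i s x => s * dx (u i s) x) := by
  obtain ⟨C, hC, hle⟩ := exists_jetNorm_le_of_mixed_le hκ T.δ₀ n
  exact .of_curve (.of_jetNorm_le hκ (fun i => (h.contJet i).spatialDeriv.id_smul) hC fun i =>
    (hle _ (T.le i) _ (T.mem i) _ _ (h.contJet i) (h.mixed_le i)).2.2) fun i s _ =>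
      (Lp.coeFn_smul s (wderiv (toL2 (u i s)))).symm

theorem Dt_sub_ae_eq (h : HasTildeBound T n κ B u) (h' : HasTildeBound T n κ B u') {i : ι} {s : ℝ}
    (hs : s ∈ Ioc 0 (T.δ i)) : (fun x => Dt (T.δ i) (u i) s x - Dt (T.δ i) (u' i) s x) =ᵐ[measU]
      Dt (T.δ i) (u i - u' i) s := by
  have hsub : EqOn (fun r => toL2 ((u i - u' i) r))
      ((fun r => toL2 (u i r)) + (-1 : ℝ) • fun r => toL2 (u' i r)) (Ioc 0 (T.δ i)) :=
    fun r hr => (toL2_sub (h.memLp i r hr) (h'.memLp i r hr)).trans <| by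
      rw [Pi.add_apply, Pi.smul_apply, neg_one_smul, sub_eq_add_neg]
  have hDL2 : DL2 (T.δ i) (fun r => toL2 ((u i - u' i) r)) s =
      DL2 (T.δ i) (fun r => toL2 (u i r)) s - DL2 (T.δ i) (fun r => toL2 (u' i r)) s := by
    rw [DL2_congr hsub hs, ((h.contJet i).hasEulerDeriv.add
      ((h'.contJet i).hasEulerDeriv.smul (-1))).eqOn_DL2 hs, Pi.add_apply, Pi.smul_apply,
      neg_one_smul, sub_eq_add_neg]
  filter_upwards [Lp.coeFn_sub (DL2 (T.δ i) (fun r => toL2 (u i r)) s)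
    (DL2 (T.δ i) (fun r => toL2 (u' i r)) s)] with x hx
  rw [Dt, Dt, Dt, hDL2, hx, Pi.sub_apply]

theorem dx_sub_ae_eq (h : HasTildeBound T n κ B u) (h' : HasTildeBound T n κ B u') {i : ι} {s : ℝ}
    (hs : s ∈ Ioc 0 (T.δ i)) :
    (fun x => dx (u i s) x - dx (u' i s) x) =ᵐ[measU] dx ((u i - u' i) s) := by
  have hwderiv : wderiv (toL2 (u i s - u' i s)) = wderiv (toL2 (u i s)) - wderiv (toL2 (u' i s)) :=
    toL2_sub (h.memLp i s hs) (h'.memLp i s hs) ▸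
      (((h.contJet i).hasSpatialDeriv s hs).sub ((h'.contJet i).hasSpatialDeriv s hs)).wderiv_eq
  filter_upwards [Lp.coeFn_sub (wderiv (toL2 (u i s))) (wderiv (toL2 (u' i s)))] with x hx
  rw [dx, dx, dx, Pi.sub_apply, hwderiv, hx, Pi.sub_apply]

end HasTildeBound

/-- Lipschitz bounds for `u`, for `D u` and for `t ∂ₓ u`. -/
structure HasTildeLipOrder (T : TimeFamily ι) (n : ℕ) (κ : ℝ → ℝ) (B : ι → ℝ)
    (u u' : ι → ℝ → ℝ → ℝ) : Prop where
  self : HasLipOrder T n κ B u u'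
  euler : HasLipOrder T n κ B (fun i => Dt (T.δ i) (u i)) (fun i => Dt (T.δ i) (u' i))
  spatial : HasLipOrder T n κ B (fun i s x => s * dx (u i s) x) (fun i s x => s * dx (u' i s) x)

theorem HasTildeBound.hasTildeLipOrder {u u' : ι → ℝ → ℝ → ℝ} {r : ℝ}
    (h : HasTildeBound T n κ (fun _ => r) u) (h' : HasTildeBound T n κ (fun _ => r) u')
    (hsub : HasTildeBound T n κ B (u - u')) (hκ : Continuous κ) :
    HasTildeLipOrder T n κ B u u' where
  self := ⟨(h.hasOrder hκ).of_const_bound, (h'.hasOrder hκ).of_const_bound, hsub.hasOrder hκ⟩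
  euler := ⟨(h.hasOrder_Dt hκ).of_const_bound, (h'.hasOrder_Dt hκ).of_const_bound,
    (hsub.hasOrder_Dt hκ).congr_ae fun _ _ hs => h.Dt_sub_ae_eq h' hs⟩
  spatial := ⟨(h.hasOrder_dx hκ).of_const_bound, (h'.hasOrder_dx hκ).of_const_bound,
    (hsub.hasOrder_dx hκ).congr_ae fun i s hs => by
      filter_upwards [h.dx_sub_ae_eq h' hs] with x hx
      rw [← mul_sub, hx]
      rfl⟩

end

/-! ### The source operator -/

/-- `e^P = t^{P_*} e^{P_{**}} e^u` for the ansatz `P = P_* log t + P_{**} + u`. -/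
def gowdyExpP (Ps Pss : ℝ → ℝ) (u : ℝ → ℝ → ℝ) (t x : ℝ) : ℝ :=
  t ^ Ps x * Real.exp (Pss x) * Real.exp (u t x)

/-- `t ∂ₓ P` for the ansatz `P = P_* log t + P_{**} + u`. -/
def gowdyDxP (Ps Pss : ℝ → ℝ) (u : ℝ → ℝ → ℝ) (t x : ℝ) : ℝ :=
  t * dx Ps x * Real.log t + t * dx Pss x + t * dx (u t) x

/-- The quantity `R = D Q` for the ansatz `Q = Q_* + t^{2k} Q_{**} + v`. -/
def gowdyDQ (δ : ℝ) (k Qss : ℝ → ℝ) (v : ℝ → ℝ → ℝ) (t x : ℝ) : ℝ :=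
  2 * k x * t ^ (2 * k x) * Qss x + Dt δ v t x

/-- The quantity `S = t ∂ₓ Q` for the ansatz `Q = Q_* + t^{2k} Q_{**} + v`. -/
def gowdyDxQ (k Qs Qss : ℝ → ℝ) (v : ℝ → ℝ → ℝ) (t x : ℝ) : ℝ :=
  t * dx Qs x + 2 * deriv k x * t ^ (2 * k x) * t * Real.log t * Qss x
    + t ^ (2 * k x) * t * dx Qss x + t * dx (v t) x

theorem gowdyF_zero (δ : ℝ) (k Ps Pss Qs Qss : ℝ → ℝ) (w : Fin 2 → ℝ → ℝ → ℝ) (t x : ℝ) :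
    gowdyF δ k Ps Pss Qs Qss w 0 t x =
      (gowdyExpP Ps Pss (w 0) t x * gowdyDQ δ k Qss (w 1) t x) ^ 2 -
        (gowdyExpP Ps Pss (w 0) t x * gowdyDxQ k Qs Qss (w 1) t x) ^ 2 := rfl

theorem gowdyF_one (δ : ℝ) (k Ps Pss Qs Qss : ℝ → ℝ) (w : Fin 2 → ℝ → ℝ → ℝ) (t x : ℝ) :
    gowdyF δ k Ps Pss Qs Qss w 1 t x =
      -2 * Dt δ (w 0) t x * gowdyDQ δ k Qss (w 1) t x +
        2 * gowdyDxP Ps Pss (w 0) t x * gowdyDxQ k Qs Qss (w 1) t x := rfl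

/-- The regularity of the data in the source operator: `k` is smooth, periodic and positive, the
asymptotic data are in `H^m(U)`, and `P_*` is its continuous representative. -/
structure IsAsymptoticData (m : ℕ) (k Ps Pss Qs Qss : ℝ → ℝ) : Prop where
  contDiff : ContDiff ℝ ∞ k
  periodic : Function.Periodic k (2 * Real.pi)
  pos : ∀ x, 0 < k x
  memSobolev_Ps : MemSobolev m Ps
  memSobolev_Pss : MemSobolev m Pss
  memSobolev_Qs : MemSobolev m Qs
  memSobolev_Qss : MemSobolev m Qss
  continuous_Ps : Continuous Ps

section

variable {ι : Type*} {T : TimeFamily ι} {n : ℕ} {k : ℝ → ℝ}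

theorem hasOrder_deriv (hk : ContDiff ℝ ∞ k) (hper : Function.Periodic k (2 * Real.pi)) :
    HasOrder T n (fun _ => 0) (fun _ => 1) (fun _ _ => deriv k) :=
  .of_contDiff (contDiff_infty_iff_deriv.1 hk).2 fun x => by
    rw [← deriv_comp_add_const, show (fun y => k (y + 2 * Real.pi)) = k from funext hper]

theorem hasOrder_rpow_two_mul (hk : ContDiff ℝ ∞ k)
    (hper : Function.Periodic k (2 * Real.pi)) :
    HasOrder T (n + 1) (fun x => 2 * k x) (fun _ => 1) (fun _ s x => s ^ (2 * k x)) :=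
  .rpow (continuous_const.mul hk.continuous)
    (hasWeakDerivs_of_contDiff (contDiff_const.mul hk) fun x => by simp only [hper x])

namespace IsAsymptoticData

variable {Ps Pss Qs Qss : ℝ → ℝ} {B : ι → ℝ} {u u' v v' : ι → ℝ → ℝ → ℝ} {α κ : ℝ → ℝ}

theorem hasLipOrder_expP (hd : IsAsymptoticData (n + 2) k Ps Pss Qs Qss) (hB : ∀ i, 0 ≤ B i)
    (hα : ∀ x, 0 < α x) (hu : HasLipOrder T (n + 1) α B u u') :
    HasLipOrder T (n + 1) Ps B (fun i => gowdyExpP Ps Pss (u i))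
      (fun i => gowdyExpP Ps Pss (u' i)) := by
  have hPs : HasOrder T (n + 1) Ps (fun _ => 1) (fun _ s x => s ^ Ps x) :=
    .rpow hd.continuous_Ps hd.memSobolev_Ps.hasWeakDerivs.of_succ
  have h := (hPs.hasLipOrder.mul hd.memSobolev_Pss.hasOrder_exp.hasLipOrder hB).mul
    (hu.exp hα hB) hB
  simp only [add_zero] at h
  exact h

theorem hasLipOrder_DQ (hd : IsAsymptoticData (n + 2) k Ps Pss Qs Qss) (hB : ∀ i, 0 ≤ B i)
    (hκ : ∀ x, 2 * k x ≤ κ x) (hv : HasLipOrder T (n + 1) κ B (fun i => Dt (T.δ i) (v i))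
      (fun i => Dt (T.δ i) (v' i))) :
    HasLipOrder T (n + 1) (fun x => 2 * k x) B (fun i => gowdyDQ (T.δ i) k Qss (v i))
      (fun i => gowdyDQ (T.δ i) k Qss (v' i)) := by
  have hk : HasOrder T (n + 1) (fun _ => 0) (fun _ => 1) (fun _ _ => k) :=
    .of_contDiff hd.contDiff hd.periodic
  have h := (((hk.hasLipOrder (B := B)).const_mul 2).mul
    (hasOrder_rpow_two_mul hd.contDiff hd.periodic).hasLipOrder hB).mul
      hd.memSobolev_Qss.hasOrder.hasLipOrder hB
  simp only [zero_add, add_zero] at h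
  exact h.add (hv.mono (continuous_const.mul hd.contDiff.continuous) hκ)

theorem hasLipOrder_DxQ (hd : IsAsymptoticData (n + 2) k Ps Pss Qs Qss) (hB : ∀ i, 0 ≤ B i)
    (hκ : Continuous κ) (hv : HasLipOrder T (n + 1) κ B (fun i s x => s * dx (v i s) x)
      (fun i s x => s * dx (v' i s) x)) :
    HasLipOrder T (n + 1) (fun x => min 1 (κ x)) B (fun i => gowdyDxQ k Qs Qss (v i))
      (fun i => gowdyDxQ k Qs Qss (v' i)) := by
  have hc : Continuous fun x => min 1 (κ x) := continuous_const.min hκ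
  have ht : HasLipOrder T (n + 1) (fun _ => 1) B (fun _ s _ => s) (fun _ s _ => s) :=
    HasOrder.time.hasLipOrder
  have hk := (hasOrder_rpow_two_mul (T := T) (n := n) hd.contDiff hd.periodic).hasLipOrder (B := B)
  have hk' := (hasOrder_deriv (T := T) (n := n + 1) hd.contDiff hd.periodic).hasLipOrder (B := B)
  refine .add (.add (.add ?_ ?_) ?_) (hv.mono hc fun _ => min_le_right _ _)
  · refine (ht.mul hd.memSobolev_Qs.hasOrder_dx.hasLipOrder hB).mono hc fun x => ?_
    linarith [min_le_left 1 (κ x)]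
  · refine (((((hk'.const_mul 2).mul hk hB).mul ht hB).mul HasOrder.log.hasLipOrder hB).mul
      hd.memSobolev_Qss.hasOrder.hasLipOrder hB).mono hc fun x => ?_
    linarith [min_le_left 1 (κ x), hd.pos x]
  · refine ((hk.mul ht hB).mul hd.memSobolev_Qss.hasOrder_dx.hasLipOrder hB).mono hc fun x => ?_
    linarith [min_le_left 1 (κ x), hd.pos x]

theorem hasLipOrder_DxP (hd : IsAsymptoticData (n + 2) k Ps Pss Qs Qss) (hB : ∀ i, 0 ≤ B i)
    (hα : Continuous α) (hu : HasLipOrder T (n + 1) α B (fun i s x => s * dx (u i s) x)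
      (fun i s x => s * dx (u' i s) x)) :
    HasLipOrder T (n + 1) (fun x => min 1 (α x)) B (fun i => gowdyDxP Ps Pss (u i))
      (fun i => gowdyDxP Ps Pss (u' i)) := by
  have hc : Continuous fun x => min 1 (α x) := continuous_const.min hα
  have ht : HasLipOrder T (n + 1) (fun _ => 1) B (fun _ s _ => s) (fun _ s _ => s) :=
    HasOrder.time.hasLipOrder
  refine .add (.add ?_ ?_) (hu.mono hc fun _ => min_le_right _ _)
  · refine ((ht.mul hd.memSobolev_Ps.hasOrder_dx.hasLipOrder hB).mul
      HasOrder.log.hasLipOrder hB).mono hc fun x => ?_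
    linarith [min_le_left 1 (α x)]
  · refine (ht.mul hd.memSobolev_Pss.hasOrder_dx.hasLipOrder hB).mono hc fun x => ?_
    linarith [min_le_left 1 (α x)]

theorem hasLipOrder_gowdyF_zero (hd : IsAsymptoticData (n + 2) k Ps Pss Qs Qss)
    (hB : ∀ i, 0 ≤ B i) (hα : ∀ x, 0 < α x) (hκ : ∀ x, 2 * k x ≤ κ x)
    {w w' : ι → Fin 2 → ℝ → ℝ → ℝ}
    (h₀ : HasTildeLipOrder T (n + 1) α B (fun i => w i 0) (fun i => w' i 0))
    (h₁ : HasTildeLipOrder T (n + 1) κ B (fun i => w i 1) (fun i => w' i 1)) :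
    HasLipOrder T (n + 1) (fun x => 2 * (Ps x + min 1 (2 * k x))) B
      (fun i => gowdyF (T.δ i) k Ps Pss Qs Qss (w i) 0)
      (fun i => gowdyF (T.δ i) k Ps Pss Qs Qss (w' i) 0) := by
  have hc : Continuous fun x => 2 * (Ps x + min 1 (2 * k x)) :=
    continuous_const.mul (hd.continuous_Ps.add
      (continuous_const.min (continuous_const.mul hd.contDiff.continuous)))
  have hP := hd.hasLipOrder_expP hB hα h₀.self
  have hR := hP.mul (hd.hasLipOrder_DQ hB hκ h₁.euler) hB
  have hS := hP.mul (hd.hasLipOrder_DxQ hB h₁.spatial.left.curveHasOrder.continuous h₁.spatial) hB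
  refine (((hR.mul hR hB).mono hc fun x => ?_).sub ((hS.mul hS hB).mono hc fun x => ?_)).congr
    (fun i s x => ?_) (fun i s x => ?_)
  · linarith [min_le_right 1 (2 * k x)]
  · linarith [min_le_min_left 1 (hκ x)]
  all_goals rw [gowdyF_zero, sq, sq]

theorem hasLipOrder_gowdyF_one (hd : IsAsymptoticData (n + 2) k Ps Pss Qs Qss)
    (hB : ∀ i, 0 ≤ B i) (hκ : ∀ x, 2 * k x ≤ κ x) {w w' : ι → Fin 2 → ℝ → ℝ → ℝ}
    (h₀ : HasTildeLipOrder T (n + 1) α B (fun i => w i 0) (fun i => w' i 0))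
    (h₁ : HasTildeLipOrder T (n + 1) κ B (fun i => w i 1) (fun i => w' i 1)) :
    HasLipOrder T (n + 1) (fun x => min (α x + 2 * k x) (min 1 (α x) + min 1 (κ x))) B
      (fun i => gowdyF (T.δ i) k Ps Pss Qs Qss (w i) 1)
      (fun i => gowdyF (T.δ i) k Ps Pss Qs Qss (w' i) 1) := by
  have hαc := h₀.spatial.left.curveHasOrder.continuous
  have hκc := h₁.spatial.left.curveHasOrder.continuous
  have hc : Continuous fun x => min (α x + 2 * k x) (min 1 (α x) + min 1 (κ x)) :=
    (hαc.add (continuous_const.mul hd.contDiff.continuous)).min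
      ((continuous_const.min hαc).add (continuous_const.min hκc))
  have hR := (h₀.euler.const_mul (-2)).mul (hd.hasLipOrder_DQ hB hκ h₁.euler) hB
  have hS := ((hd.hasLipOrder_DxP hB hαc h₀.spatial).const_mul 2).mul
    (hd.hasLipOrder_DxQ hB hκc h₁.spatial) hB
  exact ((hR.mono hc fun _ => min_le_left _ _).add (hS.mono hc fun _ => min_le_right _ _)).congr
    (fun _ _ _ => gowdyF_one ..) (fun _ _ _ => gowdyF_one ..)

end IsAsymptoticData

end

/-! ### The energies -/

section

variable {N : ℕ} {δ : ℝ} {lam al : Fin N → ℝ → ℝ} {s : ℕ → ℝ} {l : ℕ} {w : Fin N → ℝ → ℝ → ℝ}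
  {t : ℝ}

theorem slice_term_nonneg (ht : 0 < t) (i : Fin N) (p q : ℕ) :
    0 ≤ ∫ x, t ^ (2 * (lam i x - al i x + s q)) * (mixedDeriv δ p q (w i) t x) ^ 2 ∂measU :=
  integral_nonneg fun _ => mul_nonneg (Real.rpow_nonneg ht.le _) (sq_nonneg _)

theorem slice_nonneg (ht : 0 < t) (p j : ℕ) : 0 ≤ slice δ lam al s p j w t :=
  Finset.sum_nonneg fun i _ => Finset.sum_nonneg fun _ _ => Finset.sum_nonneg fun _ _ =>
    slice_term_nonneg ht i _ _

theorem slice_term_eq_sq_weightedNorm (hl : ∀ i, Continuous (lam i)) (ha : ∀ i, Continuous (al i))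
    (ht : 0 < t) (i : Fin N) (p q : ℕ) :
    ∫ x, t ^ (2 * (lam i x - al i x + s q)) * (mixedDeriv δ p q (w i) t x) ^ 2 ∂measU =
      (t ^ s q *
        weightedNorm (fun x => al i x - lam i x) t (mixedDeriv δ p q (w i) t)) ^ 2 := by
  rw [mul_pow, sq_weightedNorm (μ := fun x => al i x - lam i x) ((ha i).sub (hl i)) ht,
    ← integral_const_mul]
  refine integral_congr_ae (ae_of_all _ fun x => ?_)
  dsimp only
  rw [← mul_assoc, ← Real.rpow_natCast (t ^ s q) 2, ← Real.rpow_mul ht.le, ← Real.rpow_add ht]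
  congr 2
  push_cast
  ring

theorem energy_nonneg : 0 ≤ energy δ lam al s l w t := Real.sqrt_nonneg _

theorem slice_term_le_slice (ht : 0 < t) (i : Fin N) {p p' q j : ℕ} (hp : p' ≤ p) (hq : q ≤ j) :
    ∫ x, t ^ (2 * (lam i x - al i x + s q)) * (mixedDeriv δ p' q (w i) t x) ^ 2 ∂measU ≤
      slice δ lam al s p j w t := by
  let f (i : Fin N) (p' q : ℕ) : ℝ :=
    ∫ x, t ^ (2 * (lam i x - al i x + s q)) * (mixedDeriv δ p' q (w i) t x) ^ 2 ∂measU
  have hf : ∀ i p' q, 0 ≤ f i p' q := slice_term_nonneg ht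
  calc f i p' q ≤ ∑ q ∈ Finset.range (j + 1), f i p' q :=
        Finset.single_le_sum (f := f i p') (fun _ _ => hf i p' _) (Finset.mem_range_succ_iff.2 hq)
    _ ≤ ∑ p' ∈ Finset.range (p + 1), ∑ q ∈ Finset.range (j + 1), f i p' q :=
        Finset.single_le_sum (f := fun p' => ∑ q ∈ Finset.range (j + 1), f i p' q)
          (fun _ _ => Finset.sum_nonneg fun _ _ => hf i _ _) (Finset.mem_range_succ_iff.2 hp)
    _ ≤ slice δ lam al s p j w t :=
        Finset.single_le_sum
          (f := fun i => ∑ p' ∈ Finset.range (p + 1), ∑ q ∈ Finset.range (j + 1), f i p' q)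
          (fun _ _ => Finset.sum_nonneg fun _ _ => Finset.sum_nonneg fun _ _ => hf _ _ _)
          (Finset.mem_univ i)

theorem weightedNorm_mixedDeriv_le_energy (hl : ∀ i, Continuous (lam i))
    (ha : ∀ i, Continuous (al i)) (ht : 0 < t) (i : Fin N) {p q : ℕ} (hpq : p + q ≤ l) :
    t ^ s q * weightedNorm (fun x => al i x - lam i x) t (mixedDeriv δ p q (w i) t) ≤
      energy δ lam al s l w t := by
  refine Real.le_sqrt_of_sq_le ?_
  rw [← slice_term_eq_sq_weightedNorm hl ha ht]
  exact (slice_term_le_slice ht i le_rfl (by omega)).trans <|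
    Finset.single_le_sum (f := fun p => slice δ lam al s p (l - p) w t)
      (fun _ _ => slice_nonneg ht _ _) (Finset.mem_range.2 (by omega))

theorem slice_le {p j : ℕ} {b : ℝ} (h : ∀ i, ∀ p' ≤ p, ∀ q ≤ j,
    ∫ x, t ^ (2 * (lam i x - al i x + s q)) * (mixedDeriv δ p' q (w i) t x) ^ 2 ∂measU ≤ b) :
    slice δ lam al s p j w t ≤ N * ((p + 1) * (j + 1)) * b := by
  calc slice δ lam al s p j w t
      ≤ Finset.card (Finset.univ : Finset (Fin N)) • (Finset.range (p + 1)).card •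
          (Finset.range (j + 1)).card • b :=
        Finset.sum_le_card_nsmul _ _ _ fun i _ => Finset.sum_le_card_nsmul _ _ _ fun p' hp' =>
          Finset.sum_le_card_nsmul _ _ _ fun q hq =>
            h i p' (Finset.mem_range_succ_iff.1 hp') q (Finset.mem_range_succ_iff.1 hq)
    _ = N * ((p + 1) * (j + 1)) * b := by
        simp only [Finset.card_univ, Fintype.card_fin, Finset.card_range, nsmul_eq_mul,
          Nat.cast_add_one]
        ring

theorem exists_energy_le (N l : ℕ) : ∃ K, 0 ≤ K ∧ ∀ (δ : ℝ) (lam al : Fin N → ℝ → ℝ) (s : ℕ → ℝ)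
    (w : Fin N → ℝ → ℝ → ℝ) (t b : ℝ), (∀ i, Continuous (lam i)) → (∀ i, Continuous (al i)) →
    0 < t → 0 ≤ b → (∀ i p q, p + q ≤ l →
      t ^ s q * weightedNorm (fun x => al i x - lam i x) t (mixedDeriv δ p q (w i) t) ≤ b) →
    energy δ lam al s l w t ≤ K * b := by
  refine ⟨√(∑ p ∈ Finset.range (l + 1), N * ((p + 1) * ((l - p : ℕ) + 1))), Real.sqrt_nonneg _,
    fun δ lam al s w t b hl ha ht hb h => ?_⟩
  refine Real.sqrt_le_iff.2 ⟨by positivity, ?_⟩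
  rw [mul_pow, Real.sq_sqrt (by positivity), Finset.sum_mul]
  refine Finset.sum_le_sum fun p hp => slice_le fun i p' hp' q hq => ?_
  rw [slice_term_eq_sq_weightedNorm hl ha ht]
  have hpl := Finset.mem_range_succ_iff.1 hp
  exact pow_le_pow_left₀ (mul_nonneg (Real.rpow_nonneg ht.le _) (weightedNorm_nonneg _ _ _))
    (h i p' q (by omega)) 2

theorem energy_le_of_wnorm_le {r : ℝ} (hr : 0 ≤ r) (ht : t ∈ Ioc 0 δ)
    (h : wnorm δ lam al s l w ≤ ENNReal.ofReal r) : energy δ lam al s l w t ≤ r := by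
  have hslice : ∀ p j, 0 ≤ slice δ lam al s p j w t := slice_nonneg ht.1
  rw [← ENNReal.ofReal_le_ofReal_iff hr]
  refine le_trans ?_ h
  rw [energy, wnorm, Real.sqrt_eq_rpow, ← ENNReal.ofReal_rpow_of_nonneg
    (Finset.sum_nonneg fun _ _ => hslice _ _) one_half_pos.le,
    ENNReal.ofReal_sum_of_nonneg fun _ _ => hslice _ _]
  refine ENNReal.rpow_le_rpow (Finset.sum_le_sum fun p _ => ?_) one_half_pos.le
  rw [← Real.sq_sqrt (hslice p (l - p)), ENNReal.ofReal_pow (Real.sqrt_nonneg _)]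
  exact pow_le_pow_left₀ zero_le (le_iSup₂ (f := fun t (_ : t ∈ Ioc 0 δ) =>
    ENNReal.ofReal √(slice δ lam al s p (l - p) w t)) t ht) 2

theorem wnorm_lt_top {b : ℝ} (h : ∀ t ∈ Ioc 0 δ, energy δ lam al s l w t ≤ b) :
    wnorm δ lam al s l w < ⊤ := by
  refine ENNReal.rpow_lt_top_of_nonneg one_half_pos.le <| ne_of_lt <|
    ENNReal.sum_lt_top.2 fun p hp => ENNReal.pow_lt_top ?_
  refine (iSup₂_le fun t ht => ENNReal.ofReal_le_ofReal ?_).trans_lt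
    (ENNReal.ofReal_lt_top (r := b))
  exact (Real.sqrt_le_sqrt <| Finset.single_le_sum
    (f := fun p => slice δ lam al s p (l - p) w t) (fun _ _ => slice_nonneg ht.1 _ _) hp).trans
      (h t ht)

end

theorem continuous_gowdyLam {k : ℝ → ℝ} (hk : Continuous k) :
    ∀ i, Continuous (gowdyLam k i) :=
  Fin.forall_fin_two.2 ⟨continuous_const, continuous_const.mul hk⟩

theorem MemC.sub {δ : ℝ} {p j : ℕ} {w w' : ℝ → ℝ → ℝ} (h : MemC δ p j w) (h' : MemC δ p j w') :
    MemC δ p j (w - w') := by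
  obtain ⟨W, hW, e⟩ := h
  obtain ⟨W', hW', e'⟩ := h'
  exact ⟨fun t => W t - W' t, hW.sub hW', fun t ht =>
    ((e t ht).sub (e' t ht)).trans (Lp.coeFn_sub (sobFn (W t)) (sobFn (W' t))).symm⟩

section

variable {ι : Type*} {T : TimeFamily ι} {N n : ℕ} {lam al : Fin N → ℝ → ℝ} {B : ι → ℝ}

theorem hasTildeBound_of_Et_le {w : ι → Fin N → ℝ → ℝ → ℝ} (hlam : ∀ j, Continuous (lam j))
    (hal : ∀ j, Continuous (al j)) (j : Fin N)
    (hw : ∀ i, ∀ p ≤ n + 1, MemC (T.δ i) p (n + 1 - p) (w i j))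
    (hB : ∀ i, Et (T.δ i) lam al (n + 1) (w i) (T.t i) ≤ B i) :
    HasTildeBound T n (fun x => al j x - lam j x) B (fun i => w i j) where
  memLp i s hs := by
    obtain ⟨W, -, e⟩ := hw i 0 (Nat.zero_le _)
    exact (Lp.memLp (sobFn (W s))).ae_eq (e s hs).symm
  contJet i := .of_curveMemC fun p q hpq => by
    obtain rfl : n + 1 - p = q := by omega
    exact (hw i p (by omega)).curveMemC
  mixed_le i p q hpq := by
    have hle := (weightedNorm_mixedDeriv_le_energy (δ := T.δ i) (s := topWeight (n + 1))
      (w := w i) hlam hal (T.pos i) j hpq).trans (hB i)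
    rwa [topWeight, apply_ite (T.t i ^ ·), Real.rpow_one, Real.rpow_zero] at hle

theorem exists_E_le_of_hasOrder {a κ : Fin N → ℝ → ℝ} {v : ι → Fin N → ℝ → ℝ → ℝ}
    (hlam : ∀ j, Continuous (lam j)) (ha : ∀ j, Continuous (a j)) (hB : ∀ i, 0 ≤ B i)
    (hv : ∀ j, HasOrder T n (κ j) B (fun i => v i j)) (hlt : ∀ j x, a j x - lam j x < κ j x) :
    ∃ C, 0 ≤ C ∧ ∀ i, E (T.δ i) lam a n (v i) (T.t i) ≤ C * B i := by
  obtain ⟨K, hK, hKle⟩ := exists_energy_le N n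
  choose C hC hCle using fun j =>
    (hv j).curveHasOrder.exists_le _ ((ha j).sub (hlam j)) (hlt j)
  refine ⟨K * ∑ j, C j, mul_nonneg hK (Finset.sum_nonneg fun j _ => hC j), fun i => ?_⟩
  rw [mul_assoc]
  refine hKle _ _ _ _ _ _ _ hlam ha (T.pos i)
    (mul_nonneg (Finset.sum_nonneg fun j _ => hC j) (hB i)) fun j p q hpq => ?_
  rw [Pi.zero_apply, Real.rpow_zero, one_mul]
  calc weightedNorm (fun x => a j x - lam j x) (T.t i) (mixedDeriv (T.δ i) p q (v i j) (T.t i))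
      ≤ jetNorm (fun x => a j x - lam j x) (T.δ i) n (fun s => toL2 (v i j s)) (T.t i) :=
        mixed_le_jetNorm hpq
    _ ≤ C j * B i := hCle j i
    _ ≤ (∑ j, C j) * B i := mul_le_mul_of_nonneg_right
        (Finset.single_le_sum (fun j _ => hC j) (Finset.mem_univ j)) (hB i)

end

/-- The exponents `κ` such that the components of `F` are of order `t^κ`, up to an arbitrarily small
loss, on bounded subsets of `X̃_{δ,α,m}`. -/
def gowdyOrder (k Ps : ℝ → ℝ) (α : Fin 2 → ℝ → ℝ) : Fin 2 → ℝ → ℝ :=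
  ![fun x => 2 * (Ps x + min 1 (2 * k x)),
    fun x => min (α 0 x + 2 * k x) (min 1 (α 0 x) + min 1 (α 1 x + 2 * k x))]

theorem lt_gowdyOrder {k Ps : ℝ → ℝ} {α : Fin 2 → ℝ → ℝ} {ε x : ℝ} (hα : 0 < α 1 x) (hε : ε < 1)
    (h1 : α 0 x + ε < min (2 * (Ps x + 2 * k x)) (2 * (Ps x + 1))) (h2 : α 1 x + ε < 2 * (1 - k x))
    (h3 : α 0 x - α 1 x > ε + max 0 (2 * k x - 1)) (j : Fin 2) :
    α j x + ε - gowdyLam k j x < gowdyOrder k Ps α j x := by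
  have hmax₀ := le_max_left 0 (2 * k x - 1)
  have hmax₁ := le_max_right 0 (2 * k x - 1)
  obtain ⟨hP, hP'⟩ := lt_min_iff.1 h1
  fin_cases j
  · change α 0 x + ε - 0 < 2 * (Ps x + min 1 (2 * k x))
    rcases min_choice 1 (2 * k x) with h | h <;> rw [h] <;> linarith
  · change α 1 x + ε - -2 * k x < min (α 0 x + 2 * k x) (min 1 (α 0 x) + min 1 (α 1 x + 2 * k x))
    refine lt_min (by linarith) ?_
    rcases min_choice 1 (α 0 x) with h | h <;>
      rcases min_choice 1 (α 1 x + 2 * k x) with h' | h' <;> rw [h, h'] <;> linarith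

namespace IsAsymptoticData

variable {k Ps Pss Qs Qss : ℝ → ℝ} {α a : Fin 2 → ℝ → ℝ} {n : ℕ}

theorem hasLipOrder_gowdyF (hd : IsAsymptoticData (n + 2) k Ps Pss Qs Qss)
    (hα : ∀ j, Continuous (α j)) (hαpos : ∀ j x, 0 < α j x) {ι : Type*} {T : TimeFamily ι} {r : ℝ}
    {w w' : ι → Fin 2 → ℝ → ℝ → ℝ} (hw : ∀ i, w i ∈ Xt (T.δ i) (gowdyLam k) α (n + 2))
    (hw' : ∀ i, w' i ∈ Xt (T.δ i) (gowdyLam k) α (n + 2))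
    (hr : ∀ i, Et (T.δ i) (gowdyLam k) α (n + 2) (w i) (T.t i) ≤ r)
    (hr' : ∀ i, Et (T.δ i) (gowdyLam k) α (n + 2) (w' i) (T.t i) ≤ r) (j : Fin 2) :
    HasLipOrder T (n + 1) (gowdyOrder k Ps α j)
      (fun i => Et (T.δ i) (gowdyLam k) α (n + 2) (w i - w' i) (T.t i))
      (fun i => gowdyF (T.δ i) k Ps Pss Qs Qss (w i) j)
      (fun i => gowdyF (T.δ i) k Ps Pss Qs Qss (w' i) j) := by
  have hlam := continuous_gowdyLam hd.contDiff.continuous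
  have hlip : ∀ j, HasTildeLipOrder T (n + 1) (fun x => α j x - gowdyLam k j x)
      (fun i => Et (T.δ i) (gowdyLam k) α (n + 2) (w i - w' i) (T.t i))
      (fun i => w i j) (fun i => w' i j) := fun j =>
    (hasTildeBound_of_Et_le hlam hα j (fun i => (hw i).1 j) hr).hasTildeLipOrder
      (hasTildeBound_of_Et_le hlam hα j (fun i => (hw' i).1 j) hr')
      (hasTildeBound_of_Et_le hlam hα j
        (fun i p hp => ((hw i).1 j p hp).sub ((hw' i).1 j p hp)) fun _ => le_rfl)
      ((hα j).sub (hlam j))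
  have h₀ := hlip 0
  have h₁ := hlip 1
  have hκ₀ : (fun x => α 0 x - gowdyLam k 0 x) = α 0 := funext fun x => sub_zero (α 0 x)
  have hκ₁ : (fun x => α 1 x - gowdyLam k 1 x) = fun x => α 1 x + 2 * k x := funext fun x => by
    rw [gowdyLam, Matrix.cons_val_one, Matrix.cons_val_fin_one, neg_mul, sub_neg_eq_add]
  rw [hκ₀] at h₀
  rw [hκ₁] at h₁
  have hκ : ∀ x, 2 * k x ≤ α 1 x + 2 * k x := fun x => le_add_of_nonneg_left (hαpos 1 x).le
  fin_cases j
  · exact hd.hasLipOrder_gowdyF_zero (fun _ => energy_nonneg) (hαpos 0) hκ h₀ h₁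
  · exact hd.hasLipOrder_gowdyF_one (fun _ => energy_nonneg) hκ h₀ h₁

theorem mapsTo_gowdyF (hd : IsAsymptoticData (n + 2) k Ps Pss Qs Qss)
    (hα : ∀ j, Continuous (α j)) (hαpos : ∀ j x, 0 < α j x) (ha : ∀ j, Continuous (a j))
    (hlt : ∀ j x, a j x - gowdyLam k j x < gowdyOrder k Ps α j x) {δ : ℝ} (hδ : 0 < δ) :
    MapsTo (gowdyF δ k Ps Pss Qs Qss) (Xt δ (gowdyLam k) α (n + 2))
      (X δ (gowdyLam k) a (n + 1)) := by
  intro w hw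
  let T : TimeFamily (Ioc 0 δ) := ⟨fun _ => δ, fun t => t, δ, fun t => t.2, fun _ => le_rfl⟩
  have hr : ∀ t : Ioc 0 δ, Et δ (gowdyLam k) α (n + 2) w t ≤
      (normXt δ (gowdyLam k) α (n + 2) w).toReal := fun t =>
    energy_le_of_wnorm_le ENNReal.toReal_nonneg t.2 (ENNReal.ofReal_toReal hw.2.ne).ge
  have hF := fun j => (hd.hasLipOrder_gowdyF hα hαpos (T := T) (fun _ => hw) (fun _ => hw)
    hr hr j).left
  obtain ⟨C, -, hC⟩ := exists_E_le_of_hasOrder (continuous_gowdyLam hd.contDiff.continuous) ha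
    (fun _ => zero_le_one) hF hlt
  refine ⟨fun j p hp => ?_, wnorm_lt_top fun t ht => hC ⟨t, ht⟩⟩
  let i : Ioc 0 δ := ⟨δ, hδ, le_rfl⟩
  have hjet := (hF j).curveHasOrder.contJet i
  rw [← Nat.add_sub_cancel' hp] at hjet
  exact hjet.curveMemC.memC ((hF j).memLp i)

theorem exists_E_gowdyF_sub_le (hd : IsAsymptoticData (n + 2) k Ps Pss Qs Qss)
    (hα : ∀ j, Continuous (α j)) (hαpos : ∀ j x, 0 < α j x) (ha : ∀ j, Continuous (a j))
    (hlt : ∀ j x, a j x - gowdyLam k j x < gowdyOrder k Ps α j x) (δ₀ : ℝ) {r : ℝ} (hr : 0 ≤ r) :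
    ∃ C, 0 ≤ C ∧ ∀ δ ≤ δ₀, ∀ w ∈ Xt δ (gowdyLam k) α (n + 2), ∀ w' ∈ Xt δ (gowdyLam k) α (n + 2),
      normXt δ (gowdyLam k) α (n + 2) w ≤ ENNReal.ofReal r →
      normXt δ (gowdyLam k) α (n + 2) w' ≤ ENNReal.ofReal r → ∀ t ∈ Ioc 0 δ,
        E δ (gowdyLam k) a (n + 1)
            (gowdyF δ k Ps Pss Qs Qss w - gowdyF δ k Ps Pss Qs Qss w') t ≤
          C * Et δ (gowdyLam k) α (n + 2) (w - w') t := by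
  let W := Fin 2 → ℝ → ℝ → ℝ
  let ball (δ : ℝ) : Set W :=
    {w ∈ Xt δ (gowdyLam k) α (n + 2) | normXt δ (gowdyLam k) α (n + 2) w ≤ ENNReal.ofReal r}
  let T : TimeFamily {i : ℝ × ℝ × W × W //
      i.1 ≤ δ₀ ∧ i.2.1 ∈ Ioc 0 i.1 ∧ i.2.2.1 ∈ ball i.1 ∧ i.2.2.2 ∈ ball i.1} :=
    ⟨fun i => i.1.1, fun i => i.1.2.1, δ₀, fun i => i.2.2.1, fun i => i.2.1⟩
  obtain ⟨C, hC, hle⟩ := exists_E_le_of_hasOrder (T := T)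
    (v := fun i => gowdyF i.1.1 k Ps Pss Qs Qss i.1.2.2.1 - gowdyF i.1.1 k Ps Pss Qs Qss i.1.2.2.2)
    (continuous_gowdyLam hd.contDiff.continuous) ha (fun _ => energy_nonneg) (fun j =>
      (hd.hasLipOrder_gowdyF hα hαpos (fun i => i.2.2.2.1.1) (fun i => i.2.2.2.2.1)
        (fun i => energy_le_of_wnorm_le hr i.2.2.1 i.2.2.2.1.2)
        (fun i => energy_le_of_wnorm_le hr i.2.2.1 i.2.2.2.2.2) j).diff) hlt
  exact ⟨C, hC, fun δ hδ w hw w' hw' hwr hwr' t ht =>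
    hle ⟨(δ, t, w, w'), hδ, ht, ⟨hw, hwr⟩, ⟨hw', hwr'⟩⟩⟩

end IsAsymptoticData

end GowdyFuchs

end

theorem lemma4p1
    (k : ℝ → ℝ) (hk : ContDiff ℝ ∞ k) (hkper : Function.Periodic k (2 * Real.pi))
    (hkpos : ∀ x, 0 < k x)
    (m : ℕ) (hm : 2 ≤ m)
    (Ps Pss Qs Qss : ℝ → ℝ)
    (hPs : MemSobolev m Ps) (hPss : MemSobolev m Pss)
    (hQs : MemSobolev m Qs) (hQss : MemSobolev m Qss)
    (hPscont : Continuous Ps) (hPsper : Function.Periodic Ps (2 * Real.pi))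
    (α : Fin 2 → ℝ → ℝ) (hαcont : ∀ i, Continuous (α i))
    (hαper : ∀ i, Function.Periodic (α i) (2 * Real.pi)) (hαpos : ∀ i x, 0 < α i x)
    (ε : ℝ) (hε : 0 < ε) (hε1 : ε < 1)
    (h1 : ∀ x, α 0 x + ε < min (2 * (Ps x + 2 * k x)) (2 * (Ps x + 1)))
    (h2 : ∀ x, α 1 x + ε < 2 * (1 - k x))
    (h3 : ∀ x, α 0 x - α 1 x > ε + max 0 (2 * k x - 1)) :
    (∀ δ : ℝ, 0 < δ →
      MapsTo (gowdyF δ k Ps Pss Qs Qss) (Xt δ (gowdyLam k) α m)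
        (X δ (gowdyLam k) (fun i x => α i x + ε) (m - 1))) ∧
    (∀ δ₀ : ℝ, 0 < δ₀ → ∀ r : ℝ, 0 < r → ∃ C : ℝ, 0 < C ∧
      ∀ δ : ℝ, 0 < δ → δ ≤ δ₀ →
        ∀ w ∈ Xt δ (gowdyLam k) α m, ∀ w' ∈ Xt δ (gowdyLam k) α m,
          normXt δ (gowdyLam k) α m w ≤ ENNReal.ofReal r →
          normXt δ (gowdyLam k) α m w' ≤ ENNReal.ofReal r →
          ∀ t ∈ Ioc 0 δ,
            E δ (gowdyLam k) (fun i x => α i x + ε) (m - 1)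
                (gowdyF δ k Ps Pss Qs Qss w - gowdyF δ k Ps Pss Qs Qss w') t
              ≤ C * Et δ (gowdyLam k) α m (w - w') t) := by
  obtain ⟨n, rfl⟩ : ∃ n, m = n + 2 := ⟨m - 2, (Nat.sub_add_cancel hm).symm⟩
  have hd : IsAsymptoticData (n + 2) k Ps Pss Qs Qss :=
    ⟨hk, hkper, hkpos, hPs, hPss, hQs, hQss, hPscont⟩
  have ha : ∀ j, Continuous fun x => α j x + ε := fun j => (hαcont j).add continuous_const
  have hlt : ∀ j x, α j x + ε - gowdyLam k j x < gowdyOrder k Ps α j x := fun j x =>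
    lt_gowdyOrder (hαpos 1 x) hε1 (h1 x) (h2 x) (h3 x) j
  refine ⟨fun δ hδ => hd.mapsTo_gowdyF hαcont hαpos ha hlt hδ, fun δ₀ _ r hr => ?_⟩
  obtain ⟨C, hC, hle⟩ := hd.exists_E_gowdyF_sub_le hαcont hαpos ha hlt δ₀ hr.le
  refine ⟨C + 1, by linarith, fun δ _ hδ w hw w' hw' hwr hwr' t ht => ?_⟩
  exact (hle δ hδ w hw w' hw' hwr hwr' t ht).trans
    (mul_le_mul_of_nonneg_right (by linarith) energy_nonneg)
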